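/- Let $\mathcal R$ be Siegel's (Riemann's) auxiliary function, the entire function \[ \mathcal R(s)=\int_{0\swarrow 1}\frac{x^{-s}e^{\pi i x^2}}{e^{\pi i x}-e^{-\pi i x}}\,dx , \] where the path is the straight line through $\tfrac12$ of slope $1$, run through from the upper right to the lower left, and $x^{-s}$ is the principal branch. Let $\sigma$ be a real number, let $\zeta$ be the Riemann zeta function and $\gamma$ Euler's constant. When $T\to+\infty$, we have, with implied constants that may depend on $\sigma$ but not on $T$, \[ \frac1T\int_0^T|\mathcal R(\sigma+it)|^2\,dt= \begin{cases} \frac{2}{(1-2\sigma)(3-2\sigma)}\left(\frac{T}{2\pi}\right)^{\frac12-\sigma}+O(T^{\frac14-\sigma}),&\text{for }\sigma\le \frac14,\\ \frac{2}{(1-2\sigma)(3-2\sigma)}\left(\frac{T}{2\pi}\right)^{\frac12-\sigma}+\zeta(2\sigma)+O(T^{\frac14-\sigma}),&\text{for }\frac14<\sigma<\frac12,\\ \frac12\log\frac{T}{2\pi}+(\gamma-\tfrac12)+O(T^{-\frac14}\log^{\frac12}T),&\text{for }\sigma=\frac12,\\ \zeta(2\sigma)+\frac{2}{(1-2\sigma)(3-2\sigma)}\left(\frac{T}{2\pi}\right)^{\frac12-\sigma}+O(T^{-\frac{\sigma}{2}}),&\text{for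 }\frac12<\sigma<1,\\ \zeta(2)+O(T^{-\frac12}\log^{\frac12}T),&\text{for }\sigma=1,\\ \zeta(2\sigma)+O(T^{-\frac{\sigma}{2}}),&\text{for }1<\sigma<2,\\ \zeta(2\sigma)+O(T^{-1}),&\text{for }\sigma\ge 2. \end{cases} \] -/

import Mathlib

open Filter Asymptotics

noncomputable section

/-- The point with parameter `u` on the straight line through `1/2` of slope `1`. As `u` increases
the line is run through from the upper right to the lower left; it crosses the real axis only
at `1/2`. -/
def siegelLine (u : ℝ) : ℂ :=
  1 / 2 - (u : ℂ) * Complex.exp (Real.pi / 4 * Complex.I)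

/-- The integrand `x ^ (-s) e^{π i x²} / (e^{π i x} - e^{-π i x})`, with the principal branch of the
power. -/
def siegelIntegrand (s x : ℂ) : ℂ :=
  x ^ (-s) * Complex.exp (Real.pi * Complex.I * x ^ 2) /
    (Complex.exp (Real.pi * Complex.I * x) - Complex.exp (-(Real.pi * Complex.I * x)))

/-- Siegel's (Riemann's) auxiliary function: the contour integral of `siegelIntegrand s` along
`siegelLine`, whose constant velocity is `-e^{π i / 4}`. -/
def riemannAux (s : ℂ) : ℂ :=
  ∫ u : ℝ, siegelIntegrand s (siegelLine u) * (-Complex.exp (Real.pi / 4 * Complex.I))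

/-- The mean value over `[0, T]` of the square of the modulus on the line of abscissa `σ`. -/
def meanSquare (σ T : ℝ) : ℝ :=
  1 / T * ∫ t in (0 : ℝ)..T, ‖riemannAux ((σ : ℂ) + (t : ℂ) * Complex.I)‖ ^ 2

end

/-! Moving the line of integration to the right across 1, ..., N picks up the residues `n ^ (-s)`,
so `riemannAux s` is a Dirichlet polynomial of length N plus the integral along the line through N +
1/2 (`riemannAux_eq_sum_add`). At s = σ + it the exponent -it log x + πi x² has its saddle point at
√(t / 2π), and slope 1 is the direction of steepest descent there. With N = ⌊√(t / 2π)⌋ the line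
passes within 1/2 of the saddle point, so the remainder E = R - S is O((1 + t)^(-σ/2))
(`exists_remainder_bound`), where R is the auxiliary function and S the Dirichlet polynomial.

In the mean square of S the n-th term is present only for t ≥ 2πn². The diagonal therefore gives the
sum of n^(-2σ) (T - 2πn²) over n ≤ X = √(T / 2π). After division by T, Euler summation produces
ζ(2σ), or a logarithm and γ at σ = 1/2, together with X^(1 - 2σ) (1/(1 - 2σ) - 1/(3 - 2σ)), the
power of T in the theorem. The pairs m ≠ n are bounded by (mn)^(-σ) / |log(n/m)|, summed in
`exists_offDiagSum_le` and `exists_offDiagSum_le_const`.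

The passage from S to R costs 2|S||E| + |E|². For σ ≤ 1 a weighted arithmetic-geometric inequality
(`exists_abs_meanSquare_sub_le`) plays the role of Cauchy-Schwarz. For σ > 1 the sum S is bounded,
and integrating |E| directly is better (`exists_meanSquare_sub_le_of_one_lt`). At σ = 2 that would
lose a logarithm, because |E| is only bounded by a multiple of 1/(1 + t). There the cross term ∫ R
conj(S) is evaluated up to O(1) by shifting each integral of n^s R(s) to abscissa 5/2, where the
remainder is integrable (`exists_norm_cross_sub_le`). -/

namespace SiegelAux

open MeasureTheory Set Topology
open scoped ComplexConjugate

noncomputable section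

/-! ### The denominator of the integrand -/

/-- The denominator of `siegelIntegrand`. -/
def siegelDenom (x : ℂ) : ℂ :=
  Complex.exp (Real.pi * Complex.I * x) - Complex.exp (-(Real.pi * Complex.I * x))

/-- The direction `e^{π i / 4}` of the lines of integration. -/
def diagDir : ℂ := Complex.exp (Real.pi / 4 * Complex.I)

/-- The common value `√2 / 2` of the real and the imaginary part of `diagDir`. -/
def halfSqrt : ℝ := √2 / 2

lemma halfSqrt_pos : 0 < halfSqrt := by unfold halfSqrt; positivity

lemma halfSqrt_sq : halfSqrt ^ 2 = 1 / 2 := by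
  unfold halfSqrt; rw [div_pow, Real.sq_sqrt (by norm_num)]; norm_num

lemma halfSqrt_lt_one : halfSqrt < 1 := by
  nlinarith [halfSqrt_sq, halfSqrt_pos]

lemma half_lt_halfSqrt : 1 / 2 < halfSqrt := by
  nlinarith [halfSqrt_sq, halfSqrt_pos]

lemma diagDir_eq : diagDir = halfSqrt + halfSqrt * Complex.I := by
  unfold diagDir halfSqrt
  have : (Real.pi / 4 * Complex.I : ℂ) = ((Real.pi / 4 : ℝ) : ℂ) * Complex.I := by push_cast; rfl
  rw [this, Complex.exp_mul_I, ← Complex.ofReal_cos, ← Complex.ofReal_sin, Real.cos_pi_div_four,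
    Real.sin_pi_div_four]

lemma diagDir_re : diagDir.re = halfSqrt := by simp [diagDir_eq]

lemma diagDir_im : diagDir.im = halfSqrt := by simp [diagDir_eq]

lemma norm_diagDir : ‖diagDir‖ = 1 := by
  unfold diagDir
  rw [Complex.norm_exp]; simp

lemma diagDir_ne_zero : diagDir ≠ 0 := Complex.exp_ne_zero _

lemma siegelDenom_eq (x : ℂ) : siegelDenom x = 2 * Complex.I * Complex.sin (Real.pi * x) := by
  unfold siegelDenom
  rw [Complex.sin]
  have h1 : -(Real.pi * x) * Complex.I = -(Real.pi * Complex.I * x) := by ring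
  have h2 : (Real.pi * x) * Complex.I = (Real.pi * Complex.I * x) := by ring
  rw [h1, h2]
  linear_combination (Complex.exp (Real.pi * Complex.I * x) -
    Complex.exp (-(Real.pi * Complex.I * x))) * Complex.I_sq

lemma norm_siegelDenom_sq (x : ℂ) : ‖siegelDenom x‖ ^ 2 =
    4 * (Real.sinh (Real.pi * x.im) ^ 2 + Real.sin (Real.pi * x.re) ^ 2) := by
  rw [← Complex.normSq_eq_norm_sq, Complex.normSq_apply]
  have h1 : (siegelDenom x).re = - 2 * Real.cos (Real.pi * x.re) * Real.sinh (Real.pi * x.im) := by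
    simp only [siegelDenom, Complex.sub_re, Complex.exp_re, Complex.neg_re, Complex.neg_im]
    simp only [Complex.mul_re, Complex.mul_im, Complex.ofReal_re, Complex.ofReal_im, Complex.I_re,
      Complex.I_im, Real.sinh_eq]
    simp only [mul_zero, zero_mul, sub_zero, add_zero, mul_one, zero_add, zero_sub, neg_neg,
      Real.cos_neg]
    ring
  have h2 : (siegelDenom x).im = 2 * Real.sin (Real.pi * x.re) * Real.cosh (Real.pi * x.im) := by
    simp only [siegelDenom, Complex.sub_im, Complex.exp_im, Complex.neg_re, Complex.neg_im]
    simp only [Complex.mul_re, Complex.mul_im, Complex.ofReal_re, Complex.ofReal_im, Complex.I_re,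
      Complex.I_im, Real.cosh_eq]
    simp only [mul_zero, zero_mul, sub_zero, add_zero, mul_one, zero_add, zero_sub, neg_neg,
      Real.sin_neg]
    ring
  rw [h1, h2]
  nlinarith [Real.cosh_sq (Real.pi * x.im), Real.sin_sq_add_cos_sq (Real.pi * x.re)]

lemma sq_le_sinh_sq (y : ℝ) : y ^ 2 ≤ Real.sinh y ^ 2 := by
  rcases le_total 0 y with h | h
  · exact pow_le_pow_left₀ h (Real.self_le_sinh_iff.2 h) 2
  · have := pow_le_pow_left₀ (neg_nonneg.2 h) (Real.self_le_sinh_iff.2 (neg_nonneg.2 h)) 2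
    rw [Real.sinh_neg] at this
    simpa using this

/-- On a line of slope `1` through a half-integer the denominator is bounded below. -/
lemma two_le_norm_siegelDenom {x : ℂ} {k : ℕ} (h : x.re = k + 1 / 2 + x.im) :
    2 ≤ ‖siegelDenom x‖ := by
  have h1 := norm_siegelDenom_sq x
  have h2 : Real.sin (Real.pi * x.re) ^ 2 = Real.cos (Real.pi * x.im) ^ 2 := by
    have : Real.pi * x.re = (Real.pi * x.im + Real.pi / 2) + k * Real.pi := by rw [h]; ring
    rw [this, Real.sin_add_nat_mul_pi, Real.sin_add_pi_div_two, mul_pow, ← pow_mul, mul_comm k,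
      pow_mul]
    simp
  -- On this line sin² of π Re x equals cos² of π Im x, while sinh² of π Im x dominates sin² of π Im
  -- x; the two squares thus add up to at least 1.
  have h3 : Real.sin (Real.pi * x.im) ^ 2 ≤ (Real.pi * x.im) ^ 2 :=
    sq_le_sq.2 Real.abs_sin_le_abs
  have h4 := sq_le_sinh_sq (Real.pi * x.im)
  rw [h2] at h1
  have h5 := Real.sin_sq_add_cos_sq (Real.pi * x.im)
  nlinarith [norm_nonneg (siegelDenom x)]

lemma two_le_norm_siegelDenom_of_im {x : ℂ} (h : 1 / 3 ≤ |x.im|) : 2 ≤ ‖siegelDenom x‖ := by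
  have h1 := norm_siegelDenom_sq x
  have h4 := sq_le_sinh_sq (Real.pi * x.im)
  have h5 : 1 ≤ (Real.pi * x.im) ^ 2 := by
    rw [one_le_sq_iff_one_le_abs, abs_mul, abs_of_pos Real.pi_pos]
    nlinarith [Real.pi_gt_three, abs_nonneg x.im]
  nlinarith [norm_nonneg (siegelDenom x), sq_nonneg (Real.sin (Real.pi * x.re))]

lemma siegelIntegrand_eq (s x : ℂ) : siegelIntegrand s x =
    x ^ (-s) * Complex.exp (Real.pi * Complex.I * x ^ 2) / siegelDenom x := rfl

/-! ### Rotated coordinates and Gaussian decay -/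

/-- Rotated coordinates centred at `n`: the lines of slope `1` are the horizontal ones. -/
def rot (n : ℕ) (z : ℂ) : ℂ := n + diagDir * z

lemma rot_re (n : ℕ) (z : ℂ) : (rot n z).re = n + halfSqrt * (z.re - z.im) := by
  simp [rot, diagDir_re, diagDir_im]; ring

lemma rot_im (n : ℕ) (z : ℂ) : (rot n z).im = halfSqrt * (z.re + z.im) := by
  simp [rot, diagDir_re, diagDir_im]; ring

lemma rot_re_sub_im (n : ℕ) (z : ℂ) : (rot n z).re = n - 2 * halfSqrt * z.im + (rot n z).im := by
  rw [rot_re, rot_im]; ring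

/-- The line at height `z.im` meets the real axis at n - √2 `z.im`, which exceeds n - 1 ≥ 0 when
|`z.im`| < √2/2. -/
lemma rot_mem_slitPlane {n : ℕ} (hn : 1 ≤ n) {z : ℂ} (hz : |z.im| < halfSqrt) :
    rot n z ∈ Complex.slitPlane := by
  rw [Complex.mem_slitPlane_iff]
  by_cases h : (rot n z).im = 0
  · left
    rw [rot_re_sub_im, h]
    have : (1 : ℝ) ≤ n := by exact_mod_cast hn
    nlinarith [halfSqrt_sq, halfSqrt_pos, (abs_lt.1 hz).2]
  · exact Or.inr h

lemma abs_log_le {ρ : ℝ} (h : 1 / 4 ≤ ρ) : |Real.log ρ| ≤ ρ + 3 := by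
  have h0 : 0 < ρ := by linarith
  rw [abs_le]
  constructor
  · have := Real.one_sub_inv_le_log_of_pos h0
    have h2 : ρ⁻¹ ≤ 4 := by
      rw [inv_le_comm₀ h0 (by norm_num)]; linarith
    linarith
  · linarith [Real.log_le_sub_one_of_pos h0]

lemma norm_log_rot_le {n : ℕ} (hn : 1 ≤ n) {z : ℂ} (hz : |z.im| ≤ halfSqrt / 2) :
    ‖Complex.log (rot n z)‖ ≤ n + 8 + |z.re| := by
  have hn' : (1 : ℝ) ≤ n := by exact_mod_cast hn
  have hp := halfSqrt_pos
  have hs := halfSqrt_sq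
  have hl := halfSqrt_lt_one
  -- If the imaginary part is below 1/4 in modulus, the real part is at least 1 - 1/2 - 1/4.
  have h1 : 1 / 4 ≤ ‖rot n z‖ := by
    by_cases h : 1 / 4 ≤ |(rot n z).im|
    · exact h.trans (Complex.abs_im_le_norm _)
    · refine le_trans ?_ (Complex.re_le_norm _)
      rw [rot_re_sub_im]
      have h2 := (abs_lt.1 (not_le.1 h)).1
      nlinarith [(abs_le.1 hz).2]
  have h2 : ‖rot n z‖ ≤ n + |z.re| + 1 := by
    unfold rot
    refine (norm_add_le _ _).trans ?_
    rw [norm_mul, norm_diagDir, one_mul, Complex.norm_natCast]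
    have := Complex.norm_le_abs_re_add_abs_im z
    linarith
  refine (Complex.norm_le_abs_re_add_abs_im _).trans ?_
  rw [Complex.log_re, Complex.log_im]
  have := Complex.abs_arg_le_pi (rot n z)
  have := abs_log_le h1
  linarith [Real.pi_lt_four]

/-- Since `diagDir` squares to i, the quadratic part of πi x² is -πz²: this is where the Gaussian
comes from. -/
lemma norm_exp_sq_rot (n : ℕ) (z : ℂ) : ‖Complex.exp (Real.pi * Complex.I * rot n z ^ 2)‖ =
    Real.exp (- Real.pi * (2 * halfSqrt * n * (z.re + z.im) + z.re ^ 2 - z.im ^ 2)) := by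
  rw [Complex.norm_exp]
  congr 1
  have : (Real.pi * Complex.I * rot n z ^ 2).re = - Real.pi * (2 * (rot n z).re * (rot n z).im) := by
    simp [pow_two]; ring
  rw [this, rot_re, rot_im]
  linear_combination (- Real.pi) * 2 * (z.re ^ 2 - z.im ^ 2) * halfSqrt_sq

/-- Gaussian decay of the numerator of the integrand in the strip around `n`. -/
lemma exists_numer_bound (B : ℝ) (n : ℕ) : ∃ K : ℝ, ∀ z : ℂ, ∀ β : ℝ, 1 ≤ n → |z.im| ≤ halfSqrt / 2 →
    β ≤ B → 0 ≤ β → Real.exp (β * ‖Complex.log (rot n z)‖) *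
      ‖Complex.exp (Real.pi * Complex.I * rot n z ^ 2)‖ ≤ K * Real.exp (- z.re ^ 2) := by
  refine ⟨Real.exp (B * (n + 8) + 8 * n + 8 + (B + 8 * n) ^ 2), fun z β hn hz hβ hβ0 ↦ ?_⟩
  rw [norm_exp_sq_rot, ← Real.exp_add, ← Real.exp_add]
  apply Real.exp_le_exp.2
  have hL := norm_log_rot_le hn hz
  have hn' : (1 : ℝ) ≤ n := by exact_mod_cast hn
  have hp := halfSqrt_pos
  have hl := halfSqrt_lt_one
  have h3 := Real.pi_gt_three
  have h4 := Real.pi_lt_four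
  have hv := abs_nonneg z.re
  have h1 : β * ‖Complex.log (rot n z)‖ ≤ B * (n + 8 + |z.re|) := by
    apply mul_le_mul hβ hL (norm_nonneg _) (hβ0.trans hβ)
  have hy : |z.im| ≤ 1 / 2 := by linarith
  have h5 : - Real.pi * (2 * halfSqrt * n * (z.re + z.im)) ≤ 8 * n * (|z.re| + 1) := by
    have e1 : -(z.re + z.im) ≤ |z.re| + 1 := by
      have := neg_abs_le z.re; have := neg_abs_le z.im; linarith
    have e2 : (Real.pi * (2 * halfSqrt * n)) ≤ 8 * n := by
      have : Real.pi * halfSqrt ≤ 4 * 1 := mul_le_mul h4.le hl.le hp.le (by norm_num)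
      nlinarith
    calc - Real.pi * (2 * halfSqrt * n * (z.re + z.im)) = (Real.pi * (2 * halfSqrt * n)) * (-(z.re + z.im)) := by ring
      _ ≤ (Real.pi * (2 * halfSqrt * n)) * (|z.re| + 1) := by
        apply mul_le_mul_of_nonneg_left e1; positivity
      _ ≤ _ := by apply mul_le_mul_of_nonneg_right e2; positivity
  have h6 : Real.pi * z.im ^ 2 ≤ 4 := by
    have : z.im ^ 2 ≤ 1 := by
      rw [← sq_abs]; nlinarith [abs_nonneg z.im]
    nlinarith [sq_nonneg z.im]
  have h7 : 3 * z.re ^ 2 ≤ Real.pi * z.re ^ 2 := by nlinarith [sq_nonneg z.re]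
  -- Of the 3v² supplied by π > 3, where v = `z.re`, one v² absorbs the terms linear in |v| and one
  -- is kept for the final Gaussian.
  have h8 : (B + 8 * n) * |z.re| ≤ (B + 8 * n) ^ 2 + z.re ^ 2 := by
    rw [← sq_abs z.re]; nlinarith [sq_nonneg ((B + 8 * n) - |z.re|), sq_nonneg ((B + 8 * n) + |z.re|)]
  nlinarith [sq_nonneg z.re]

/-- The integrand in the rotated coordinates around `n`. -/
def rotIntegrand (s : ℂ) (n : ℕ) (z : ℂ) : ℂ := siegelIntegrand s (rot n z) * diagDir

/-- The numerator of the integrand. -/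
def siegelNumer (s x : ℂ) : ℂ := x ^ (-s) * Complex.exp (Real.pi * Complex.I * x ^ 2)

lemma norm_cpow_neg_le {x : ℂ} (hx : x ≠ 0) (s : ℂ) :
    ‖x ^ (-s)‖ ≤ Real.exp (‖s‖ * ‖Complex.log x‖) := by
  rw [Complex.cpow_def_of_ne_zero hx, Complex.norm_exp]
  apply Real.exp_le_exp.2
  refine (Complex.re_le_norm _).trans ?_
  rw [norm_mul, norm_neg, mul_comm]

lemma exists_norm_rotIntegrand_le (s : ℂ) (n : ℕ) (hn : 1 ≤ n) : ∃ K : ℝ, ∀ z : ℂ,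
    |z.im| ≤ halfSqrt / 2 → 2 ≤ ‖siegelDenom (rot n z)‖ →
      ‖rotIntegrand s n z‖ ≤ K * Real.exp (- z.re ^ 2) := by
  obtain ⟨K, hK⟩ := exists_numer_bound ‖s‖ n
  refine ⟨K, fun z hz hd ↦ ?_⟩
  have hx : rot n z ≠ 0 := Complex.slitPlane_ne_zero
    (rot_mem_slitPlane hn (hz.trans_lt (by linarith [halfSqrt_pos])))
  rw [rotIntegrand, siegelIntegrand_eq, norm_mul, norm_diagDir, mul_one, norm_div, norm_mul]
  refine (div_le_self (by positivity) (by linarith)).trans ?_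
  refine le_trans ?_ (hK z ‖s‖ hn hz le_rfl (norm_nonneg _))
  exact mul_le_mul_of_nonneg_right (norm_cpow_neg_le hx s) (norm_nonneg _)

/-! ### The simple pole at n and its removal -/

lemma siegelDenom_rot (n : ℕ) (z : ℂ) : siegelDenom (rot n z) =
    2 * Complex.I * ((-1) ^ n * Complex.sin (Real.pi * diagDir * z)) := by
  rw [siegelDenom_eq]
  have : (Real.pi * rot n z : ℂ) = Real.pi * diagDir * z + n * Real.pi := by
    unfold rot; ring
  rw [this]
  congr 1
  induction n with
  | zero => simp
  | succ k ih =>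
    have e : (Real.pi * diagDir * z + (k + 1 : ℕ) * Real.pi : ℂ) =
      (Real.pi * diagDir * z + k * Real.pi) + Real.pi := by push_cast; ring
    rw [e, Complex.sin_add_pi, ih, pow_succ]
    · ring
    · unfold rot; ring

/-- The strip is covered by the lines of slope 1 that meet the real axis strictly between n - 1 and
n + 1, so n, that is z = 0, is the only integer in it. -/
lemma sin_diagDir_ne_zero {z : ℂ} (hz : |z.im| < halfSqrt) (h0 : z ≠ 0) :
    Complex.sin (Real.pi * diagDir * z) ≠ 0 := by
  intro h
  obtain ⟨k, hk⟩ := Complex.sin_eq_zero_iff.1 h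
  have hk' : diagDir * z = (k : ℝ) := by
    have hpi : (Real.pi : ℂ) ≠ 0 := by exact_mod_cast Real.pi_ne_zero
    apply mul_left_cancel₀ hpi
    rw [← mul_assoc, hk]; push_cast; ring
  have him := congrArg Complex.im hk'
  have hre := congrArg Complex.re hk'
  simp only [Complex.mul_im, Complex.mul_re, diagDir_re, diagDir_im, Complex.ofReal_im,
    Complex.ofReal_re] at him hre
  have hp := halfSqrt_pos
  have h1 : z.re = - z.im := by
    have : halfSqrt * (z.re + z.im) = 0 := by linarith
    rcases mul_eq_zero.1 this with h | h <;> linarith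
  have h2 : |(k : ℝ)| < 1 := by
    have : (k : ℝ) = - 2 * halfSqrt * z.im := by rw [← hre, h1]; ring
    rw [this, abs_mul, abs_mul]
    simp only [abs_neg, Nat.abs_ofNat, abs_of_pos hp]
    nlinarith [halfSqrt_sq, abs_nonneg z.im]
  have h3 : k = 0 := by
    rw [← Int.abs_lt_one_iff]; exact_mod_cast h2
  rw [h3] at hk'
  simp only [Int.cast_zero, Complex.ofReal_zero, mul_eq_zero, diagDir_ne_zero, false_or] at hk'
  exact h0 hk'

/-- The entire function `sin (π e^{π i / 4} z) / z`. -/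
def sinQuot (z : ℂ) : ℂ := dslope (fun z ↦ Complex.sin (Real.pi * diagDir * z)) 0 z

lemma differentiable_sinQuot : Differentiable ℂ sinQuot := by
  rw [← differentiableOn_univ]
  apply (Complex.differentiableOn_dslope univ_mem).2
  exact Differentiable.differentiableOn (by fun_prop)

lemma sinQuot_zero : sinQuot 0 = Real.pi * diagDir := by
  unfold sinQuot
  rw [dslope_same]
  have : HasDerivAt (fun z : ℂ ↦ Complex.sin (Real.pi * diagDir * z))
      (Complex.cos (Real.pi * diagDir * 0) * (Real.pi * diagDir * 1)) 0 :=
    ((hasDerivAt_id (0 : ℂ)).const_mul (Real.pi * diagDir : ℂ)).csin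
  rw [this.deriv]; simp

lemma mul_sinQuot (z : ℂ) : z * sinQuot z = Complex.sin (Real.pi * diagDir * z) := by
  have := sub_smul_dslope (fun z ↦ Complex.sin (Real.pi * diagDir * z)) 0 z
  simpa [sinQuot] using this

lemma sinQuot_ne_zero {z : ℂ} (hz : |z.im| < halfSqrt) : sinQuot z ≠ 0 := by
  by_cases h : z = 0
  · rw [h, sinQuot_zero]
    exact mul_ne_zero (by exact_mod_cast Real.pi_ne_zero) diagDir_ne_zero
  · intro h0
    apply sin_diagDir_ne_zero hz h
    rw [← mul_sinQuot, h0, mul_zero]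

/-- The function `z ↦ z * rotIntegrand s n z` with the singularity at `0` removed. -/
def regIntegrand (s : ℂ) (n : ℕ) (z : ℂ) : ℂ :=
  siegelNumer s (rot n z) * diagDir / (2 * Complex.I * ((-1) ^ n * sinQuot z))

lemma two_I_mul_ne_zero (n : ℕ) {w : ℂ} (hw : w ≠ 0) : 2 * Complex.I * ((-1) ^ n * w) ≠ 0 := by
  have h1 : ((-1 : ℂ)) ^ n ≠ 0 := pow_ne_zero _ (by norm_num)
  exact mul_ne_zero (mul_ne_zero two_ne_zero Complex.I_ne_zero) (mul_ne_zero h1 hw)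

lemma regIntegrand_eq (s : ℂ) (n : ℕ) {z : ℂ} (hz : |z.im| < halfSqrt) (h0 : z ≠ 0) :
    regIntegrand s n z = z * rotIntegrand s n z := by
  have h2 := two_I_mul_ne_zero n (sinQuot_ne_zero hz)
  unfold regIntegrand rotIntegrand
  rw [siegelIntegrand_eq, siegelDenom_rot, ← mul_sinQuot, siegelNumer]
  have h3 : 2 * Complex.I * ((-1) ^ n * (z * sinQuot z)) = z * (2 * Complex.I * ((-1) ^ n * sinQuot z)) := by
    ring
  rw [h3]
  field_simp

lemma isOpen_strip : IsOpen {z : ℂ | |z.im| < halfSqrt} :=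
  isOpen_lt (by fun_prop) continuous_const

lemma differentiableOn_siegelNumer (s : ℂ) : DifferentiableOn ℂ (siegelNumer s) Complex.slitPlane := by
  intro x hx
  unfold siegelNumer
  apply DifferentiableAt.differentiableWithinAt
  apply DifferentiableAt.mul
  · exact (differentiableAt_id).cpow_const hx
  · fun_prop

lemma differentiableOn_regIntegrand (s : ℂ) {n : ℕ} (hn : 1 ≤ n) :
    DifferentiableOn ℂ (regIntegrand s n) {z : ℂ | |z.im| < halfSqrt} := by
  have hr : Differentiable ℂ (rot n) := by unfold rot; fun_prop
  apply DifferentiableOn.div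
  · apply DifferentiableOn.mul_const
    exact (differentiableOn_siegelNumer s).comp hr.differentiableOn
      (fun z hz ↦ rot_mem_slitPlane hn hz)
  · exact ((differentiable_sinQuot.const_mul _).const_mul _).differentiableOn
  · intro z hz
    exact two_I_mul_ne_zero n (sinQuot_ne_zero hz)

/-- This is the residue of `rotIntegrand` at 0. The sign of exp(πi n²) cancels the sign (-1)^n of
the sine, because n² and n have the same parity. -/
lemma regIntegrand_zero (s : ℂ) (n : ℕ) :
    regIntegrand s n 0 = (n : ℂ) ^ (-s) / (2 * Real.pi * Complex.I) := by
  have hpi : (Real.pi : ℂ) ≠ 0 := by exact_mod_cast Real.pi_ne_zero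
  have h1 : Complex.exp (Real.pi * Complex.I * (n : ℂ) ^ 2) = (-1) ^ n := by
    have : (Real.pi * Complex.I * (n : ℂ) ^ 2) = ((n ^ 2 : ℕ) : ℂ) * (Real.pi * Complex.I) := by
      push_cast; ring
    rw [this, Complex.exp_nat_mul, Complex.exp_pi_mul_I]
    rcases Nat.even_or_odd n with h | h
    · rw [h.neg_one_pow, (h.pow_of_ne_zero (by norm_num)).neg_one_pow]
    · rw [h.neg_one_pow, h.pow.neg_one_pow]
  unfold regIntegrand siegelNumer
  rw [sinQuot_zero]
  simp only [rot, mul_zero, add_zero]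
  rw [h1]
  have h2 : ((-1 : ℂ)) ^ n ≠ 0 := pow_ne_zero _ (by norm_num)
  have h3 := diagDir_ne_zero
  have h4 := Complex.I_ne_zero
  field_simp

/-- The regular part of `rotIntegrand` at `0`. -/
def regPart (s : ℂ) (n : ℕ) (z : ℂ) : ℂ := dslope (regIntegrand s n) 0 z

lemma regPart_eq (s : ℂ) (n : ℕ) {z : ℂ} (hz : |z.im| < halfSqrt) (h0 : z ≠ 0) :
    regPart s n z = rotIntegrand s n z - regIntegrand s n 0 / z := by
  unfold regPart
  rw [dslope_of_ne _ h0, slope_def_field, sub_zero, regIntegrand_eq s n hz h0]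
  field_simp

lemma differentiableOn_regPart (s : ℂ) {n : ℕ} (hn : 1 ≤ n) :
    DifferentiableOn ℂ (regPart s n) {z : ℂ | |z.im| < halfSqrt} :=
  (Complex.differentiableOn_dslope (isOpen_strip.mem_nhds (by simp [halfSqrt_pos]))).2
    (differentiableOn_regIntegrand s hn)

lemma im_mem_strip {z : ℂ} (h : |z.im| ≤ halfSqrt / 2) : |z.im| < halfSqrt :=
  h.trans_lt (by linarith [halfSqrt_pos])

lemma two_le_norm_siegelDenom_rot_upper (n : ℕ) {z : ℂ} (hz : z.im = halfSqrt / 2) :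
    2 ≤ ‖siegelDenom (rot (n + 1) z)‖ := by
  apply two_le_norm_siegelDenom (k := n)
  rw [rot_re_sub_im, hz]; push_cast
  linarith [halfSqrt_sq]

lemma two_le_norm_siegelDenom_rot_lower (n : ℕ) {z : ℂ} (hz : z.im = -(halfSqrt / 2)) :
    2 ≤ ‖siegelDenom (rot n z)‖ := by
  apply two_le_norm_siegelDenom (k := n)
  rw [rot_re_sub_im, hz]
  linarith [halfSqrt_sq]

lemma continuousOn_rotIntegrand (s : ℂ) {n : ℕ} (hn : 1 ≤ n) :
    ContinuousOn (rotIntegrand s n) {z : ℂ | |z.im| < halfSqrt ∧ z ≠ 0} := by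
  have h : ContinuousOn (fun z ↦ regIntegrand s n z / z) {z : ℂ | |z.im| < halfSqrt ∧ z ≠ 0} :=
    ((differentiableOn_regIntegrand s hn).continuousOn.mono (fun z hz ↦ hz.1)).div
      continuousOn_id (fun z hz ↦ hz.2)
  apply h.congr
  intro z hz
  change rotIntegrand s n z = regIntegrand s n z / z
  rw [regIntegrand_eq s n hz.1 hz.2, mul_div_cancel_left₀ _ hz.2]

lemma integrable_rotIntegrand_line (s : ℂ) {n : ℕ} (hn : 1 ≤ n) {y : ℝ} (hy : |y| ≤ halfSqrt / 2)
    (hy0 : y ≠ 0) (hd : ∀ v : ℝ, 2 ≤ ‖siegelDenom (rot n (v + y * Complex.I))‖) :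
    Integrable (fun v : ℝ ↦ rotIntegrand s n (v + y * Complex.I)) := by
  obtain ⟨K, hK⟩ := exists_norm_rotIntegrand_le s n hn
  have hint : Integrable (fun v : ℝ ↦ K * Real.exp (- v ^ 2)) := by
    have := (integrable_exp_neg_mul_sq (b := 1) one_pos).const_mul K
    simpa using this
  refine hint.mono' ?_ (Eventually.of_forall fun v ↦ ?_)
  · apply Continuous.aestronglyMeasurable
    refine (continuousOn_rotIntegrand s hn).comp_continuous (by fun_prop) (fun v ↦ ⟨?_, ?_⟩)
    · apply im_mem_strip; simpa using hy
    · intro h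
      have := congrArg Complex.im h
      simp at this; exact hy0 this
  · have := hK (v + y * Complex.I) (by simpa using hy) (hd v)
    simpa using this

/-! ### Shifting the line of integration across an integer -/

lemma integral_lorentz {b : ℝ} (hb : 0 < b) : Integrable (fun v : ℝ ↦ (v ^ 2 + b ^ 2)⁻¹) ∧
    ∫ v : ℝ, (v ^ 2 + b ^ 2)⁻¹ = Real.pi / b := by
  have h1 : (fun v : ℝ ↦ (v ^ 2 + b ^ 2)⁻¹) = fun v ↦ (b ^ 2)⁻¹ * (1 + (v / b) ^ 2)⁻¹ := by
    ext v; rw [← mul_inv]; congr 1; field_simp; ring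
  rw [h1]
  constructor
  · exact (integrable_inv_one_add_sq.comp_div hb.ne').const_mul _
  · rw [integral_const_mul, Measure.integral_comp_div (fun v : ℝ ↦ (1 + v ^ 2)⁻¹) b,
      integral_univ_inv_one_add_sq, abs_of_pos hb, smul_eq_mul]
    field_simp

/-- The polar part A/z is treated by hand: its difference on the lines at heights -b and b is a
Lorentz kernel with integral 2πiA. Cauchy's theorem is then needed only for the holomorphic
`regPart`. -/
lemma sub_pole_lines {b : ℝ} (hb : 0 < b) (A : ℂ) (v : ℝ) :
    A / ((v : ℂ) + ((-b : ℝ) : ℂ) * Complex.I) - A / ((v : ℂ) + (b : ℂ) * Complex.I) =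
      A * (2 * b * Complex.I) * (((v ^ 2 + b ^ 2)⁻¹ : ℝ) : ℂ) := by
  have h1 : (v : ℂ) + ((-b : ℝ) : ℂ) * Complex.I ≠ 0 := by
    intro h; have := congrArg Complex.im h; simp at this; exact hb.ne' this
  have h2 : (v : ℂ) + (b : ℂ) * Complex.I ≠ 0 := by
    intro h; have := congrArg Complex.im h; simp at this; exact hb.ne' this
  have h3 : (((v ^ 2 + b ^ 2)⁻¹ : ℝ) : ℂ) =
      (((v : ℂ) + ((-b : ℝ) : ℂ) * Complex.I) * ((v : ℂ) + (b : ℂ) * Complex.I))⁻¹ := by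
    push_cast; congr 1; linear_combination (b : ℂ) ^ 2 * Complex.I_sq
  rw [h3, div_sub_div _ _ h1 h2, div_eq_mul_inv]
  push_cast; ring

/-- On a short side the integrand has Gaussian size and the subtracted pole is O(1/|R|), so these
sides vanish in the limit. -/
lemma norm_side_le (s : ℂ) {n : ℕ} (hn : 1 ≤ n) : ∃ K : ℝ, ∀ R : ℝ, 2 ≤ |R| →
    ‖∫ y in (-(halfSqrt / 2))..(halfSqrt / 2), regPart s n (R + y * Complex.I)‖ ≤ K / |R| := by
  obtain ⟨K, hK⟩ := exists_norm_rotIntegrand_le s n hn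
  have hp := halfSqrt_pos
  refine ⟨(|K| + ‖regIntegrand s n 0‖) * |halfSqrt / 2 - -(halfSqrt / 2)|, fun R hR ↦ ?_⟩
  have hR0 : 0 < |R| := by linarith
  rw [mul_div_right_comm]
  apply intervalIntegral.norm_integral_le_of_norm_le_const
  intro y hy
  rw [uIoc_of_le (by linarith)] at hy
  have hy' : |y| ≤ halfSqrt / 2 := abs_le.2 ⟨hy.1.le, hy.2⟩
  have hz : |((R : ℂ) + y * Complex.I).im| ≤ halfSqrt / 2 := by simpa using hy'
  have hre : |R| ≤ ‖(R : ℂ) + y * Complex.I‖ := by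
    simpa using Complex.abs_re_le_norm ((R : ℂ) + y * Complex.I)
  have h0 : (R : ℂ) + y * Complex.I ≠ 0 := by
    rw [← norm_pos_iff]; linarith
  rw [regPart_eq s n (im_mem_strip hz) h0]
  have hd : 2 ≤ ‖siegelDenom (rot n (R + y * Complex.I))‖ := by
    -- With |R| ≥ 2 and |y| ≤ √2/4 the height √2/2 · |R + y| is well above 1/3.
    apply two_le_norm_siegelDenom_of_im
    rw [rot_im, abs_mul, abs_of_pos hp]
    simp only [Complex.add_re, Complex.ofReal_re, Complex.mul_re, Complex.I_re, mul_zero,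
      Complex.ofReal_im, Complex.I_im, mul_one, sub_self, add_zero, Complex.add_im, Complex.mul_im,
      zero_add]
    have h1 : |R| - |y| ≤ |R + y| := by
      have := abs_sub_abs_le_abs_sub R (-y); simpa using this
    nlinarith [half_lt_halfSqrt, halfSqrt_lt_one]
  have h1 := hK _ hz hd
  have h2 : Real.exp (-((R : ℂ) + y * Complex.I).re ^ 2) ≤ 1 / |R| := by
    rw [Real.exp_neg, ← one_div]
    apply one_div_le_one_div_of_le hR0
    simp only [Complex.add_re, Complex.ofReal_re, Complex.mul_re, Complex.I_re, mul_zero,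
      Complex.ofReal_im, Complex.I_im, mul_one, sub_self, add_zero]
    have := Real.add_one_le_exp (R ^ 2)
    rw [← sq_abs] at this ⊢
    nlinarith
  refine (norm_sub_le _ _).trans ?_
  rw [add_div, norm_div]
  apply add_le_add
  · refine h1.trans ?_
    calc K * _ ≤ |K| * (1 / |R|) := mul_le_mul (le_abs_self K) h2 (Real.exp_pos _).le (abs_nonneg _)
      _ = _ := by ring
  · exact div_le_div_of_nonneg_left (norm_nonneg _) hR0 hre

/-- Cauchy's theorem for `regPart` on the rectangle between the two lines leaves only the explicit
integral of the polar part, 2πi times `regIntegrand s n 0`. -/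
lemma integral_line_sub (s : ℂ) {n : ℕ} (hn : 1 ≤ n) :
    (∫ v : ℝ, rotIntegrand s n (v + (-(halfSqrt / 2) : ℝ) * Complex.I)) -
      ∫ v : ℝ, rotIntegrand s n (v + (halfSqrt / 2 : ℝ) * Complex.I) = (n : ℂ) ^ (-s) := by
  obtain ⟨m, rfl⟩ := Nat.exists_eq_add_of_le' hn
  set n := m + 1 with hndef
  have hp := halfSqrt_pos
  set b : ℝ := halfSqrt / 2 with hb
  have hbp : 0 < b := by positivity
  set A := regIntegrand s n 0 with hA
  have hbd : |b| ≤ halfSqrt / 2 := by rw [abs_of_pos hbp]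
  have hbd' : |-b| ≤ halfSqrt / 2 := by rwa [abs_neg]
  have i1 : Integrable (fun v : ℝ ↦ rotIntegrand s n (v + (-b : ℝ) * Complex.I)) :=
    integrable_rotIntegrand_line s hn hbd' (by linarith)
      (fun v ↦ two_le_norm_siegelDenom_rot_lower n (by simp [hb]))
  have i2 : Integrable (fun v : ℝ ↦ rotIntegrand s n (v + b * Complex.I)) :=
    integrable_rotIntegrand_line s hn hbd hbp.ne'
      (fun v ↦ two_le_norm_siegelDenom_rot_upper m (by simp [hb]))
  obtain ⟨l1, l2⟩ := integral_lorentz hbp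
  have i3 : Integrable (fun v : ℝ ↦ A * (2 * b * Complex.I) * (((v ^ 2 + b ^ 2)⁻¹ : ℝ) : ℂ)) :=
    (l1.ofReal).const_mul _
  have key : ∀ R : ℝ, 2 ≤ R → ∫ v in (-R)..R, (rotIntegrand s n (v + (-b : ℝ) * Complex.I) -
      rotIntegrand s n (v + b * Complex.I) - A * (2 * b * Complex.I) * (((v ^ 2 + b ^ 2)⁻¹ : ℝ) : ℂ)) =
      Complex.I * (∫ y in (-b)..b, regPart s n ((-R : ℝ) + y * Complex.I)) -
      Complex.I * (∫ y in (-b)..b, regPart s n (R + y * Complex.I)) := by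
    intro R hR
    have hd : DifferentiableOn ℂ (regPart s n) (uIcc (-R) R ×ℂ uIcc (-b) b) := by
      apply (differentiableOn_regPart s hn).mono
      intro z hz
      apply im_mem_strip
      have := hz.2
      rw [uIcc_of_le (by linarith)] at this
      exact abs_le.2 this
    have hrect := Complex.integral_boundary_rect_eq_zero_of_differentiableOn (regPart s n)
      (⟨-R, -b⟩ : ℂ) (⟨R, b⟩ : ℂ) hd
    simp only [smul_eq_mul] at hrect
    have hc : ∀ y : ℝ, |y| ≤ halfSqrt / 2 → ContinuousOn (fun x : ℝ ↦ regPart s n (x + y * Complex.I))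
        (uIcc (-R) R) := by
      intro y hy
      apply Continuous.continuousOn
      refine (differentiableOn_regPart s hn).continuousOn.comp_continuous (by fun_prop) (fun v ↦ ?_)
      apply im_mem_strip; simpa using hy
    have j1 := (hc (-b) hbd').intervalIntegrable (μ := volume)
    have j2 := (hc b hbd).intervalIntegrable (μ := volume)
    rw [← intervalIntegral.integral_sub j1 j2] at hrect
    have heq : ∀ v : ℝ, rotIntegrand s n (v + (-b : ℝ) * Complex.I) -
        rotIntegrand s n (v + b * Complex.I) - A * (2 * b * Complex.I) * (((v ^ 2 + b ^ 2)⁻¹ : ℝ) : ℂ) =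
        regPart s n (v + (-b : ℝ) * Complex.I) - regPart s n (v + b * Complex.I) := by
      intro v
      rw [← sub_pole_lines hbp, regPart_eq, regPart_eq]
      · ring
      · apply im_mem_strip; simpa using hbd
      · intro h; have := congrArg Complex.im h; simp at this; exact hbp.ne' this
      · apply im_mem_strip; simpa using hbd
      · intro h; have := congrArg Complex.im h; simp at this; exact hbp.ne' this
    simp_rw [heq]
    linear_combination hrect
  have t1 := intervalIntegral_tendsto_integral ((i1.sub i2).sub i3) tendsto_neg_atTop_atBot
    tendsto_id
  have t2 : Tendsto (fun R : ℝ ↦ ∫ v in (-R)..R, (rotIntegrand s n (v + (-b : ℝ) * Complex.I) -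
      rotIntegrand s n (v + b * Complex.I) - A * (2 * b * Complex.I) * (((v ^ 2 + b ^ 2)⁻¹ : ℝ) : ℂ)))
      atTop (𝓝 0) := by
    obtain ⟨K, hK⟩ := norm_side_le s hn
    have t3 : Tendsto (fun R : ℝ ↦ K / R + K / R) atTop (𝓝 0) := by
      have : Tendsto (fun R : ℝ ↦ K / R) atTop (𝓝 0) := tendsto_const_nhds.div_atTop tendsto_id
      simpa using this.add this
    apply squeeze_zero_norm' _ t3
    filter_upwards [eventually_ge_atTop 2] with R hR
    rw [key R hR]
    refine (norm_sub_le _ _).trans ?_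
    rw [norm_mul, norm_mul, Complex.norm_I, one_mul, one_mul]
    have hRa : |R| = R := abs_of_pos (by linarith)
    have e1 := hK (-R) (by rw [abs_neg, hRa]; exact hR)
    have e2 := hK R (by rw [hRa]; exact hR)
    rw [abs_neg, hRa] at e1
    rw [hRa] at e2
    exact add_le_add e1 e2
  have h0 := tendsto_nhds_unique t1 t2
  rw [integral_sub' (i1.sub i2) i3, integral_sub' i1 i2, integral_const_mul, integral_complex_ofReal, l2,
    sub_eq_zero] at h0
  rw [h0, hA, regIntegrand_zero]
  have hpi : (Real.pi : ℂ) ≠ 0 := by exact_mod_cast Real.pi_ne_zero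
  have hbc : (b : ℂ) ≠ 0 := by exact_mod_cast hbp.ne'
  have h4 := Complex.I_ne_zero
  push_cast
  field_simp

/-- The integral along the line of slope `1` through `c`, from the upper right to the lower
left. -/
def lineIntegral (c : ℝ) (s : ℂ) : ℂ :=
  ∫ u : ℝ, siegelIntegrand s (c - u * diagDir) * (-diagDir)

lemma riemannAux_eq_lineIntegral (s : ℂ) : riemannAux s = lineIntegral (1 / 2) s := by
  unfold riemannAux lineIntegral siegelLine diagDir
  push_cast; rfl

lemma lineIntegral_eq (s : ℂ) (n : ℕ) (y : ℝ) :
    lineIntegral (n - 2 * halfSqrt * y) s = - ∫ v : ℝ, rotIntegrand s n (v + y * Complex.I) := by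
  unfold lineIntegral
  -- The substitution v = -y - u reverses the orientation, hence the sign, and recentres the
  -- parameter of the line at n.
  rw [← integral_neg, ← integral_sub_left_eq_self
    (fun v : ℝ ↦ - rotIntegrand s n (v + y * Complex.I)) volume (-y)]
  congr 1
  ext u
  unfold rotIntegrand
  have : ((n - 2 * halfSqrt * y : ℝ) : ℂ) - u * diagDir =
      rot n (((-y - u : ℝ) : ℂ) + y * Complex.I) := by
    apply Complex.ext
    · rw [rot_re]; simp [diagDir_re]; ring
    · rw [rot_im]; simp [diagDir_im]; ring
  rw [this]; ring

lemma lineIntegral_sub_succ (s : ℂ) (k : ℕ) :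
    lineIntegral (k + 1 / 2) s - lineIntegral ((k + 1 : ℕ) + 1 / 2) s = ((k + 1 : ℕ) : ℂ) ^ (-s) := by
  have h1 := integral_line_sub s (n := k + 1) (by omega)
  have e1 : (k : ℝ) + 1 / 2 = (k + 1 : ℕ) - 2 * halfSqrt * (halfSqrt / 2) := by
    push_cast; linarith [halfSqrt_sq]
  have e2 : ((k + 1 : ℕ) : ℝ) + 1 / 2 = (k + 1 : ℕ) - 2 * halfSqrt * (-(halfSqrt / 2)) := by
    push_cast; linarith [halfSqrt_sq]
  rw [e1, e2, lineIntegral_eq, lineIntegral_eq, ← h1]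
  ring

/-- The residue theorem for the shift of the line of integration. -/
theorem riemannAux_eq_sum_add (s : ℂ) (N : ℕ) :
    riemannAux s = ∑ n ∈ Finset.Icc 1 N, (n : ℂ) ^ (-s) + lineIntegral (N + 1 / 2) s := by
  induction N with
  | zero => rw [riemannAux_eq_lineIntegral]; simp
  | succ k ih =>
    rw [ih, Finset.sum_Icc_succ_top (by omega), ← lineIntegral_sub_succ]
    ring

/-! ### The saddle point estimate -/

/-- The argument of `1 + q + i q`. -/
def rayArg (q : ℝ) : ℝ := Complex.arg (1 + q + q * Complex.I)

lemma ray_mem_slitPlane (q : ℝ) : (1 + q + q * Complex.I : ℂ) ∈ Complex.slitPlane := by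
  rw [Complex.mem_slitPlane_iff]
  by_cases h : q = 0
  · left; simp [h]
  · right; simpa using h

lemma quad_pos (q : ℝ) : 1 / 2 ≤ 1 + 2 * q + 2 * q ^ 2 := by nlinarith [sq_nonneg (1 + 2 * q)]

lemma hasDerivAt_rayArg (q : ℝ) : HasDerivAt rayArg (1 / (1 + 2 * q + 2 * q ^ 2)) q := by
  have h0 : HasDerivAt (fun t : ℝ ↦ (t : ℂ)) 1 q := Complex.ofRealCLM.hasDerivAt
  have h1 : HasDerivAt (fun t : ℝ ↦ (1 + t + t * Complex.I : ℂ)) (1 + 1 * Complex.I) q :=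
    (h0.const_add 1).add (h0.mul_const Complex.I)
  have h2 := h1.clog_real (ray_mem_slitPlane q)
  have h3 := (Complex.imCLM.hasFDerivAt.comp_hasDerivAt q h2)
  have h4 : Complex.imCLM ((1 + 1 * Complex.I) / (1 + q + q * Complex.I)) =
      1 / (1 + 2 * q + 2 * q ^ 2) := by
    have hq := quad_pos q
    have hn : Complex.normSq (1 + q + q * Complex.I) = 1 + 2 * q + 2 * q ^ 2 := by
      simp [Complex.normSq_apply]; ring
    rw [Complex.imCLM_apply, Complex.div_im, hn]
    simp
    field_simp
    ring
  rw [h4] at h3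
  refine h3.congr_of_eventuallyEq (Eventually.of_forall fun t ↦ ?_)
  simp [rayArg, Complex.log_im]

lemma rayArg_zero : rayArg 0 = 0 := by simp [rayArg]

lemma abs_rayArg_le (q : ℝ) : |rayArg q| ≤ 2 * |q| := by
  have := (convex_univ (𝕜 := ℝ)).norm_image_sub_le_of_norm_hasDerivWithin_le (f := rayArg)
    (f' := fun q ↦ 1 / (1 + 2 * q + 2 * q ^ 2)) (C := 2) (x := 0) (y := q)
    (fun x _ ↦ (hasDerivAt_rayArg x).hasDerivWithinAt) (fun x _ ↦ by
      have := quad_pos x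
      rw [Real.norm_of_nonneg (by positivity), div_le_iff₀ (by linarith)]
      linarith) (mem_univ _) (mem_univ _)
  simpa [rayArg_zero] using this

/-- The derivative of q + q²/2 - arg has the sign of q, and the difference vanishes at 0. Against
the q + q² coming from exp(πi x²) this bound still leaves a decay of q²/2 for every real q. -/
lemma rayArg_le (q : ℝ) : rayArg q ≤ q + q ^ 2 / 2 := by
  have hd : ∀ x : ℝ, HasDerivAt (fun q ↦ q + q ^ 2 / 2 - rayArg q)
      (x * (3 + 4 * x + 2 * x ^ 2) / (1 + 2 * x + 2 * x ^ 2)) x := by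
    intro x
    have h1 := ((hasDerivAt_id x).add ((hasDerivAt_pow 2 x).div_const 2)).sub (hasDerivAt_rayArg x)
    refine h1.congr_deriv ?_
    have := quad_pos x
    field_simp
    push_cast
    ring
  have h3 : ∀ x : ℝ, 0 < 3 + 4 * x + 2 * x ^ 2 := fun x ↦ by nlinarith [sq_nonneg (1 + x)]
  have hc : Continuous (fun q ↦ q + q ^ 2 / 2 - rayArg q) :=
    continuous_iff_continuousAt.2 fun x ↦ (hd x).continuousAt
  suffices 0 ≤ q + q ^ 2 / 2 - rayArg q by linarith
  have h0 : (0 : ℝ) + 0 ^ 2 / 2 - rayArg 0 = 0 := by simp [rayArg_zero]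
  rcases le_total 0 q with h | h
  · have hm : MonotoneOn (fun q ↦ q + q ^ 2 / 2 - rayArg q) (Ici 0) := by
      apply monotoneOn_of_deriv_nonneg (convex_Ici 0) hc.continuousOn
        (fun x _ ↦ (hd x).differentiableAt.differentiableWithinAt)
      intro x hx
      rw [interior_Ici] at hx
      rw [(hd x).deriv]
      have := quad_pos x
      exact div_nonneg (mul_nonneg (le_of_lt hx) (h3 x).le) (by linarith)
    have := hm (mem_Ici.2 le_rfl) (mem_Ici.2 h) h
    linarith
  · have hm : AntitoneOn (fun q ↦ q + q ^ 2 / 2 - rayArg q) (Iic 0) := by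
      apply antitoneOn_of_deriv_nonpos (convex_Iic 0) hc.continuousOn
        (fun x _ ↦ (hd x).differentiableAt.differentiableWithinAt)
      intro x hx
      rw [interior_Iic] at hx
      rw [(hd x).deriv]
      have := quad_pos x
      exact div_nonpos_of_nonpos_of_nonneg
        (mul_nonpos_of_nonpos_of_nonneg (le_of_lt hx) (h3 x).le) (by linarith)
    have := hm (mem_Iic.2 h) (mem_Iic.2 le_rfl) h
    linarith

lemma abs_log_norm_ray_le (q : ℝ) : |Real.log ‖(1 + q + q * Complex.I : ℂ)‖| ≤ 1 + 2 * |q| := by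
  set ρ := ‖(1 + q + q * Complex.I : ℂ)‖ with hρ
  have h1 : ρ ^ 2 = 1 + 2 * q + 2 * q ^ 2 := by
    rw [hρ, ← Complex.normSq_eq_norm_sq, Complex.normSq_apply]; simp; ring
  have h2 := quad_pos q
  have h0 : 1 / 2 ≤ ρ := by
    have : 0 ≤ ρ := norm_nonneg _
    nlinarith
  have h3 : ρ ≤ 1 + 2 * |q| := by
    have := Complex.norm_le_abs_re_add_abs_im (1 + q + q * Complex.I : ℂ)
    simp at this
    have := abs_add_le 1 q
    simp at this
    linarith
  have hp : 0 < ρ := by linarith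
  rw [abs_le]
  constructor
  · have := Real.one_sub_inv_le_log_of_pos hp
    have h4 : ρ⁻¹ ≤ 2 := by rw [inv_le_comm₀ hp (by norm_num)]; linarith
    linarith [abs_nonneg q]
  · linarith [Real.log_le_sub_one_of_pos hp]

/-- Replacing a² by c² in front of `rayArg` makes the terms linear in q cancel and leaves 2π(-w²/4)
at most. The replacement costs 2π · 3|w|, since a and c differ by at most 1/2. The constants 24 and
3/2 come from 3 < π < 4. -/
lemma saddle_phase_le {t c a w q : ℝ} (ha : 0 ≤ a) (ht : t = 2 * Real.pi * a ^ 2) (hc : 1 / 2 ≤ c)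
    (hac : |a - c| ≤ 1 / 2) (hcq : c * q = halfSqrt * w) :
    t * rayArg q - 2 * Real.pi * c ^ 2 * (q + q ^ 2) ≤ 24 * |w| - 3 / 2 * w ^ 2 := by
  have hcp : 0 < c := by linarith
  have hr := halfSqrt_pos
  have h1 := rayArg_le q
  have h2 := abs_rayArg_le q
  have h3 : (a ^ 2 - c ^ 2) * rayArg q ≤ 3 * (c * |q|) := by
    refine (le_abs_self _).trans ?_
    rw [abs_mul]
    -- The hypotheses c ≥ 1/2 and a ≤ c + 1/2 give a + c ≤ 3c.
    have e : |a ^ 2 - c ^ 2| ≤ 3 / 2 * c := by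
      have : a ^ 2 - c ^ 2 = (a - c) * (a + c) := by ring
      rw [this, abs_mul, abs_of_nonneg (by linarith : 0 ≤ a + c)]
      have := (abs_le.1 hac).2
      have h5 : a + c ≤ 3 * c := by linarith
      calc |a - c| * (a + c) ≤ 1 / 2 * (3 * c) := mul_le_mul hac h5 (by linarith) (by norm_num)
        _ = _ := by ring
    calc _ ≤ 3 / 2 * c * (2 * |q|) := mul_le_mul e h2 (abs_nonneg _) (by linarith)
      _ = _ := by ring
  have h4 : c * |q| ≤ |w| := by
    rw [← abs_of_pos hcp, ← abs_mul, hcq, abs_mul, abs_of_pos hr]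
    nlinarith [abs_nonneg w, halfSqrt_lt_one]
  have h5 : c ^ 2 * q ^ 2 = w ^ 2 / 2 := by
    rw [← mul_pow, hcq, mul_pow, halfSqrt_sq]; ring
  have h6 := Real.pi_gt_three
  have h7 := Real.pi_lt_four
  have h8 : c ^ 2 * rayArg q ≤ c ^ 2 * (q + q ^ 2 / 2) :=
    mul_le_mul_of_nonneg_left h1 (by positivity)
  have h9 : a ^ 2 * rayArg q - c ^ 2 * (q + q ^ 2) ≤ 3 * |w| - w ^ 2 / 4 := by
    linarith
  have h11 := mul_le_mul_of_nonneg_left h9 (by positivity : 0 ≤ 2 * Real.pi)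
  have h12 : Real.pi * |w| ≤ 4 * |w| := mul_le_mul_of_nonneg_right h7.le (abs_nonneg w)
  have h13 : 3 * w ^ 2 ≤ Real.pi * w ^ 2 := mul_le_mul_of_nonneg_right h6.le (sq_nonneg w)
  rw [ht]
  linarith

/-- The integrand on the line of slope `1` through the half-integer next to the saddle point. -/
lemma norm_siegelIntegrand_le {B σ t c a w : ℝ} {N : ℕ} (hσ : |σ| ≤ B) (ha : 0 ≤ a)
    (ht : t = 2 * Real.pi * a ^ 2) (hc : c = N + 1 / 2) (hac : |a - c| ≤ 1 / 2) :
    ‖siegelIntegrand (σ + t * Complex.I) (c + w * diagDir)‖ ≤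
      c ^ (-σ) * (Real.exp (B + (4 * B + 24) ^ 2) * Real.exp (-(1 / 2) * w ^ 2)) := by
  have hN : (0 : ℝ) ≤ N := Nat.cast_nonneg N
  have hc0 : 1 / 2 ≤ c := by linarith
  have hcp : 0 < c := by linarith
  have hr := halfSqrt_pos
  have hB : 0 ≤ B := (abs_nonneg σ).trans hσ
  set q := halfSqrt * w / c with hq
  have hcq : c * q = halfSqrt * w := by rw [hq]; field_simp
  have hx : (c + w * diagDir : ℂ) = c * (1 + q + q * Complex.I) := by
    have : (c : ℂ) * q = halfSqrt * w := by exact_mod_cast hcq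
    rw [diagDir_eq]
    linear_combination (-(1 : ℂ) - Complex.I) * this
  have hray0 : (1 + q + q * Complex.I : ℂ) ≠ 0 := Complex.slitPlane_ne_zero (ray_mem_slitPlane q)
  have hx0 : (c + w * diagDir : ℂ) ≠ 0 := by
    rw [hx]; exact mul_ne_zero (by exact_mod_cast hcp.ne') hray0
  have hqw : |q| ≤ 2 * |w| := by
    rw [hq, abs_div, abs_mul, abs_of_pos hr, abs_of_pos hcp, div_le_iff₀ hcp]
    nlinarith [abs_nonneg w, halfSqrt_lt_one]
  have hre : (c + w * diagDir : ℂ).re = c * (1 + q) := by rw [hx]; simp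
  have him : (c + w * diagDir : ℂ).im = c * q := by rw [hx]; simp
  have hden : 2 ≤ ‖siegelDenom (c + w * diagDir)‖ := by
    apply two_le_norm_siegelDenom (k := N)
    rw [hre, him, hc]; ring
  have harg : Complex.arg (c + w * diagDir) = rayArg q := by
    rw [hx, Complex.arg_real_mul _ hcp, rayArg]
  have hpow : ‖(c + w * diagDir : ℂ) ^ (-(σ + t * Complex.I : ℂ))‖ ≤
      c ^ (-σ) * Real.exp (B * (1 + 2 * |q|)) * Real.exp (t * rayArg q) := by
    rw [Complex.norm_cpow_of_ne_zero hx0, harg]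
    have e1 : (-(σ + t * Complex.I : ℂ)).re = -σ := by simp
    have e2 : (-(σ + t * Complex.I : ℂ)).im = -t := by simp
    rw [e1, e2, mul_neg, Real.exp_neg, div_inv_eq_mul, mul_comm (rayArg q)]
    apply mul_le_mul_of_nonneg_right _ (Real.exp_pos _).le
    rw [hx, norm_mul, Complex.norm_of_nonneg hcp.le,
      Real.mul_rpow hcp.le (norm_nonneg _)]
    apply mul_le_mul_of_nonneg_left _ (by positivity)
    rw [Real.rpow_def_of_pos (norm_pos_iff.2 hray0)]
    apply Real.exp_le_exp.2
    refine (le_abs_self _).trans ?_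
    rw [abs_mul, abs_neg, mul_comm]
    exact mul_le_mul hσ (abs_log_norm_ray_le q) (abs_nonneg _) hB
  have hexp : ‖Complex.exp (Real.pi * Complex.I * (c + w * diagDir) ^ 2)‖ =
      Real.exp (-2 * Real.pi * c ^ 2 * (q + q ^ 2)) := by
    rw [Complex.norm_exp]; congr 1
    have : (Real.pi * Complex.I * (c + w * diagDir : ℂ) ^ 2).re =
        - Real.pi * (2 * (c + w * diagDir : ℂ).re * (c + w * diagDir : ℂ).im) := by
      generalize (c + w * diagDir : ℂ) = x
      simp [pow_two]; ring
    rw [this, hre, him]; ring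
  have hphase : t * rayArg q - 2 * Real.pi * c ^ 2 * (q + q ^ 2) ≤ 24 * |w| - 3 / 2 * w ^ 2 :=
    saddle_phase_le ha ht hc0 hac hcq
  rw [siegelIntegrand_eq, norm_div, norm_mul, hexp]
  have hb1 := mul_le_mul_of_nonneg_right hpow
    (Real.exp_pos (-2 * Real.pi * c ^ 2 * (q + q ^ 2))).le
  refine (div_le_self (by positivity) (by linarith)).trans (hb1.trans ?_)
  rw [mul_assoc, mul_assoc, ← Real.exp_add, ← Real.exp_add, ← Real.exp_add]
  apply mul_le_mul_of_nonneg_left _ (by positivity)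
  apply Real.exp_le_exp.2
  have h1 : B * |q| ≤ B * (2 * |w|) := mul_le_mul_of_nonneg_left hqw hB
  -- The 4B comes from |x / c|^(-σ), whose exponent is at most B(1 + 2|q|) with |q| ≤ 2|w|; the 24
  -- comes from the phase.
  have h2 : (4 * B + 24) * |w| ≤ (4 * B + 24) ^ 2 + w ^ 2 / 2 := by
    rw [← sq_abs w]; nlinarith [sq_nonneg ((4 * B + 24) - |w|), sq_nonneg ((4 * B + 24) + |w|)]
  nlinarith [sq_nonneg w]

lemma exists_lineIntegral_bound (B : ℝ) : ∃ K : ℝ, 0 ≤ K ∧ ∀ (σ t c a : ℝ) (N : ℕ), |σ| ≤ B → 0 ≤ a →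
    t = 2 * Real.pi * a ^ 2 → c = N + 1 / 2 → |a - c| ≤ 1 / 2 →
    ‖lineIntegral c (σ + t * Complex.I)‖ ≤ K * c ^ (-σ) := by
  refine ⟨Real.exp (B + (4 * B + 24) ^ 2) * ∫ w : ℝ, Real.exp (-(1 / 2) * w ^ 2),
    mul_nonneg (Real.exp_pos _).le (integral_nonneg fun _ ↦ (Real.exp_pos _).le),
    fun σ t c a N hσ ha ht hc hac ↦ ?_⟩
  have hi : Integrable (fun w : ℝ ↦ c ^ (-σ) * (Real.exp (B + (4 * B + 24) ^ 2) *
      Real.exp (-(1 / 2) * w ^ 2))) :=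
    ((integrable_exp_neg_mul_sq (by norm_num)).const_mul _).const_mul _
  unfold lineIntegral
  refine (norm_integral_le_of_norm_le hi (Eventually.of_forall fun u ↦ ?_)).trans ?_
  · rw [norm_mul, norm_neg, norm_diagDir, mul_one]
    have := norm_siegelIntegrand_le (w := -u) hσ ha ht hc hac
    have e : (c + ((-u : ℝ) : ℂ) * diagDir : ℂ) = c - u * diagDir := by push_cast; ring
    rw [e] at this
    simpa using this
  · rw [integral_const_mul, integral_const_mul]
    apply le_of_eq; ring

/-- The number of terms of the Dirichlet polynomial approximating `riemannAux` at height `t`. -/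
def cutoff (t : ℝ) : ℕ := ⌊√(t / (2 * Real.pi))⌋₊

lemma le_cutoff_iff {n : ℕ} (hn : 1 ≤ n) {t : ℝ} (ht : 0 ≤ t) :
    n ≤ cutoff t ↔ 2 * Real.pi * n ^ 2 ≤ t := by
  unfold cutoff
  rw [Nat.le_floor_iff (Real.sqrt_nonneg _), Real.le_sqrt (by positivity) (by positivity),
    le_div_iff₀ (by positivity), mul_comm]

/-- The Dirichlet polynomial approximating `riemannAux` at `σ + i t`. -/
def dirichletSum (σ t : ℝ) : ℂ := ∑ n ∈ Finset.Icc 1 (cutoff t), (n : ℂ) ^ (-(σ + t * Complex.I : ℂ))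

/-- It converts c^(-σ) into (1 + t)^(-σ/2) for either sign of σ. The constant 32 is set by c = N +
1/2 at N = 0: with t ≤ 7(N + 1)², the inequality 1 + 7(N + 1)² ≤ 32(N + 1/2)² is an equality there.
-/
lemma rpow_neg_le_of_sq {B σ t c : ℝ} (hσ : |σ| ≤ B) (hc : 0 < c) (ht : 0 ≤ t)
    (h1 : 1 + t ≤ 32 * c ^ 2) (h2 : c ^ 2 ≤ 1 + t) :
    c ^ (-σ) ≤ (32 : ℝ) ^ (B / 2) * (1 + t) ^ (-σ / 2) := by
  have e : c ^ (-σ) = (c ^ 2) ^ (-σ / 2) := by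
    rw [← Real.rpow_natCast, ← Real.rpow_mul hc.le]; congr 1; push_cast; ring
  have hB : 0 ≤ B := (abs_nonneg σ).trans hσ
  rw [e]
  rcases le_total 0 σ with h | h
  · calc (c ^ 2) ^ (-σ / 2) ≤ ((1 + t) / 32) ^ (-σ / 2) := by
          apply Real.rpow_le_rpow_of_nonpos (by positivity) (by linarith) (by linarith)
      _ = (32 : ℝ) ^ (σ / 2) * (1 + t) ^ (-σ / 2) := by
          rw [Real.div_rpow (by positivity) (by norm_num), neg_div,
            Real.rpow_neg (by norm_num : (0 : ℝ) ≤ 32), div_inv_eq_mul, mul_comm]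
      _ ≤ _ := by
          apply mul_le_mul_of_nonneg_right _ (by positivity)
          apply Real.rpow_le_rpow_of_exponent_le (by norm_num)
          linarith [(abs_le.1 hσ).2]
  · calc (c ^ 2) ^ (-σ / 2) ≤ (1 + t) ^ (-σ / 2) :=
          Real.rpow_le_rpow (by positivity) h2 (by linarith)
      _ ≤ _ := le_mul_of_one_le_left (by positivity)
          (Real.one_le_rpow (by norm_num) (by positivity))

/-- `riemannAux` is approximated by a Dirichlet polynomial, uniformly for bounded `σ`. -/
theorem exists_remainder_bound (B : ℝ) : ∃ K : ℝ, 0 ≤ K ∧ ∀ σ t : ℝ, |σ| ≤ B → 0 ≤ t →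
    ‖riemannAux (σ + t * Complex.I) - dirichletSum σ t‖ ≤ K * (1 + t) ^ (-σ / 2) := by
  obtain ⟨K, hK0, hK⟩ := exists_lineIntegral_bound B
  refine ⟨K * (32 : ℝ) ^ (B / 2), by positivity, fun σ t hσ ht ↦ ?_⟩
  have h3 := Real.pi_gt_three
  set a := √(t / (2 * Real.pi)) with ha
  have ha0 : 0 ≤ a := Real.sqrt_nonneg _
  have hta : t = 2 * Real.pi * a ^ 2 := by
    rw [ha, Real.sq_sqrt (by positivity)]; field_simp
  have hf1 : (cutoff t : ℝ) ≤ a := Nat.floor_le ha0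
  have hf2 : a < cutoff t + 1 := Nat.lt_floor_add_one a
  have hN : (0 : ℝ) ≤ cutoff t := Nat.cast_nonneg _
  have h := hK σ t (cutoff t + 1 / 2) a (cutoff t) hσ ha0 hta rfl
    (abs_le.2 ⟨by linarith, by linarith⟩)
  rw [riemannAux_eq_sum_add _ (cutoff t), dirichletSum, add_sub_cancel_left, mul_assoc]
  refine h.trans (mul_le_mul_of_nonneg_left ?_ hK0)
  have hpi : Real.pi ≤ 3.5 := by linarith [Real.pi_lt_d2]
  have hup : t ≤ 7 * a ^ 2 := by rw [hta]; nlinarith [sq_nonneg a]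
  have hlo : 6 * a ^ 2 ≤ t := by rw [hta]; nlinarith [sq_nonneg a]
  generalize (cutoff t : ℝ) = N at *
  apply rpow_neg_le_of_sq hσ (by linarith) ht
  · have : a ^ 2 ≤ (N + 1 : ℝ) ^ 2 := pow_le_pow_left₀ ha0 hf2.le 2
    nlinarith [sq_nonneg a]
  · have : N ^ 2 ≤ a ^ 2 := pow_le_pow_left₀ hN hf1 2
    nlinarith [sq_nonneg (a - 1 / 2)]

/-! ### Analyticity of the auxiliary function -/

lemma hasDerivAt_siegelIntegrand (s : ℂ) {x : ℂ} (hx : x ≠ 0) :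
    HasDerivAt (fun s ↦ siegelIntegrand s x) (-Complex.log x * siegelIntegrand s x) s := by
  have h1 : HasDerivAt (fun s : ℂ ↦ x ^ (-s)) (x ^ (-s) * Complex.log x * (-1)) s :=
    (hasDerivAt_neg s).const_cpow (Or.inl hx)
  have h2 := (h1.mul_const (Complex.exp (Real.pi * Complex.I * x ^ 2))).div_const (siegelDenom x)
  refine h2.congr_deriv ?_
  rw [siegelIntegrand_eq]; ring

/-- Differentiation under the integral sign, with a Gaussian majorant uniform for s in a unit ball.
Besides continuity in t, this permits the later shift of abscissa. -/
theorem differentiable_riemannAux : Differentiable ℂ riemannAux := by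
  intro s₀
  have hb : |halfSqrt / 2| ≤ halfSqrt / 2 := by rw [abs_of_pos (by linarith [halfSqrt_pos])]
  -- In the coordinates centred at 1 the line through 1/2 has height `halfSqrt / 2`.
  set z : ℝ → ℂ := fun v ↦ v + (halfSqrt / 2 : ℝ) * Complex.I with hz
  have hzim : ∀ v, (z v).im = halfSqrt / 2 := fun v ↦ by simp [hz]
  have hzre : ∀ v, (z v).re = v := fun v ↦ by simp [hz]
  have hzc : Continuous z := by simp only [hz]; fun_prop
  have hzs : ∀ v, |(z v).im| ≤ halfSqrt / 2 := fun v ↦ by rw [hzim]; exact hb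
  have hslit : ∀ v, rot 1 (z v) ∈ Complex.slitPlane := fun v ↦
    rot_mem_slitPlane le_rfl (im_mem_strip (hzs v))
  have hz0 : ∀ v, z v ≠ 0 := fun v h ↦ by
    have := hzim v; rw [h] at this; simp at this; linarith [halfSqrt_pos]
  have hR : riemannAux = fun s ↦ - ∫ v : ℝ, rotIntegrand s 1 (z v) := by
    ext s
    rw [riemannAux_eq_lineIntegral, ← lineIntegral_eq]
    congr 1; push_cast; linarith [halfSqrt_sq]
  have hden : ∀ v, 2 ≤ ‖siegelDenom (rot 1 (z v))‖ := fun v ↦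
    two_le_norm_siegelDenom_rot_upper 0 (hzim v)
  have hcont : ∀ s, Continuous (fun v ↦ rotIntegrand s 1 (z v)) := fun s ↦
    (continuousOn_rotIntegrand s le_rfl).comp_continuous hzc
      (fun v ↦ ⟨im_mem_strip (hzs v), hz0 v⟩)
  have hlog : Continuous (fun v ↦ Complex.log (rot 1 (z v))) :=
    Continuous.clog (by unfold rot; fun_prop) hslit
  obtain ⟨K, hK⟩ := exists_numer_bound (‖s₀‖ + 2) 1
  have hgauss : Integrable (fun v : ℝ ↦ K * Real.exp (- v ^ 2)) := by
    have := (integrable_exp_neg_mul_sq (b := 1) one_pos).const_mul K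
    simpa using this
  have hmain := hasDerivAt_integral_of_dominated_loc_of_deriv_le (μ := volume)
    (F := fun s (v : ℝ) ↦ rotIntegrand s 1 (z v))
    (F' := fun s v ↦ -Complex.log (rot 1 (z v)) * rotIntegrand s 1 (z v))
    (bound := fun v ↦ K * Real.exp (- v ^ 2)) (x₀ := s₀) (Metric.ball_mem_nhds s₀ one_pos)
    (Eventually.of_forall fun s ↦ (hcont s).aestronglyMeasurable)
    (integrable_rotIntegrand_line s₀ le_rfl hb (by linarith [halfSqrt_pos]) hden)
    ((hlog.neg.mul (hcont s₀)).aestronglyMeasurable)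
    (Eventually.of_forall fun v s hs ↦ ?_) hgauss
    (Eventually.of_forall fun v s _ ↦ ?_)
  · rw [hR]
    exact hmain.2.neg.differentiableAt
  · have hns : ‖s‖ + 1 ≤ ‖s₀‖ + 2 := by
      have h1 : ‖s - s₀‖ < 1 := by simpa [dist_eq_norm] using hs
      have := norm_le_insert' s s₀
      linarith
    have h := hK (z v) (‖s‖ + 1) le_rfl (hzs v) hns (by positivity)
    rw [hzre] at h
    refine le_trans ?_ h
    set L := ‖Complex.log (rot 1 (z v))‖ with hL
    rw [rotIntegrand, siegelIntegrand_eq, norm_mul, norm_neg, norm_mul, norm_diagDir, mul_one,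
      norm_div, norm_mul]
    have h1 := norm_cpow_neg_le (Complex.slitPlane_ne_zero (hslit v)) s
    rw [← hL] at h1
    -- The logarithm produced by differentiation is absorbed by raising the exponent ‖s‖ by one.
    have h2 : L ≤ Real.exp L := by linarith [Real.add_one_le_exp L]
    calc L * (‖rot 1 (z v) ^ (-s)‖ * ‖Complex.exp (Real.pi * Complex.I * rot 1 (z v) ^ 2)‖ /
          ‖siegelDenom (rot 1 (z v))‖)
        ≤ Real.exp L * (Real.exp (‖s‖ * L) * ‖Complex.exp (Real.pi * Complex.I * rot 1 (z v) ^ 2)‖) := by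
          apply mul_le_mul h2 _ (by positivity) (by positivity)
          refine (div_le_self (by positivity) (by linarith [hden v])).trans ?_
          exact mul_le_mul_of_nonneg_right h1 (norm_nonneg _)
      _ = _ := by rw [← mul_assoc, ← Real.exp_add]; ring_nf
  · have := (hasDerivAt_siegelIntegrand s (Complex.slitPlane_ne_zero (hslit v))).mul_const diagDir
    refine this.congr_deriv ?_
    unfold rotIntegrand; ring

lemma continuous_riemannAux_vertical (σ : ℝ) :
    Continuous (fun t : ℝ ↦ riemannAux (σ + t * Complex.I)) :=
  differentiable_riemannAux.continuous.comp (by fun_prop)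

/-! ### Euler summation and sums of powers -/

lemma hasDerivAt_ofReal_cpow {x : ℝ} (hx : 0 < x) (r : ℂ) :
    HasDerivAt (fun y : ℝ ↦ (y : ℂ) ^ r) (r * (x : ℂ) ^ (r - 1)) x := by
  have h := ((hasDerivAt_id (x : ℂ)).cpow_const (c := r)
    (Complex.ofReal_mem_slitPlane.2 hx)).comp_ofReal
  simpa using h

lemma norm_cpow_sub_le {a x : ℝ} (ha : 0 < a) (hx : x ∈ Icc a (a + 1)) {s : ℂ} (hs : 0 < s.re) :
    ‖(a : ℂ) ^ (-s) - (x : ℂ) ^ (-s)‖ ≤ ‖s‖ * a ^ (-s.re - 1) := by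
  have h := norm_image_sub_le_of_norm_deriv_le_segment' (f := fun y : ℝ ↦ (y : ℂ) ^ (-s))
    (f' := fun y ↦ -s * (y : ℂ) ^ (-s - 1)) (a := a) (b := a + 1) (C := ‖s‖ * a ^ (-s.re - 1))
    (fun y hy ↦ (hasDerivAt_ofReal_cpow (ha.trans_le hy.1) (-s)).hasDerivWithinAt)
    (fun y hy ↦ by
      rw [norm_mul, norm_neg, Complex.norm_cpow_eq_rpow_re_of_pos (ha.trans_le hy.1)]
      apply mul_le_mul_of_nonneg_left _ (norm_nonneg _)
      simp only [Complex.sub_re, Complex.neg_re, Complex.one_re]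
      exact Real.rpow_le_rpow_of_nonpos ha hy.1 (by linarith)) x hx
  rw [norm_sub_rev]
  refine h.trans ?_
  have : 0 ≤ ‖s‖ * a ^ (-s.re - 1) := by positivity
  nlinarith [hx.1, hx.2]

/-- The Euler summation terms `(1 - s) ∫ (k ^ (-s) - x ^ (-s))` over `[k, k + 1]`, `k = n + 1`. -/
def eulerTerm (n : ℕ) (s : ℂ) : ℂ :=
  (1 - s) * ((n + 1 : ℝ) : ℂ) ^ (-s) - (((n + 1 : ℝ) + 1 : ℝ) : ℂ) ^ (1 - s) + ((n + 1 : ℝ) : ℂ) ^ (1 - s)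

/-- With a = n + 1, the term is the increment over [a, a + 1] of (1 - s) a^(-s) y - y^(1 - s), whose
derivative (1 - s)(a^(-s) - y^(-s)) is small by a second application of the mean value inequality.
The gain of one power of a is what gives convergence for Re s > 0. -/
lemma norm_eulerTerm_le (n : ℕ) {s : ℂ} (hs : 0 < s.re) :
    ‖eulerTerm n s‖ ≤ ‖1 - s‖ * ‖s‖ * (n + 1 : ℝ) ^ (-s.re - 1) := by
  have ha : (0 : ℝ) < n + 1 := by positivity
  unfold eulerTerm
  set a : ℝ := n + 1
  have h := norm_image_sub_le_of_norm_deriv_le_segment'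
    (f := fun y : ℝ ↦ (1 - s) * (a : ℂ) ^ (-s) * (y : ℂ) - (y : ℂ) ^ (1 - s))
    (f' := fun y ↦ (1 - s) * (a : ℂ) ^ (-s) * 1 - (1 - s) * (y : ℂ) ^ (1 - s - 1))
    (a := a) (b := a + 1) (C := ‖1 - s‖ * (‖s‖ * a ^ (-s.re - 1)))
    (fun y hy ↦ (((Complex.ofRealCLM.hasDerivAt (x := y)).const_mul _).sub
      (hasDerivAt_ofReal_cpow (ha.trans_le hy.1) (1 - s))).hasDerivWithinAt)
    (fun y hy ↦ by
      have e : (1 - s) * (a : ℂ) ^ (-s) * 1 - (1 - s) * (y : ℂ) ^ (1 - s - 1) =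
        (1 - s) * ((a : ℂ) ^ (-s) - (y : ℂ) ^ (-s)) := by
        have : 1 - s - 1 = -s := by ring
        rw [this]; ring
      rw [e, norm_mul]
      exact mul_le_mul_of_nonneg_left (norm_cpow_sub_le ha ⟨hy.1, hy.2.le⟩ hs) (norm_nonneg _))
    (a + 1) ⟨by linarith, le_rfl⟩
  rw [add_sub_cancel_left, mul_one, ← mul_assoc] at h
  refine le_of_eq_of_le (congrArg _ ?_) h
  push_cast; ring

lemma differentiable_eulerTerm (n : ℕ) : Differentiable ℂ (eulerTerm n) := by
  have ha : (((n + 1 : ℝ) : ℂ)) ≠ 0 := by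
    have : (0 : ℝ) < n + 1 := by positivity
    exact_mod_cast this.ne'
  have hb : ((((n + 1 : ℝ) + 1 : ℝ) : ℂ)) ≠ 0 := by
    have : (0 : ℝ) < (n + 1 : ℝ) + 1 := by positivity
    exact_mod_cast this.ne'
  unfold eulerTerm
  intro s
  refine DifferentiableAt.add (DifferentiableAt.sub (DifferentiableAt.mul (by fun_prop) ?_) ?_) ?_
  · exact DifferentiableAt.const_cpow (by fun_prop) (Or.inl ha)
  · exact DifferentiableAt.const_cpow (by fun_prop) (Or.inl hb)
  · exact DifferentiableAt.const_cpow (by fun_prop) (Or.inl ha)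

lemma sum_eulerTerm (s : ℂ) (M : ℕ) : ∑ n ∈ Finset.range M, eulerTerm n s =
    (1 - s) * ∑ n ∈ Finset.range M, ((n + 1 : ℝ) : ℂ) ^ (-s) - ((M + 1 : ℝ) : ℂ) ^ (1 - s) + 1 := by
  induction M with
  | zero => simp
  | succ M ih =>
    rw [Finset.sum_range_succ, ih, Finset.sum_range_succ, eulerTerm]
    push_cast; ring

lemma summable_succ_rpow {p : ℝ} (hp : p < -1) : Summable (fun n : ℕ ↦ ((n : ℝ) + 1) ^ p) := by
  have := (summable_nat_add_iff 1).2 (Real.summable_nat_rpow.2 hp)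
  simpa using this

lemma summable_eulerTerm {s : ℂ} (hs : 0 < s.re) : Summable (fun n ↦ eulerTerm n s) :=
  Summable.of_norm_bounded ((summable_succ_rpow (by linarith)).mul_left _)
    (fun n ↦ norm_eulerTerm_le n hs)

lemma tendsto_nat_add_one : Tendsto (fun M : ℕ ↦ (M + 1 : ℝ)) atTop atTop :=
  tendsto_atTop_add_const_right _ _ tendsto_natCast_atTop_atTop

/-- The partial sums telescope to (1 - s) Σ k^(-s) - (M + 1)^(1 - s) + 1, and the middle power tends
to 0. The factor 1 - s cancels the pole of zeta, so that the identity can be continued through s =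
1. -/
lemma tsum_eulerTerm_of_one_lt {s : ℂ} (hs : 1 < s.re) :
    ∑' n, eulerTerm n s = 1 - riemannZeta₁ s := by
  have h1 := (summable_eulerTerm (by linarith : 0 < s.re)).hasSum.tendsto_sum_nat
  have h2 : Tendsto (fun M : ℕ ↦ ((M + 1 : ℝ) : ℂ) ^ (1 - s)) atTop (𝓝 0) := by
    rw [tendsto_zero_iff_norm_tendsto_zero]
    have : ∀ M : ℕ, ‖((M + 1 : ℝ) : ℂ) ^ (1 - s)‖ = (M + 1 : ℝ) ^ (-(s.re - 1)) := by
      intro M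
      rw [Complex.norm_cpow_eq_rpow_re_of_pos (by positivity)]
      congr 1; simp
    simp_rw [this]
    exact (tendsto_rpow_neg_atTop (by linarith)).comp tendsto_nat_add_one
  have h3 : Tendsto (fun M : ℕ ↦ ∑ n ∈ Finset.range M, ((n + 1 : ℝ) : ℂ) ^ (-s)) atTop
      (𝓝 (riemannZeta s)) := by
    rw [zeta_eq_tsum_one_div_nat_add_one_cpow hs]
    have hsum : Summable (fun n : ℕ ↦ 1 / ((n : ℂ) + 1) ^ s) := by
      have := (summable_nat_add_iff 1).2 (Complex.summable_one_div_nat_cpow.2 hs)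
      simpa using this
    have := hsum.hasSum.tendsto_sum_nat
    refine this.congr (fun M ↦ Finset.sum_congr rfl fun n _ ↦ ?_)
    rw [Complex.cpow_neg]; push_cast; rw [one_div]
  have h4 := ((h3.const_mul (1 - s)).sub h2).add_const 1
  simp_rw [← sum_eulerTerm] at h4
  rw [tendsto_nhds_unique h1 h4]
  have hs1 : s ≠ 1 := by rintro rfl; simp at hs
  have : s - 1 ≠ 0 := sub_ne_zero.2 hs1
  rw [riemannZeta_eq_inv_sub_mul hs1]
  field_simp
  ring

/-- Analytic continuation of the Euler summation formula to the right half-plane. -/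
lemma tsum_eulerTerm {s : ℂ} (hs : 0 < s.re) : ∑' n, eulerTerm n s = 1 - riemannZeta₁ s := by
  set δ := s.re / 2 with hδ
  set M := ‖s‖ + 3 with hM
  -- The half-plane keeps the decay of the terms uniform and the ball bounds the factors ‖1 - z‖
  -- ‖z‖; `min δ 1` and the radius ‖s‖ + 3 are chosen so that both s and 2 belong to the region.
  set U : Set ℂ := {z | min δ 1 < z.re} ∩ Metric.ball 0 M with hU
  have hδ0 : 0 < min δ 1 := lt_min (by positivity) one_pos
  have hUo : IsOpen U := (isOpen_lt continuous_const Complex.continuous_re).inter Metric.isOpen_ball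
  have hUc : IsPreconnected U :=
    ((convex_halfSpace_re_gt _).inter (convex_ball _ _)).isPreconnected
  have hsU : s ∈ U := by
    refine ⟨(min_le_left δ 1).trans_lt (by rw [hδ]; linarith : δ < s.re), ?_⟩
    simp [hM]
  have h2U : (2 : ℂ) ∈ U := by
    refine ⟨(min_le_right δ 1).trans_lt (by norm_num : (1 : ℝ) < (2 : ℂ).re), ?_⟩
    simp [hM]; linarith [norm_nonneg s]
  have hd : DifferentiableOn ℂ (fun z ↦ ∑' n, eulerTerm n z) U := by
    apply Complex.differentiableOn_tsum_of_summable_norm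
      (u := fun n : ℕ ↦ (1 + M) * M * ((n : ℝ) + 1) ^ (-(min δ 1) - 1))
    · exact (summable_succ_rpow (by linarith)).mul_left _
    · exact fun n ↦ (differentiable_eulerTerm n).differentiableOn
    · exact hUo
    · intro n z hz
      have hzn : ‖z‖ ≤ M := by have := hz.2; simp at this; exact this.le
      have hzr : min δ 1 < z.re := hz.1
      refine (norm_eulerTerm_le n (hδ0.trans hzr)).trans ?_
      have h1 : ‖1 - z‖ ≤ 1 + M := (norm_sub_le _ _).trans (by simpa using hzn)
      gcongr
      linarith [Nat.cast_nonneg (α := ℝ) n]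
  have heq := AnalyticOnNhd.eqOn_of_preconnected_of_eventuallyEq (hd.analyticOnNhd hUo)
    (((differentiable_const 1).sub differentiable_riemannZeta₁).differentiableOn.analyticOnNhd hUo)
    hUc h2U (by
      have : ∀ᶠ z : ℂ in 𝓝 2, 1 < z.re :=
        (isOpen_lt continuous_const Complex.continuous_re).mem_nhds (by simp)
      filter_upwards [this] with z hz
      exact tsum_eulerTerm_of_one_lt hz)
  exact heq hsU

/-- For `β > 0` the normalised partial sums of `∑ n ^ (-β)` converge to `ζ(β)`. -/
lemma tendsto_partial_zeta {β : ℝ} (hβ : 0 < β) (h1 : β ≠ 1) :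
    Tendsto (fun M : ℕ ↦ ((∑ n ∈ Finset.Icc 1 M, (n : ℝ) ^ (-β) - (M + 1 : ℝ) ^ (1 - β) / (1 - β) : ℝ) : ℂ))
      atTop (𝓝 (riemannZeta β)) := by
  have h := (summable_eulerTerm (s := β) (by simpa using hβ)).hasSum.tendsto_sum_nat
  rw [tsum_eulerTerm (by simpa using hβ)] at h
  have hb : (β : ℂ) ≠ 1 := by exact_mod_cast h1
  have hb' : (1 - β : ℂ) ≠ 0 := sub_ne_zero.2 hb.symm
  have hb'' : (β - 1 : ℂ) ≠ 0 := sub_ne_zero.2 hb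
  have h2 := (h.sub_const 1).div_const (1 - β : ℂ)
  have e1 : (1 - riemannZeta₁ β - 1) / (1 - β : ℂ) = riemannZeta β := by
    rw [riemannZeta_eq_inv_sub_mul hb]; grind
  rw [e1] at h2
  refine h2.congr fun M ↦ ?_
  rw [sum_eulerTerm]
  have e2 : ∑ n ∈ Finset.range M, ((n + 1 : ℝ) : ℂ) ^ (-β : ℂ) =
      ((∑ n ∈ Finset.Icc 1 M, (n : ℝ) ^ (-β) : ℝ) : ℂ) := by
    rw [← Finset.Ico_add_one_right_eq_Icc, Finset.sum_Ico_eq_sum_range]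
    push_cast
    refine Finset.sum_congr rfl fun n _ ↦ ?_
    rw [Complex.ofReal_cpow (by positivity)]
    push_cast; rw [add_comm]
  rw [e2]
  have e3 : (((M + 1 : ℝ) : ℂ)) ^ (1 - β : ℂ) = (((M + 1 : ℝ) ^ (1 - β) : ℝ) : ℂ) := by
    rw [Complex.ofReal_cpow (by positivity)]; push_cast; rfl
  rw [e3]
  push_cast
  field_simp
  ring

lemma exists_rpow_sub_eq {a b p : ℝ} (ha : 0 ≤ a) (hab : a < b) (hp : p ≠ 0) (h : 0 < a ∨ 0 ≤ p) :
    ∃ ξ ∈ Ioo a b, (b ^ p - a ^ p) / p = (b - a) * ξ ^ (p - 1) := by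
  have hc : ContinuousOn (fun x : ℝ ↦ x ^ p) (Icc a b) := by
    intro x hx
    apply ContinuousAt.continuousWithinAt
    apply Real.continuousAt_rpow_const
    rcases h with h | h
    · exact Or.inl (h.trans_le hx.1).ne'
    · exact Or.inr h
  obtain ⟨ξ, hξ, he⟩ := exists_hasDerivAt_eq_slope (fun x : ℝ ↦ x ^ p) (fun x ↦ p * x ^ (p - 1)) hab hc
    (fun x hx ↦ Real.hasDerivAt_rpow_const (Or.inl (ha.trans_lt hx.1).ne'))
  refine ⟨ξ, hξ, ?_⟩
  have hba : b - a ≠ 0 := sub_ne_zero.2 hab.ne'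
  rw [eq_div_iff hba] at he
  rw [← he]; field_simp

lemma exists_real_zeta {β : ℝ} (hβ : 0 < β) (h1 : β ≠ 1) : ∃ z : ℝ, riemannZeta β = z ∧
    Tendsto (fun M : ℕ ↦ ∑ n ∈ Finset.Icc 1 M, (n : ℝ) ^ (-β) - (M + 1 : ℝ) ^ (1 - β) / (1 - β))
      atTop (𝓝 z) := by
  have h := tendsto_partial_zeta hβ h1
  refine ⟨(riemannZeta β).re, ?_, ?_⟩
  · apply Complex.ext
    · simp
    · have h2 := (Complex.continuous_im.tendsto _).comp h
      have h3 : (Complex.im ∘ fun M : ℕ ↦ ((∑ n ∈ Finset.Icc 1 M, (n : ℝ) ^ (-β) -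
        (M + 1 : ℝ) ^ (1 - β) / (1 - β) : ℝ) : ℂ)) = fun _ ↦ 0 := by
        ext M; exact Complex.ofReal_im _
      rw [h3] at h2
      rw [Complex.ofReal_im]
      exact (tendsto_nhds_unique h2 tendsto_const_nhds)
  · exact (Complex.continuous_re.tendsto _).comp h

/-- By the mean value theorem the normalised partial sums increase, while adding (M + 1)^(-β) turns
them into a decreasing sequence. Both tend to ζ(β), which is thus trapped with an error at most
X^(-β). Passing from ⌊X⌋ + 1 to X is one more mean value estimate of opposite sign. -/
lemma exists_zeta_asymp {β : ℝ} (hβ : 0 < β) (h1 : β ≠ 1) : ∃ z : ℝ, riemannZeta β = z ∧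
    ∀ X : ℝ, 1 ≤ X →
      |∑ n ∈ Finset.Icc 1 ⌊X⌋₊, (n : ℝ) ^ (-β) - X ^ (1 - β) / (1 - β) - z| ≤ X ^ (-β) := by
  obtain ⟨z, hz, ht⟩ := exists_real_zeta hβ h1
  have hb : 1 - β ≠ 0 := sub_ne_zero.2 h1.symm
  refine ⟨z, hz, fun X hX ↦ ?_⟩
  set a : ℕ → ℝ := fun M ↦ ∑ n ∈ Finset.Icc 1 M, (n : ℝ) ^ (-β) - (M + 1 : ℝ) ^ (1 - β) / (1 - β)
    with ha
  have hstep : ∀ M : ℕ, ∃ ξ ∈ Ioo (M + 1 : ℝ) (M + 2), a (M + 1) - a M = (M + 1 : ℝ) ^ (-β) - ξ ^ (-β) := by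
    intro M
    obtain ⟨ξ, hξ, he⟩ := exists_rpow_sub_eq (a := (M + 1 : ℝ)) (b := M + 2) (p := 1 - β)
      (by positivity) (by linarith) hb (Or.inl (by positivity))
    refine ⟨ξ, hξ, ?_⟩
    have e : 1 - β - 1 = -β := by ring
    rw [e] at he
    simp only [ha]
    rw [Finset.sum_Icc_succ_top (by omega)]
    push_cast
    have e2 : (M + 1 + 1 : ℝ) = M + 2 := by ring
    rw [e2]
    have e3 : (M + 2 - (M + 1) : ℝ) = 1 := by ring
    rw [e3, one_mul, sub_div] at he
    linarith
  have hmono : Monotone a := by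
    apply monotone_nat_of_le_succ
    intro M
    obtain ⟨ξ, hξ, he⟩ := hstep M
    have : ξ ^ (-β) ≤ (M + 1 : ℝ) ^ (-β) :=
      Real.rpow_le_rpow_of_nonpos (by positivity) hξ.1.le (by linarith)
    linarith
  have hanti : Antitone (fun M : ℕ ↦ a M + (M + 1 : ℝ) ^ (-β)) := by
    apply antitone_nat_of_succ_le
    intro M
    obtain ⟨ξ, hξ, he⟩ := hstep M
    have : (M + 2 : ℝ) ^ (-β) ≤ ξ ^ (-β) :=
      Real.rpow_le_rpow_of_nonpos (lt_trans (by positivity) hξ.1) hξ.2.le (by linarith)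
    have e2 : (((M + 1 : ℕ) : ℝ) + 1 : ℝ) = M + 2 := by push_cast; ring
    simp only [e2]
    linarith
  have hb0 : Tendsto (fun M : ℕ ↦ (M + 1 : ℝ) ^ (-β)) atTop (𝓝 0) :=
    (tendsto_rpow_neg_atTop hβ).comp tendsto_nat_add_one
  have ht2 : Tendsto (fun M : ℕ ↦ a M + (M + 1 : ℝ) ^ (-β)) atTop (𝓝 z) := by
    simpa using ht.add hb0
  set N := ⌊X⌋₊ with hN
  have hN1 : (N : ℝ) ≤ X := Nat.floor_le (by linarith)
  have hN2 : X < N + 1 := Nat.lt_floor_add_one X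
  have b1 : a N ≤ z := hmono.ge_of_tendsto ht N
  have b2 : z ≤ a N + (N + 1 : ℝ) ^ (-β) := hanti.le_of_tendsto ht2 N
  obtain ⟨ξ, hξ, he⟩ := exists_rpow_sub_eq (a := X) (b := N + 1) (p := 1 - β)
    (by linarith) hN2 hb (Or.inl (by linarith))
  have hX0 : 0 < X := by linarith
  have e : 1 - β - 1 = -β := by ring
  rw [e, sub_div] at he
  have c1 : ξ ^ (-β) ≤ X ^ (-β) := Real.rpow_le_rpow_of_nonpos hX0 hξ.1.le (by linarith)
  have c2 : (N + 1 : ℝ) ^ (-β) ≤ X ^ (-β) := Real.rpow_le_rpow_of_nonpos hX0 hN2.le (by linarith)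
  have c3 : 0 ≤ ξ ^ (-β) := Real.rpow_nonneg (by linarith [hξ.1]) _
  have c4 : 0 ≤ (N + 1 - X) * ξ ^ (-β) := mul_nonneg (by linarith) c3
  have c5 : (N + 1 - X) * ξ ^ (-β) ≤ X ^ (-β) :=
    (mul_le_of_le_one_left c3 (by linarith)).trans c1
  simp only [ha] at b1 b2
  rw [abs_le]
  constructor <;> linarith

/-- For integral X the difference lies between 0 and X^α by induction, comparing each term with the
integral over the preceding unit interval. The fractional part of X contributes an amount of the
opposite sign, also at most X^α. -/
lemma sum_rpow_asymp {α : ℝ} (hα : 0 ≤ α) {X : ℝ} (hX : 1 ≤ X) :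
    |∑ n ∈ Finset.Icc 1 ⌊X⌋₊, (n : ℝ) ^ α - X ^ (α + 1) / (α + 1)| ≤ X ^ α := by
  have key : ∀ M : ℕ, 0 ≤ ∑ n ∈ Finset.Icc 1 M, (n : ℝ) ^ α - (M : ℝ) ^ (α + 1) / (α + 1) ∧
      ∑ n ∈ Finset.Icc 1 M, (n : ℝ) ^ α - (M : ℝ) ^ (α + 1) / (α + 1) ≤ (M : ℝ) ^ α := by
    intro M
    induction M with
    | zero =>
      have : (0 : ℝ) ^ (α + 1) = 0 := Real.zero_rpow (by linarith)
      simp [this]; positivity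
    | succ M ih =>
      obtain ⟨ξ, hξ, he⟩ := exists_rpow_sub_eq (a := (M : ℝ)) (b := M + 1) (p := α + 1)
        (by positivity) (by linarith) (by linarith) (Or.inr (by linarith))
      have e : (M + 1 - M : ℝ) = 1 := by ring
      rw [add_sub_cancel_right, e, one_mul, sub_div] at he
      rw [Finset.sum_Icc_succ_top (by omega)]
      push_cast
      have hM : (0 : ℝ) ≤ M := Nat.cast_nonneg M
      have c1 : ξ ^ α ≤ (M + 1 : ℝ) ^ α := Real.rpow_le_rpow (by linarith [hξ.1]) hξ.2.le hα
      have c2 : (M : ℝ) ^ α ≤ ξ ^ α := Real.rpow_le_rpow hM hξ.1.le hα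
      constructor <;> linarith [ih.1, ih.2]
  set N := ⌊X⌋₊ with hN
  have hN1 : (N : ℝ) ≤ X := Nat.floor_le (by linarith)
  have hN2 : X < N + 1 := Nat.lt_floor_add_one X
  obtain ⟨k1, k2⟩ := key N
  have hNX : (N : ℝ) ^ α ≤ X ^ α := Real.rpow_le_rpow (Nat.cast_nonneg _) hN1 hα
  rcases hN1.eq_or_lt with h | h
  · rw [← h]
    rw [abs_le]; constructor <;> [skip; linarith]
    have : 0 ≤ (N : ℝ) ^ α := by positivity
    linarith
  · obtain ⟨ξ, hξ, he⟩ := exists_rpow_sub_eq (a := (N : ℝ)) (b := X) (p := α + 1)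
      (by positivity) h (by linarith) (Or.inr (by linarith))
    rw [add_sub_cancel_right, sub_div] at he
    have hξ0 : 0 < ξ := lt_of_le_of_lt (Nat.cast_nonneg _) hξ.1
    have c1 : ξ ^ α ≤ X ^ α := Real.rpow_le_rpow hξ0.le hξ.2.le hα
    have c2 : 0 ≤ ξ ^ α := by positivity
    have c3 : (X - N) * ξ ^ α ≤ X ^ α := (mul_le_of_le_one_left c2 (by linarith)).trans c1
    have c4 : 0 ≤ (X - N) * ξ ^ α := mul_nonneg (by linarith) c2
    rw [abs_le]; constructor <;> linarith

/-- The constant γ lies between harmonic numbers diminished by log(N + 1) and by log N, and both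
logarithms are within 2/X of log X. -/
lemma harmonic_asymp {X : ℝ} (hX : 1 ≤ X) :
    |∑ n ∈ Finset.Icc 1 ⌊X⌋₊, (n : ℝ) ^ (-1 : ℝ) - Real.log X - Real.eulerMascheroniConstant| ≤
      2 * X ^ (-1 : ℝ) := by
  set N := ⌊X⌋₊ with hN
  have hN0 : 1 ≤ N := Nat.le_floor (by simpa using hX)
  have hN1 : (N : ℝ) ≤ X := Nat.floor_le (by linarith)
  have hN2 : X < N + 1 := Nat.lt_floor_add_one X
  have hs : ∑ n ∈ Finset.Icc 1 N, (n : ℝ) ^ (-1 : ℝ) = (harmonic N : ℝ) := by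
    rw [harmonic_eq_sum_Icc]; push_cast
    exact Finset.sum_congr rfl fun n _ ↦ Real.rpow_neg_one _
  have h1 := Real.eulerMascheroniSeq_lt_eulerMascheroniConstant N
  have h2 := Real.eulerMascheroniConstant_lt_eulerMascheroniSeq' N
  unfold Real.eulerMascheroniSeq at h1
  unfold Real.eulerMascheroniSeq' at h2
  rw [if_neg (by omega)] at h2
  have hNp : (0 : ℝ) < N := by exact_mod_cast hN0
  have hXp : 0 < X := by linarith
  have l1 : Real.log N ≤ Real.log X := Real.log_le_log hNp hN1
  have l2 : Real.log (N + 1) - Real.log X ≤ X ^ (-1 : ℝ) := by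
    rw [← Real.log_div (by positivity) hXp.ne', Real.rpow_neg_one]
    refine (Real.log_le_sub_one_of_pos (by positivity)).trans ?_
    rw [div_sub_one hXp.ne', div_le_iff₀ hXp, inv_mul_cancel₀ hXp.ne']
    linarith
  have l3 : Real.log X - Real.log N ≤ 2 * X ^ (-1 : ℝ) := by
    rw [← Real.log_div (by positivity) hNp.ne', Real.rpow_neg_one]
    refine (Real.log_le_sub_one_of_pos (by positivity)).trans ?_
    rw [div_sub_one hNp.ne', div_le_iff₀ hNp]
    have : (1 : ℝ) ≤ N := by exact_mod_cast hN0
    rw [mul_assoc, inv_mul_eq_div, mul_div_assoc', le_div_iff₀ hXp]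
    nlinarith
  rw [hs, abs_le]
  constructor
  · linarith
  · have : 0 ≤ X ^ (-1 : ℝ) := by positivity
    linarith

/-- Power sums are `O(N ^ θ)` if the exponent is at most `θ - 1`. -/
lemma exists_sum_rpow_le {θ α : ℝ} (hθ : 0 < θ) (hα : α ≤ θ - 1) : ∃ C : ℝ, 0 ≤ C ∧ ∀ N : ℕ,
    ∑ n ∈ Finset.Icc 1 N, (n : ℝ) ^ α ≤ C * (N : ℝ) ^ θ := by
  suffices h : ∃ C : ℝ, 0 ≤ C ∧ ∀ N : ℕ, 1 ≤ N →
      ∑ n ∈ Finset.Icc 1 N, (n : ℝ) ^ (θ - 1) ≤ C * (N : ℝ) ^ θ by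
    obtain ⟨C, hC, h⟩ := h
    refine ⟨C, hC, fun N ↦ ?_⟩
    rcases Nat.eq_zero_or_pos N with rfl | hN
    · simp; positivity
    · refine (Finset.sum_le_sum fun n hn ↦ ?_).trans (h N hN)
      apply Real.rpow_le_rpow_of_exponent_le _ hα
      exact_mod_cast (Finset.mem_Icc.1 hn).1
  rcases le_or_gt 1 θ with h1 | h1
  · refine ⟨1, zero_le_one, fun N hN ↦ ?_⟩
    have hNp : (0 : ℝ) < N := by exact_mod_cast hN
    calc ∑ n ∈ Finset.Icc 1 N, (n : ℝ) ^ (θ - 1) ≤ ∑ n ∈ Finset.Icc 1 N, (N : ℝ) ^ (θ - 1) := by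
          refine Finset.sum_le_sum fun n hn ↦ ?_
          apply Real.rpow_le_rpow (Nat.cast_nonneg n) _ (by linarith)
          exact_mod_cast (Finset.mem_Icc.1 hn).2
      _ = 1 * (N : ℝ) ^ θ := by
          simp [Real.rpow_sub_one hNp.ne']; field_simp
  · obtain ⟨z, -, hz⟩ := exists_zeta_asymp (β := 1 - θ) (by linarith) (by linarith)
    refine ⟨1 / θ + |z| + 1, by positivity, fun N hN ↦ ?_⟩
    have hN' : (1 : ℝ) ≤ N := by exact_mod_cast hN
    have h := hz N hN'
    rw [Nat.floor_natCast] at h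
    have e1 : -(1 - θ) = θ - 1 := by ring
    have e2 : 1 - (1 - θ) = θ := by ring
    rw [e1, e2] at h
    have h2 : 1 ≤ (N : ℝ) ^ θ := Real.one_le_rpow hN' hθ.le
    have h3 : (N : ℝ) ^ (θ - 1) ≤ (N : ℝ) ^ θ := Real.rpow_le_rpow_of_exponent_le hN' (by linarith)
    have h4 : |z| ≤ |z| * (N : ℝ) ^ θ := le_mul_of_one_le_right (abs_nonneg z) h2
    have h5 := (abs_le.1 h).2
    have h6 := le_abs_self z
    have h7 : (N : ℝ) ^ θ / θ = 1 / θ * (N : ℝ) ^ θ := by ring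
    nlinarith

lemma exists_sum_rpow_le_const {α : ℝ} (hα : α < -1) : ∃ C : ℝ, 0 ≤ C ∧ ∀ N : ℕ,
    ∑ n ∈ Finset.Icc 1 N, (n : ℝ) ^ α ≤ C :=
  ⟨_, tsum_nonneg fun n : ℕ ↦ by positivity, fun _ ↦
    (Real.summable_nat_rpow.2 hα).sum_le_tsum _ fun n _ ↦ by positivity⟩

lemma sum_inv_le (N : ℕ) : ∑ n ∈ Finset.Icc 1 N, (n : ℝ)⁻¹ ≤ 1 + Real.log N := by
  have := harmonic_le_one_add_log N
  rw [harmonic_eq_sum_Icc] at this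
  simpa using this

/-! ### Diagonal and off-diagonal parts of the mean square -/

lemma integral_indicator_Ici {A T : ℝ} (hA : 0 < A) (hT : A ≤ T) (f : ℝ → ℂ) :
    ∫ t in (0 : ℝ)..T, (Ici A).indicator f t = ∫ t in A..T, f t := by
  rw [intervalIntegral.integral_of_le (hA.le.trans hT), intervalIntegral.integral_of_le hT,
    setIntegral_indicator measurableSet_Ici, ← integral_Icc_eq_integral_Ioc]
  congr 2
  ext t
  simp only [mem_inter_iff, mem_Ioc, mem_Ici, mem_Icc]
  constructor
  · rintro ⟨⟨_, h⟩, h'⟩; exact ⟨h', h⟩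
  · rintro ⟨h', h⟩; exact ⟨⟨by linarith, h⟩, h'⟩

lemma intervalIntegrable_indicator_Ici {A a b : ℝ} {f : ℝ → ℂ} (hf : Continuous f) :
    IntervalIntegrable ((Ici A).indicator f) volume a b := by
  have h := hf.intervalIntegrable (μ := volume) a b
  rw [intervalIntegrable_iff] at h ⊢
  exact h.indicator measurableSet_Ici

lemma intervalIntegrable_finset_sum {ι : Type*} {s : Finset ι} {f : ι → ℝ → ℂ} {a b : ℝ}
    (h : ∀ i ∈ s, IntervalIntegrable (f i) volume a b) :
    IntervalIntegrable (fun t ↦ ∑ i ∈ s, f i t) volume a b := by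
  have := IntervalIntegrable.sum s h
  rwa [Finset.sum_fn] at this

/-- The `n`-th term of `dirichletSum σ t`, as a function of `t`. -/
def cutTerm (σ : ℝ) (n : ℕ) : ℝ → ℂ :=
  (Ici (2 * Real.pi * (n : ℝ) ^ 2)).indicator fun t ↦ (n : ℂ) ^ (-(σ + t * Complex.I : ℂ))

/-- The length of the sum depends on t. Moving that dependence into indicators gives a fixed index
set on [0, T], so that sum and integral can be interchanged. -/
lemma dirichletSum_eq_sum_cutTerm (σ : ℝ) {t T : ℝ} (ht : 0 ≤ t) (htT : t ≤ T) :
    dirichletSum σ t = ∑ n ∈ Finset.Icc 1 (cutoff T), cutTerm σ n t := by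
  unfold dirichletSum cutTerm
  symm
  have hsub : Finset.Icc 1 (cutoff t) ⊆ Finset.Icc 1 (cutoff T) := by
    intro n hn
    rw [Finset.mem_Icc] at hn ⊢
    refine ⟨hn.1, ?_⟩
    rw [le_cutoff_iff hn.1 (ht.trans htT)]
    exact ((le_cutoff_iff hn.1 ht).1 hn.2).trans htT
  rw [← Finset.sum_subset hsub]
  · refine Finset.sum_congr rfl fun n hn ↦ ?_
    rw [Finset.mem_Icc] at hn
    exact indicator_of_mem (mem_Ici.2 ((le_cutoff_iff hn.1 ht).1 hn.2)) _
  · intro n hn hn'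
    rw [Finset.mem_Icc] at hn hn'
    apply indicator_of_notMem
    rw [mem_Ici, ← le_cutoff_iff hn.1 ht]
    tauto

lemma natCast_cpow_eq {n : ℕ} (hn : 1 ≤ n) (σ t : ℝ) : (n : ℂ) ^ (-(σ + t * Complex.I : ℂ)) =
    (((n : ℝ) ^ (-σ) : ℝ) : ℂ) * Complex.exp (-(Real.log n * Complex.I) * t) := by
  have hn0 : (n : ℂ) ≠ 0 := by exact_mod_cast (by omega : n ≠ 0)
  have hnr : (0 : ℝ) < n := by exact_mod_cast hn
  rw [Complex.cpow_def_of_ne_zero hn0, Real.rpow_def_of_pos hnr, Complex.ofReal_exp, ← Complex.exp_add,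
    Complex.natCast_log]
  congr 1
  push_cast
  ring

lemma norm_natCast_cpow {n : ℕ} (hn : 1 ≤ n) (σ t : ℝ) :
    ‖(n : ℂ) ^ (-(σ + t * Complex.I : ℂ))‖ = (n : ℝ) ^ (-σ) := by
  rw [Complex.norm_natCast_cpow_of_pos (by omega)]
  simp

/-- The two abscissae are kept separate because the case σ = 2 later pairs abscissa 5/2 with
abscissa 0. -/
lemma cutTerm_mul_conj {m n : ℕ} (hm : 1 ≤ m) (hn : 1 ≤ n) (σ σ' : ℝ) :
    (fun t ↦ cutTerm σ m t * conj (cutTerm σ' n t)) =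
      (Ici (2 * Real.pi * ((max m n : ℕ) : ℝ) ^ 2)).indicator fun t : ℝ ↦
        (((m : ℝ) ^ (-σ) * (n : ℝ) ^ (-σ') : ℝ) : ℂ) *
          Complex.exp (((Real.log n - Real.log m : ℝ) * Complex.I) * t) := by
  ext t
  have hmax : (2 * Real.pi * ((max m n : ℕ) : ℝ) ^ 2 ≤ t) ↔
      (2 * Real.pi * (m : ℝ) ^ 2 ≤ t ∧ 2 * Real.pi * (n : ℝ) ^ 2 ≤ t) := by
    have hmono : ∀ a b : ℕ, a ≤ b → 2 * Real.pi * (a : ℝ) ^ 2 ≤ 2 * Real.pi * (b : ℝ) ^ 2 := by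
      intro a b hab
      have : (a : ℝ) ≤ b := by exact_mod_cast hab
      gcongr
    rcases le_total m n with h | h
    · rw [max_eq_right h]; exact ⟨fun h1 ↦ ⟨(hmono _ _ h).trans h1, h1⟩, fun h1 ↦ h1.2⟩
    · rw [max_eq_left h]; exact ⟨fun h1 ↦ ⟨h1, (hmono _ _ h).trans h1⟩, fun h1 ↦ h1.1⟩
  by_cases h1 : 2 * Real.pi * (m : ℝ) ^ 2 ≤ t
  · by_cases h2 : 2 * Real.pi * (n : ℝ) ^ 2 ≤ t
    · rw [indicator_of_mem (mem_Ici.2 (hmax.2 ⟨h1, h2⟩)), cutTerm, cutTerm,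
        indicator_of_mem (mem_Ici.2 h1), indicator_of_mem (mem_Ici.2 h2), natCast_cpow_eq hm,
        natCast_cpow_eq hn, map_mul, ← Complex.exp_conj, Complex.conj_ofReal]
      simp only [map_mul, map_neg, Complex.conj_ofReal, Complex.conj_I]
      rw [mul_mul_mul_comm, ← Complex.exp_add]
      push_cast
      congr 2
      ring
    · rw [indicator_of_notMem (mt mem_Ici.1 fun h ↦ h2 (hmax.1 h).2), cutTerm, cutTerm,
        indicator_of_notMem (s := Ici (2 * Real.pi * (n : ℝ) ^ 2)) (by simpa using h2)]
      simp
  · rw [indicator_of_notMem (mt mem_Ici.1 fun h ↦ h1 (hmax.1 h).1), cutTerm, cutTerm,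
      indicator_of_notMem (s := Ici (2 * Real.pi * (m : ℝ) ^ 2)) (by simpa using h1)]
    simp

lemma norm_integral_exp_le {θ : ℝ} (hθ : θ ≠ 0) (a b : ℝ) :
    ‖∫ t in a..b, Complex.exp ((θ * Complex.I) * t)‖ ≤ 2 * |θ|⁻¹ := by
  have h0 : (θ * Complex.I : ℂ) ≠ 0 := mul_ne_zero (by exact_mod_cast hθ) Complex.I_ne_zero
  rw [integral_exp_mul_complex h0, norm_div, norm_mul, Complex.norm_I, mul_one, Complex.norm_real,
    Real.norm_eq_abs, div_eq_mul_inv]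
  apply mul_le_mul_of_nonneg_right _ (by positivity)
  refine (norm_sub_le _ _).trans (le_of_eq ?_)
  have : ∀ x : ℝ, ‖Complex.exp ((θ * Complex.I) * x)‖ = 1 := by
    intro x; rw [Complex.norm_exp]; simp
  rw [this, this]; norm_num

lemma two_pi_sq_pos {n : ℕ} (hn : 1 ≤ n) : 0 < 2 * Real.pi * (n : ℝ) ^ 2 := by
  have : (0 : ℝ) < n := by exact_mod_cast hn
  positivity

/-- Orthogonality of the terms up to the oscillating integrals. -/
lemma norm_pairing_sub_le {m n : ℕ} {T : ℝ} (hT : 0 ≤ T) (hm : m ∈ Finset.Icc 1 (cutoff T))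
    (hn : n ∈ Finset.Icc 1 (cutoff T)) (σ σ' : ℝ) :
    ‖(∫ t in (0 : ℝ)..T, cutTerm σ m t * conj (cutTerm σ' n t)) -
      (((if m = n then (n : ℝ) ^ (-σ) * (n : ℝ) ^ (-σ') * (T - 2 * Real.pi * n ^ 2) else 0 : ℝ)) : ℂ)‖ ≤
      2 * ((m : ℝ) ^ (-σ) * (n : ℝ) ^ (-σ') * |Real.log n - Real.log m|⁻¹) := by
  rw [Finset.mem_Icc] at hm hn
  have hmax : max m n ≤ cutoff T := max_le hm.2 hn.2
  have hmax1 : 1 ≤ max m n := hm.1.trans (le_max_left _ _)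
  rw [cutTerm_mul_conj hm.1 hn.1, integral_indicator_Ici (two_pi_sq_pos hmax1)
    ((le_cutoff_iff hmax1 hT).1 hmax), intervalIntegral.integral_const_mul]
  by_cases h : m = n
  -- On the diagonal the bound is 0, since 0⁻¹ = 0, and the integral is computed exactly.
  · subst h
    simp
  · have hlog : Real.log n - Real.log m ≠ 0 := by
      intro h0
      apply h
      have hn' : (0 : ℝ) < n := by exact_mod_cast hn.1
      have hm' : (0 : ℝ) < m := by exact_mod_cast hm.1
      have := Real.log_injOn_pos (mem_Ioi.2 hn') (mem_Ioi.2 hm') (by linarith)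
      exact_mod_cast this.symm
    rw [if_neg h, Complex.ofReal_zero, sub_zero, norm_mul, Complex.norm_real,
      Real.norm_of_nonneg (by positivity)]
    calc _ ≤ (m : ℝ) ^ (-σ) * (n : ℝ) ^ (-σ') * (2 * |Real.log n - Real.log m|⁻¹) :=
          mul_le_mul_of_nonneg_left (norm_integral_exp_le hlog _ _) (by positivity)
      _ = _ := by ring

/-- The contribution of the diagonal to the mean square of `dirichletSum`. -/
def diagSum (σ T : ℝ) : ℝ :=
  ∑ n ∈ Finset.Icc 1 (cutoff T), (n : ℝ) ^ (-σ) * (n : ℝ) ^ (-σ) * (T - 2 * Real.pi * n ^ 2)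

/-- A majorant of the contribution of the pairs `m ≠ n` to the mean square. -/
def offDiagSum (σ σ' : ℝ) (N : ℕ) : ℝ :=
  ∑ m ∈ Finset.Icc 1 N, ∑ n ∈ Finset.Icc 1 N,
    (m : ℝ) ^ (-σ) * (n : ℝ) ^ (-σ') * |Real.log n - Real.log m|⁻¹

lemma intervalIntegrable_pairing {m n : ℕ} (hm : 1 ≤ m) (hn : 1 ≤ n) (σ σ' a b : ℝ) :
    IntervalIntegrable (fun t ↦ cutTerm σ m t * conj (cutTerm σ' n t)) volume a b := by
  rw [cutTerm_mul_conj hm hn]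
  exact intervalIntegrable_indicator_Ici (by fun_prop)

lemma normSq_dirichletSum_eq (σ : ℝ) {t T : ℝ} (ht : 0 ≤ t) (htT : t ≤ T) :
    ((‖dirichletSum σ t‖ ^ 2 : ℝ) : ℂ) = ∑ m ∈ Finset.Icc 1 (cutoff T),
      ∑ n ∈ Finset.Icc 1 (cutoff T), cutTerm σ m t * conj (cutTerm σ n t) := by
  rw [← Complex.normSq_eq_norm_sq, ← Complex.mul_conj, dirichletSum_eq_sum_cutTerm σ ht htT,
    map_sum, Finset.sum_mul_sum]

theorem abs_integral_normSq_dirichletSum_sub_le (σ : ℝ) {T : ℝ} (hT : 0 ≤ T) :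
    |(∫ t in (0 : ℝ)..T, ‖dirichletSum σ t‖ ^ 2) - diagSum σ T| ≤ 2 * offDiagSum σ σ (cutoff T) := by
  have h1 : (((∫ t in (0 : ℝ)..T, ‖dirichletSum σ t‖ ^ 2 : ℝ)) : ℂ) =
      ∑ m ∈ Finset.Icc 1 (cutoff T), ∑ n ∈ Finset.Icc 1 (cutoff T),
        ∫ t in (0 : ℝ)..T, cutTerm σ m t * conj (cutTerm σ n t) := by
    rw [← intervalIntegral.integral_ofReal]
    have : ∀ t ∈ uIcc 0 T, ((‖dirichletSum σ t‖ ^ 2 : ℝ) : ℂ) = ∑ m ∈ Finset.Icc 1 (cutoff T),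
      ∑ n ∈ Finset.Icc 1 (cutoff T), cutTerm σ m t * conj (cutTerm σ n t) := by
      intro t ht
      rw [uIcc_of_le hT] at ht
      exact normSq_dirichletSum_eq σ ht.1 ht.2
    rw [intervalIntegral.integral_congr this, intervalIntegral.integral_finsetSum]
    · refine Finset.sum_congr rfl fun m hm ↦ ?_
      rw [intervalIntegral.integral_finsetSum]
      exact fun n hn ↦ intervalIntegrable_pairing (Finset.mem_Icc.1 hm).1 (Finset.mem_Icc.1 hn).1 _ _ _ _
    · intro m hm
      refine intervalIntegrable_finset_sum fun n hn ↦ ?_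
      exact intervalIntegrable_pairing (Finset.mem_Icc.1 hm).1 (Finset.mem_Icc.1 hn).1 _ _ _ _
  have h2 : ((diagSum σ T : ℝ) : ℂ) = ∑ m ∈ Finset.Icc 1 (cutoff T), ∑ n ∈ Finset.Icc 1 (cutoff T),
      (((if m = n then (n : ℝ) ^ (-σ) * (n : ℝ) ^ (-σ) * (T - 2 * Real.pi * n ^ 2) else 0 : ℝ)) : ℂ) := by
    unfold diagSum
    rw [Complex.ofReal_sum]
    refine Finset.sum_congr rfl fun m hm ↦ ?_
    rw [← Complex.ofReal_sum, Finset.sum_ite_eq, if_pos hm]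
  rw [← Real.norm_eq_abs, ← Complex.norm_real, Complex.ofReal_sub, h1, h2,
    ← Finset.sum_sub_distrib]
  refine (norm_sum_le _ _).trans ?_
  unfold offDiagSum
  rw [Finset.mul_sum]
  refine Finset.sum_le_sum fun m hm ↦ ?_
  rw [← Finset.sum_sub_distrib, Finset.mul_sum]
  refine (norm_sum_le _ _).trans (Finset.sum_le_sum fun n hn ↦ ?_)
  exact norm_pairing_sub_le hT hm hn σ σ

/-! ### Bounds for the off-diagonal sum -/

/-- From log(n/m) ≥ (n - m)/n and n/(n - m) = 1 + m/(n - m). The first summand yields a product of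
sums, the second a sum over the distance |m - n|. -/
lemma inv_abs_log_sub_le_of_lt {m n : ℕ} (hm : 1 ≤ m) (h : m < n) :
    |Real.log n - Real.log m|⁻¹ ≤ 1 + m * |(m : ℝ) - n|⁻¹ := by
  have hm' : (0 : ℝ) < m := by exact_mod_cast hm
  have hmn : (m : ℝ) < n := by exact_mod_cast h
  have hn' : (0 : ℝ) < n := hm'.trans hmn
  have h1 : ((n : ℝ) - m) / n ≤ Real.log n - Real.log m := by
    rw [← Real.log_div hn'.ne' hm'.ne']
    refine le_trans (le_of_eq ?_) (Real.one_sub_inv_le_log_of_pos (by positivity))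
    field_simp
  have h2 : 0 < ((n : ℝ) - m) / n := div_pos (by linarith) hn'
  rw [abs_of_pos (h2.trans_le h1), abs_sub_comm, abs_of_pos (by linarith : 0 < (n : ℝ) - m)]
  refine (inv_anti₀ h2 h1).trans (le_of_eq ?_)
  have : (n : ℝ) - m ≠ 0 := by linarith
  field_simp
  ring

lemma inv_abs_log_sub_le {m n : ℕ} (hm : 1 ≤ m) (hn : 1 ≤ n) :
    |Real.log n - Real.log m|⁻¹ ≤ 1 + (min m n : ℕ) * |(m : ℝ) - n|⁻¹ := by
  rcases lt_trichotomy m n with h | h | h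
  · rw [min_eq_left h.le]; exact inv_abs_log_sub_le_of_lt hm h
  · subst h; simp
  · rw [min_eq_right h.le, abs_sub_comm, abs_sub_comm (m : ℝ)]
    exact inv_abs_log_sub_le_of_lt hn h

lemma inv_abs_sub_le_one (m n : ℕ) : |(m : ℝ) - n|⁻¹ ≤ 1 := by
  by_cases h : m = n
  · simp [h]
  · apply inv_le_one_of_one_le₀
    have h1 : (1 : ℤ) ≤ |(m : ℤ) - n| := Int.one_le_abs (by omega)
    exact_mod_cast h1

lemma inv_abs_log_sub_le_two_mul_min {m n : ℕ} (hm : 1 ≤ m) (hn : 1 ≤ n) :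
    |Real.log n - Real.log m|⁻¹ ≤ 2 * (min m n : ℕ) := by
  have h1 : (1 : ℝ) ≤ (min m n : ℕ) := by exact_mod_cast le_min hm hn
  refine (inv_abs_log_sub_le hm hn).trans ?_
  nlinarith [inv_abs_sub_le_one m n]

lemma min_le_rpow_half_mul (m n : ℕ) :
    ((min m n : ℕ) : ℝ) ≤ (m : ℝ) ^ (1 / 2 : ℝ) * (n : ℝ) ^ (1 / 2 : ℝ) := by
  have h0 : (0 : ℝ) ≤ (min m n : ℕ) := Nat.cast_nonneg _
  calc ((min m n : ℕ) : ℝ) = ((min m n : ℕ) : ℝ) ^ (1 / 2 : ℝ) * ((min m n : ℕ) : ℝ) ^ (1 / 2 : ℝ) := by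
        rw [← Real.mul_rpow h0 h0, ← Real.sqrt_eq_rpow, Real.sqrt_mul_self h0]
    _ ≤ _ := by
        gcongr
        · exact min_le_left _ _
        · exact min_le_right _ _

lemma rpow_neg_mul_rpow_half {n : ℕ} (hn : 1 ≤ n) (σ : ℝ) :
    (n : ℝ) ^ (-σ) * (n : ℝ) ^ (1 / 2 : ℝ) = (n : ℝ) ^ (1 / 2 - σ) := by
  have hn' : (0 : ℝ) < n := by exact_mod_cast hn
  rw [← Real.rpow_add hn']; congr 1; ring

/-- After min(m, n) ≤ √m √n the second part carries (mn)^(1/2 - σ), which is separated into m^(1 -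
2σ) and n^(1 - 2σ) by the arithmetic-geometric inequality. -/
lemma offDiag_term_le {m n : ℕ} (hm : 1 ≤ m) (hn : 1 ≤ n) (σ : ℝ) :
    (m : ℝ) ^ (-σ) * (n : ℝ) ^ (-σ) * |Real.log n - Real.log m|⁻¹ ≤
      (m : ℝ) ^ (-σ) * (n : ℝ) ^ (-σ) +
        ((m : ℝ) ^ (1 - 2 * σ) * |(m : ℝ) - n|⁻¹ + (n : ℝ) ^ (1 - 2 * σ) * |(m : ℝ) - n|⁻¹) := by
  have h1 := mul_le_mul_of_nonneg_left (inv_abs_log_sub_le hm hn)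
    (by positivity : 0 ≤ (m : ℝ) ^ (-σ) * (n : ℝ) ^ (-σ))
  refine h1.trans ?_
  rw [mul_add, mul_one]
  apply add_le_add le_rfl
  rw [← add_mul, ← mul_assoc]
  apply mul_le_mul_of_nonneg_right _ (by positivity)
  have h2 := mul_le_mul_of_nonneg_left (min_le_rpow_half_mul m n)
    (by positivity : 0 ≤ (m : ℝ) ^ (-σ) * (n : ℝ) ^ (-σ))
  refine h2.trans ?_
  rw [mul_mul_mul_comm, rpow_neg_mul_rpow_half hm, rpow_neg_mul_rpow_half hn]
  have hsq : ∀ k : ℕ, (k : ℝ) ^ (1 - 2 * σ) = ((k : ℝ) ^ (1 / 2 - σ)) ^ 2 := by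
    intro k
    rw [← Real.rpow_natCast, ← Real.rpow_mul (Nat.cast_nonneg k)]; congr 1; push_cast; ring
  rw [hsq, hsq]
  nlinarith [sq_nonneg ((m : ℝ) ^ (1 / 2 - σ) - (n : ℝ) ^ (1 / 2 - σ)),
    sq_nonneg ((m : ℝ) ^ (1 / 2 - σ) + (n : ℝ) ^ (1 / 2 - σ))]

lemma sum_inv_abs_sub_le {n N : ℕ} (hn : n ∈ Finset.Icc 1 N) :
    ∑ m ∈ Finset.Icc 1 N, |(m : ℝ) - n|⁻¹ ≤ 2 * ∑ k ∈ Finset.Icc 1 N, (k : ℝ)⁻¹ := by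
  rw [Finset.mem_Icc] at hn
  have h1 : ∑ m ∈ (Finset.Icc 1 N).filter (· < n), |(m : ℝ) - n|⁻¹ ≤ ∑ k ∈ Finset.Icc 1 N, (k : ℝ)⁻¹ := by
    have hinj : InjOn (fun m ↦ n - m) ((Finset.Icc 1 N).filter (· < n) : Finset ℕ) := by
      intro a ha b hb hab
      simp at ha hb hab; omega
    have e : ∑ m ∈ (Finset.Icc 1 N).filter (· < n), |(m : ℝ) - n|⁻¹ =
        ∑ k ∈ ((Finset.Icc 1 N).filter (· < n)).image (fun m ↦ n - m), (k : ℝ)⁻¹ := by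
      rw [Finset.sum_image hinj]
      refine Finset.sum_congr rfl fun m hm ↦ ?_
      have hmn : m < n := (Finset.mem_filter.1 hm).2
      have : (m : ℝ) < n := by exact_mod_cast hmn
      rw [Nat.cast_sub hmn.le, abs_sub_comm, abs_of_pos (by linarith)]
    rw [e]
    apply Finset.sum_le_sum_of_subset_of_nonneg
    · intro k hk
      simp at hk ⊢
      obtain ⟨a, ha, rfl⟩ := hk
      omega
    · intros; positivity
  have h2 : ∑ m ∈ (Finset.Icc 1 N).filter (¬ · < n), |(m : ℝ) - n|⁻¹ ≤ ∑ k ∈ Finset.Icc 1 N, (k : ℝ)⁻¹ := by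
    have hinj : InjOn (fun m ↦ m - n) ((Finset.Icc 1 N).filter (¬ · < n) : Finset ℕ) := by
      intro a ha b hb hab
      simp at ha hb hab; omega
    have e : ∑ m ∈ (Finset.Icc 1 N).filter (¬ · < n), |(m : ℝ) - n|⁻¹ =
        ∑ k ∈ ((Finset.Icc 1 N).filter (¬ · < n)).image (fun m ↦ m - n), (k : ℝ)⁻¹ := by
      rw [Finset.sum_image hinj]
      refine Finset.sum_congr rfl fun m hm ↦ ?_
      have hmn : n ≤ m := not_lt.1 (Finset.mem_filter.1 hm).2
      have : (n : ℝ) ≤ m := by exact_mod_cast hmn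
      rw [Nat.cast_sub hmn, abs_of_nonneg (by linarith)]
    rw [e]
    -- The term m = n gives k = 0, which is outside the range 1, ..., N but contributes 0⁻¹ = 0.
    calc _ ≤ ∑ k ∈ insert 0 (Finset.Icc 1 N), (k : ℝ)⁻¹ := by
          apply Finset.sum_le_sum_of_subset_of_nonneg
          · intro k hk
            simp at hk ⊢
            obtain ⟨a, ha, rfl⟩ := hk
            omega
          · intros; positivity
      _ = _ := by rw [Finset.sum_insert (by simp)]; simp
  rw [← Finset.sum_filter_add_sum_filter_not _ (· < n)]
  linarith

lemma offDiagSum_le (σ : ℝ) (N : ℕ) : offDiagSum σ σ N ≤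
    (∑ n ∈ Finset.Icc 1 N, (n : ℝ) ^ (-σ)) ^ 2 +
      4 * (1 + Real.log N) * ∑ n ∈ Finset.Icc 1 N, (n : ℝ) ^ (1 - 2 * σ) := by
  set S := Finset.Icc 1 N with hS
  have h1 : offDiagSum σ σ N ≤ ∑ m ∈ S, ∑ n ∈ S, ((m : ℝ) ^ (-σ) * (n : ℝ) ^ (-σ) +
      ((m : ℝ) ^ (1 - 2 * σ) * |(m : ℝ) - n|⁻¹ + (n : ℝ) ^ (1 - 2 * σ) * |(m : ℝ) - n|⁻¹)) :=
    Finset.sum_le_sum fun m hm ↦ Finset.sum_le_sum fun n hn ↦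
      offDiag_term_le (Finset.mem_Icc.1 hm).1 (Finset.mem_Icc.1 hn).1 σ
  refine h1.trans ?_
  simp_rw [Finset.sum_add_distrib]
  have e1 : ∑ m ∈ S, ∑ n ∈ S, (m : ℝ) ^ (-σ) * (n : ℝ) ^ (-σ) = (∑ n ∈ S, (n : ℝ) ^ (-σ)) ^ 2 := by
    rw [pow_two, Finset.sum_mul_sum]
  have e2 : ∑ m ∈ S, ∑ n ∈ S, (m : ℝ) ^ (1 - 2 * σ) * |(m : ℝ) - n|⁻¹ =
      ∑ m ∈ S, ∑ n ∈ S, (n : ℝ) ^ (1 - 2 * σ) * |(m : ℝ) - n|⁻¹ := by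
    rw [Finset.sum_comm]
    refine Finset.sum_congr rfl fun m _ ↦ Finset.sum_congr rfl fun n _ ↦ ?_
    rw [abs_sub_comm]
  have e3 : ∑ m ∈ S, ∑ n ∈ S, (m : ℝ) ^ (1 - 2 * σ) * |(m : ℝ) - n|⁻¹ ≤
      2 * (1 + Real.log N) * ∑ n ∈ S, (n : ℝ) ^ (1 - 2 * σ) := by
    rw [Finset.mul_sum]
    refine Finset.sum_le_sum fun m hm ↦ ?_
    rw [← Finset.mul_sum, mul_comm]
    apply mul_le_mul_of_nonneg_right _ (by positivity)
    have := sum_inv_abs_sub_le hm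
    simp_rw [abs_sub_comm (m : ℝ)]
    have := sum_inv_le N
    linarith
  rw [e1, ← e2]
  linarith

lemma exists_one_add_log_le {ε : ℝ} (hε : 0 < ε) : ∃ C : ℝ, 0 ≤ C ∧ ∀ N : ℕ, 1 ≤ N →
    1 + Real.log N ≤ C * (N : ℝ) ^ ε := by
  refine ⟨1 + 1 / ε, by positivity, fun N hN ↦ ?_⟩
  have hN' : (1 : ℝ) ≤ N := by exact_mod_cast hN
  have h1 := Real.log_le_rpow_div (x := (N : ℝ)) (by linarith) hε
  have h2 := Real.one_le_rpow hN' hε.le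
  have e : (1 + 1 / ε) * (N : ℝ) ^ ε = (N : ℝ) ^ ε + (N : ℝ) ^ ε / ε := by ring
  linarith

theorem exists_offDiagSum_le {σ τ : ℝ} (h0 : 0 < τ) (h1 : 2 - 2 * σ < τ) : ∃ C : ℝ, 0 ≤ C ∧
    ∀ N : ℕ, offDiagSum σ σ N ≤ C * (N : ℝ) ^ τ := by
  -- Half of the slack between τ and max(0, 2 - 2σ) is spent on the logarithm.
  obtain ⟨ε, hε, hε0, hε1⟩ : ∃ ε : ℝ, 0 < ε ∧ 0 < τ - ε ∧ 1 - 2 * σ ≤ τ - ε - 1 := by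
    refine ⟨min τ (τ - (2 - 2 * σ)) / 2, ?_, ?_, ?_⟩
    · have := lt_min h0 (sub_pos.2 h1); linarith
    · have := min_le_left τ (τ - (2 - 2 * σ)); linarith
    · have h2 := min_le_right τ (τ - (2 - 2 * σ))
      have := lt_min h0 (sub_pos.2 h1)
      linarith
  obtain ⟨C₁, hC₁, hs₁⟩ := exists_sum_rpow_le (θ := τ / 2) (α := -σ) (by linarith) (by linarith)
  obtain ⟨C₂, hC₂, hs₂⟩ := exists_sum_rpow_le hε0 hε1
  obtain ⟨C₃, hC₃, hs₃⟩ := exists_one_add_log_le hε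
  refine ⟨C₁ ^ 2 + 4 * C₃ * C₂, by positivity, fun N ↦ ?_⟩
  rcases Nat.eq_zero_or_pos N with rfl | hN
  · simp [offDiagSum]; positivity
  have hNp : (0 : ℝ) < N := by exact_mod_cast hN
  have hN1 : (1 : ℝ) ≤ N := by exact_mod_cast hN
  have hlog := Real.log_nonneg hN1
  refine (offDiagSum_le σ N).trans ?_
  have a1 : (∑ n ∈ Finset.Icc 1 N, (n : ℝ) ^ (-σ)) ^ 2 ≤ C₁ ^ 2 * (N : ℝ) ^ τ := by
    calc _ ≤ (C₁ * (N : ℝ) ^ (τ / 2)) ^ 2 :=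
          pow_le_pow_left₀ (Finset.sum_nonneg fun _ _ ↦ by positivity) (hs₁ N) 2
      _ = _ := by
          rw [mul_pow, ← Real.rpow_natCast ((N : ℝ) ^ (τ / 2)), ← Real.rpow_mul hNp.le]
          congr 2; push_cast; ring
  have a2 : 4 * (1 + Real.log N) * ∑ n ∈ Finset.Icc 1 N, (n : ℝ) ^ (1 - 2 * σ) ≤
      4 * C₃ * C₂ * (N : ℝ) ^ τ := by
    calc _ ≤ 4 * (C₃ * (N : ℝ) ^ ε) * (C₂ * (N : ℝ) ^ (τ - ε)) :=
          mul_le_mul (mul_le_mul_of_nonneg_left (hs₃ N hN) (by norm_num)) (hs₂ N)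
            (Finset.sum_nonneg fun _ _ ↦ by positivity) (by positivity)
      _ = 4 * C₃ * C₂ * ((N : ℝ) ^ ε * (N : ℝ) ^ (τ - ε)) := by ring
      _ = _ := by rw [← Real.rpow_add hNp]; congr 2; ring
  linarith

/-- The cruder bound 2 min(m, n) ≤ 2√m √n for the inverse logarithm makes the double sum factor into
two copies of Σ n^(1/2 - σ), which stay bounded. -/
theorem exists_offDiagSum_le_const {σ : ℝ} (h : 2 ≤ σ) : ∃ C : ℝ, 0 ≤ C ∧
    ∀ N : ℕ, offDiagSum σ σ N ≤ C := by
  obtain ⟨C, hC, hs⟩ := exists_sum_rpow_le_const (α := 1 / 2 - σ) (by linarith)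
  refine ⟨2 * (C * C), by positivity, fun N ↦ ?_⟩
  calc offDiagSum σ σ N ≤ ∑ m ∈ Finset.Icc 1 N, ∑ n ∈ Finset.Icc 1 N,
        2 * ((m : ℝ) ^ (1 / 2 - σ) * (n : ℝ) ^ (1 / 2 - σ)) := by
        refine Finset.sum_le_sum fun m hm ↦ Finset.sum_le_sum fun n hn ↦ ?_
        have hm1 := (Finset.mem_Icc.1 hm).1
        have hn1 := (Finset.mem_Icc.1 hn).1
        have h1 := (inv_abs_log_sub_le_two_mul_min hm1 hn1).trans
          (mul_le_mul_of_nonneg_left (min_le_rpow_half_mul m n) (by norm_num))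
        have h2 := mul_le_mul_of_nonneg_left h1
          (by positivity : 0 ≤ (m : ℝ) ^ (-σ) * (n : ℝ) ^ (-σ))
        refine h2.trans (le_of_eq ?_)
        rw [← rpow_neg_mul_rpow_half hm1, ← rpow_neg_mul_rpow_half hn1]; ring
    _ = 2 * ((∑ n ∈ Finset.Icc 1 N, (n : ℝ) ^ (1 / 2 - σ)) *
          ∑ n ∈ Finset.Icc 1 N, (n : ℝ) ^ (1 / 2 - σ)) := by
        rw [Finset.sum_mul_sum, Finset.mul_sum]
        refine Finset.sum_congr rfl fun m _ ↦ ?_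
        rw [Finset.mul_sum]
    _ ≤ _ := by
        apply mul_le_mul_of_nonneg_left _ (by norm_num)
        exact mul_le_mul (hs N) (hs N) (Finset.sum_nonneg fun _ _ ↦ by positivity) hC

/-! ### Asymptotics of the diagonal -/

/-- The height of the saddle point. -/
def saddle (T : ℝ) : ℝ := √(T / (2 * Real.pi))

lemma one_le_saddle {T : ℝ} (hT : 2 * Real.pi ≤ T) : 1 ≤ saddle T := by
  unfold saddle
  rw [Real.one_le_sqrt, one_le_div (by positivity)]
  exact hT

lemma saddle_sq {T : ℝ} (hT : 0 ≤ T) : T = 2 * Real.pi * saddle T ^ 2 := by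
  unfold saddle
  rw [Real.sq_sqrt (by positivity)]; field_simp

lemma saddle_rpow {T : ℝ} (hT : 0 ≤ T) (p : ℝ) : saddle T ^ p = (T / (2 * Real.pi)) ^ (p / 2) := by
  unfold saddle
  rw [Real.sqrt_eq_rpow, ← Real.rpow_mul (by positivity)]; congr 1; ring

lemma isBigO_saddle_rpow {p e : ℝ} (h : p / 2 ≤ e) :
    (fun T ↦ saddle T ^ p) =O[atTop] fun T : ℝ ↦ T ^ e := by
  apply IsBigO.of_bound (((2 * Real.pi) ^ (p / 2))⁻¹)
  filter_upwards [eventually_ge_atTop 1] with T hT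
  rw [saddle_rpow (by linarith), Real.div_rpow (by linarith) (by positivity),
    Real.norm_of_nonneg (by positivity), Real.norm_of_nonneg (by positivity), div_eq_inv_mul]
  exact mul_le_mul_of_nonneg_left (Real.rpow_le_rpow_of_exponent_le hT h) (by positivity)

lemma isBigO_of_le_saddle {f : ℝ → ℝ} {C p e : ℝ} (h : p / 2 ≤ e)
    (hf : ∀ T, 2 * Real.pi ≤ T → |f T| ≤ C * saddle T ^ p) : f =O[atTop] fun T : ℝ ↦ T ^ e := by
  refine IsBigO.trans (IsBigO.of_bound C ?_) (isBigO_saddle_rpow h)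
  filter_upwards [eventually_ge_atTop (2 * Real.pi)] with T hT
  rw [Real.norm_eq_abs, Real.norm_of_nonneg (by have := one_le_saddle hT; positivity)]
  exact hf T hT

/-- With T = 2πX², where X = `saddle T`, the weight 1 - 2πn²/T is 1 - n²/X². -/
lemma diagSum_div_eq (σ : ℝ) {T : ℝ} (hT : 2 * Real.pi ≤ T) : diagSum σ T / T =
    ∑ n ∈ Finset.Icc 1 ⌊saddle T⌋₊, (n : ℝ) ^ (-(2 * σ)) -
      saddle T ^ (-2 : ℝ) * ∑ n ∈ Finset.Icc 1 ⌊saddle T⌋₊, (n : ℝ) ^ (2 - 2 * σ) := by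
  have hT0 : 0 < T := lt_of_lt_of_le (by positivity) hT
  have hX : 0 < saddle T := by linarith [one_le_saddle hT]
  have hTX := saddle_sq hT0.le
  rw [diagSum, Finset.sum_div, Finset.mul_sum, ← Finset.sum_sub_distrib]
  refine Finset.sum_congr rfl fun n hn ↦ ?_
  have hn0 : (0 : ℝ) < n := by exact_mod_cast (Finset.mem_Icc.1 hn).1
  have e1 : (n : ℝ) ^ (-σ) * (n : ℝ) ^ (-σ) = (n : ℝ) ^ (-(2 * σ)) := by
    rw [← Real.rpow_add hn0]; congr 1; ring
  have e2 : (n : ℝ) ^ (2 - 2 * σ) = (n : ℝ) ^ 2 * (n : ℝ) ^ (-(2 * σ)) := by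
    rw [← Real.rpow_natCast, ← Real.rpow_add hn0]; congr 1
  have e3 : saddle T ^ (-2 : ℝ) = 2 * Real.pi / T := by
    rw [Real.rpow_neg hX.le]
    have : saddle T ^ (2 : ℝ) = T / (2 * Real.pi) := by
      rw [Real.rpow_two]; field_simp; linarith
    rw [this, inv_div]
  rw [e1, e2, e3]
  field_simp

lemma saddle_sq_mul {T : ℝ} (hT : 2 * Real.pi ≤ T) (p : ℝ) :
    saddle T ^ (-2 : ℝ) * saddle T ^ p = saddle T ^ (p - 2) := by
  rw [← Real.rpow_add (by linarith [one_le_saddle hT])]; congr 1; ring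

lemma second_sum_asymp {σ : ℝ} (hσ : σ ≤ 1) {T : ℝ} (hT : 2 * Real.pi ≤ T) :
    |saddle T ^ (-2 : ℝ) * ∑ n ∈ Finset.Icc 1 ⌊saddle T⌋₊, (n : ℝ) ^ (2 - 2 * σ) -
      saddle T ^ (1 - 2 * σ) / (3 - 2 * σ)| ≤ saddle T ^ (-(2 * σ)) := by
  have hX := one_le_saddle hT
  have h := sum_rpow_asymp (α := 2 - 2 * σ) (by linarith) hX
  have h2 := mul_le_mul_of_nonneg_left h (by positivity : 0 ≤ saddle T ^ (-2 : ℝ))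
  rw [saddle_sq_mul hT, ← abs_of_nonneg (by positivity : 0 ≤ saddle T ^ (-2 : ℝ)), ← abs_mul, mul_sub,
    ← mul_div_assoc, saddle_sq_mul hT] at h2
  have e1 : 2 - 2 * σ + 1 - 2 = 1 - 2 * σ := by ring
  have e2 : 2 - 2 * σ + 1 = 3 - 2 * σ := by ring
  have e3 : 2 - 2 * σ - 2 = -(2 * σ) := by ring
  rw [e1, e2, e3] at h2
  exact h2

/-- The coefficient of the power of `T` in the mean square. -/
def leadCoeff (σ : ℝ) : ℝ := 2 / ((1 - 2 * σ) * (3 - 2 * σ))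

lemma leadCoeff_eq {σ : ℝ} (h1 : σ ≠ 1 / 2) (h2 : σ ≠ 3 / 2) :
    leadCoeff σ = 1 / (1 - 2 * σ) - 1 / (3 - 2 * σ) := by
  have e1 : 1 - 2 * σ ≠ 0 := fun h ↦ h1 (by linarith)
  have e2 : 3 - 2 * σ ≠ 0 := fun h ↦ h2 (by linarith)
  unfold leadCoeff
  field_simp
  ring

lemma diagSum_asymp_of_nonpos {σ : ℝ} (hσ : σ ≤ 0) {T : ℝ} (hT : 2 * Real.pi ≤ T) :
    |diagSum σ T / T - leadCoeff σ * saddle T ^ (1 - 2 * σ)| ≤ 2 * saddle T ^ (-(2 * σ)) := by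
  have hX := one_le_saddle hT
  have h1 := sum_rpow_asymp (α := -(2 * σ)) (by linarith) hX
  have h2 := second_sum_asymp (σ := σ) (by linarith) hT
  rw [diagSum_div_eq σ hT, leadCoeff_eq (by linarith) (by linarith)]
  have e1 : -(2 * σ) + 1 = 1 - 2 * σ := by ring
  rw [e1] at h1
  have h3 := abs_sub _ _ |>.trans (add_le_add h1 h2)
  refine le_trans (le_of_eq (congrArg _ ?_)) (h3.trans (by linarith))
  ring

lemma diagSum_asymp_of_pos {σ : ℝ} (hσ : 0 < σ) (h1 : σ < 1) (h12 : σ ≠ 1 / 2) : ∃ z : ℝ,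
    riemannZeta ((2 * σ : ℝ) : ℂ) = z ∧ ∀ T, 2 * Real.pi ≤ T →
    |diagSum σ T / T - leadCoeff σ * saddle T ^ (1 - 2 * σ) - z| ≤ 2 * saddle T ^ (-(2 * σ)) := by
  obtain ⟨z, hz, h⟩ := exists_zeta_asymp (β := 2 * σ) (by linarith) (fun h ↦ h12 (by linarith))
  refine ⟨z, hz, fun T hT ↦ ?_⟩
  have hX := one_le_saddle hT
  have h1 := h _ hX
  have h2 := second_sum_asymp (σ := σ) (by linarith) hT
  rw [diagSum_div_eq σ hT, leadCoeff_eq h12 (by linarith)]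
  have h3 := abs_sub _ _ |>.trans (add_le_add h1 h2)
  refine le_trans (le_of_eq (congrArg _ ?_)) (h3.trans (by linarith))
  ring

lemma diagSum_asymp_half {T : ℝ} (hT : 2 * Real.pi ≤ T) :
    |diagSum (1 / 2) T / T - (1 / 2 * Real.log (T / (2 * Real.pi)) +
      (Real.eulerMascheroniConstant - 1 / 2))| ≤ 3 * saddle T ^ (-1 : ℝ) := by
  have hX := one_le_saddle hT
  have h1 := harmonic_asymp hX
  have h2 := second_sum_asymp (σ := 1 / 2) (by norm_num) hT
  rw [diagSum_div_eq _ hT]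
  have e0 : Real.log (saddle T) = 1 / 2 * Real.log (T / (2 * Real.pi)) := by
    have hT0 : 0 < T := lt_of_lt_of_le (by positivity) hT
    unfold saddle; rw [Real.log_sqrt (by positivity)]; ring
  rw [e0] at h1
  have e1 : -(2 * (1 / 2 : ℝ)) = -1 := by norm_num
  have e2 : 1 - 2 * (1 / 2 : ℝ) = 0 := by norm_num
  have e3 : 3 - 2 * (1 / 2 : ℝ) = 2 := by norm_num
  rw [e1, e2, e3, Real.rpow_zero] at h2
  rw [e1]
  have h3 := abs_sub _ _ |>.trans (add_le_add h1 h2)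
  refine le_trans (le_of_eq (congrArg _ ?_)) (h3.trans (by linarith))
  ring

/-- For σ ≥ 1 only an error X^(-min(σ, 2)) is needed: all powers of X other than the constant are
discarded, and the second sum is merely bounded. It is O(N^(2 - σ)) for σ < 2, because 2 - 2σ ≤ (2 -
σ) - 1, and bounded for σ ≥ 2. -/
lemma diagSum_asymp_of_one_le {σ : ℝ} (hσ : 1 ≤ σ) : ∃ z C : ℝ,
    riemannZeta ((2 * σ : ℝ) : ℂ) = z ∧ ∀ T, 2 * Real.pi ≤ T →
    |diagSum σ T / T - z| ≤ C * saddle T ^ (-(min σ 2)) := by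
  obtain ⟨z, hz, h⟩ := exists_zeta_asymp (β := 2 * σ) (by linarith) (by linarith)
  obtain ⟨C, hC, hs⟩ : ∃ C : ℝ, 0 ≤ C ∧ ∀ N : ℕ,
      ∑ n ∈ Finset.Icc 1 N, (n : ℝ) ^ (2 - 2 * σ) ≤ C * (N : ℝ) ^ (2 - min σ 2) := by
    rcases lt_or_ge σ 2 with h2 | h2
    · rw [min_eq_left h2.le]
      exact exists_sum_rpow_le (by linarith) (by linarith)
    · rw [min_eq_right h2, sub_self]
      obtain ⟨C, hC, hs⟩ := exists_sum_rpow_le_const (α := 2 - 2 * σ) (by linarith)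
      exact ⟨C, hC, fun N ↦ by simpa using hs N⟩
  refine ⟨z, 2 + C, hz, fun T hT ↦ ?_⟩
  have hX := one_le_saddle hT
  have h1 := h _ hX
  have hX0 : 0 < saddle T := by linarith
  set X := saddle T with hXdef
  have hN : (⌊X⌋₊ : ℝ) ≤ X := Nat.floor_le hX0.le
  have h2 : X ^ (-2 : ℝ) * ∑ n ∈ Finset.Icc 1 ⌊X⌋₊, (n : ℝ) ^ (2 - 2 * σ) ≤ C * X ^ (-(min σ 2)) := by
    have e : X ^ (-(min σ 2)) = X ^ (-2 : ℝ) * X ^ (2 - min σ 2) := by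
      rw [← Real.rpow_add hX0]; congr 1; ring
    rw [e, mul_left_comm]
    apply mul_le_mul_of_nonneg_left _ (by positivity)
    refine (hs _).trans (mul_le_mul_of_nonneg_left ?_ hC)
    exact Real.rpow_le_rpow (Nat.cast_nonneg _) hN (by linarith [min_le_right σ 2])
  have h0 : 0 ≤ X ^ (-2 : ℝ) * ∑ n ∈ Finset.Icc 1 ⌊X⌋₊, (n : ℝ) ^ (2 - 2 * σ) :=
    mul_nonneg (by positivity) (Finset.sum_nonneg fun _ _ ↦ by positivity)
  have hm1 : min σ 2 ≤ 2 * σ - 1 := by linarith [min_le_left σ 2]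
  have h3 : X ^ (-(2 * σ)) ≤ X ^ (-(min σ 2)) := Real.rpow_le_rpow_of_exponent_le hX (by linarith)
  have h4 : X ^ (1 - 2 * σ) ≤ X ^ (-(min σ 2)) := Real.rpow_le_rpow_of_exponent_le hX (by linarith)
  have h5 : |X ^ (1 - 2 * σ) / (1 - 2 * σ)| ≤ X ^ (1 - 2 * σ) := by
    rw [abs_div, abs_of_pos (by positivity)]
    apply div_le_self (by positivity)
    rw [abs_of_neg (by linarith)]; linarith
  rw [diagSum_div_eq σ hT, ← hXdef]
  rw [abs_le] at h1 h5 ⊢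
  constructor <;> linarith [h1.1, h1.2, h5.1, h5.2]

/-! ### Weight integrals and transfer from the Dirichlet polynomial -/

lemma continuousOn_one_add_rpow (p : ℝ) : ContinuousOn (fun t : ℝ ↦ (1 + t) ^ p) (Ici 0) := by
  intro t ht
  apply ContinuousAt.continuousWithinAt
  have : (1 + t) ≠ 0 := by have : 0 ≤ t := ht; linarith
  exact ContinuousAt.rpow_const (by fun_prop) (Or.inl this)

lemma intervalIntegrable_one_add_rpow (p : ℝ) {a T : ℝ} (ha : 0 ≤ a) (hT : 0 ≤ T) :
    IntervalIntegrable (fun t : ℝ ↦ (1 + t) ^ p) volume a T := by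
  apply ((continuousOn_one_add_rpow p).mono _).intervalIntegrable
  intro t ht
  exact (le_min ha hT).trans ht.1

lemma integral_one_add_rpow {p : ℝ} (hp : p ≠ -1) {T : ℝ} (hT : 0 ≤ T) :
    ∫ t in (0 : ℝ)..T, (1 + t) ^ p = ((1 + T) ^ (p + 1) - 1) / (p + 1) := by
  rw [intervalIntegral.integral_comp_add_left (fun t : ℝ ↦ t ^ p) 1, integral_rpow]
  · simp
  · right
    refine ⟨hp, ?_⟩
    rw [add_zero, uIcc_of_le (by linarith)]
    intro h; linarith [h.1]

lemma isBigO_integral_one_add_rpow_of_lt_one {q : ℝ} (hq : q < 1) :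
    (fun T : ℝ ↦ ∫ t in (0 : ℝ)..T, (1 + t) ^ (-q)) =O[atTop] fun T : ℝ ↦ T ^ (1 - q) := by
  apply IsBigO.of_bound (2 ^ (1 - q) / (1 - q))
  filter_upwards [eventually_ge_atTop 1] with T hT
  rw [integral_one_add_rpow (by linarith) (by linarith)]
  have e : -q + 1 = 1 - q := by ring
  have h1 : 1 ≤ (1 + T) ^ (1 - q) := Real.one_le_rpow (by linarith) (by linarith)
  have h2 : (1 + T) ^ (1 - q) ≤ 2 ^ (1 - q) * T ^ (1 - q) := by
    rw [← Real.mul_rpow (by norm_num) (by linarith)]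
    exact Real.rpow_le_rpow (by linarith) (by linarith) (by linarith)
  rw [e, Real.norm_of_nonneg (div_nonneg (by linarith) (by linarith)), Real.norm_of_nonneg (by positivity),
    div_mul_eq_mul_div]
  apply div_le_div_of_nonneg_right _ (by linarith)
  linarith

lemma isBigO_integral_one_add_inv :
    (fun T : ℝ ↦ ∫ t in (0 : ℝ)..T, (1 + t) ^ (-1 : ℝ)) =O[atTop] Real.log := by
  apply IsBigO.of_bound 2
  filter_upwards [eventually_ge_atTop 2] with T hT
  have h : ∫ t in (0 : ℝ)..T, (1 + t) ^ (-1 : ℝ) = Real.log (1 + T) := by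
    simp_rw [Real.rpow_neg_one]
    rw [intervalIntegral.integral_comp_add_left (fun t : ℝ ↦ t⁻¹) 1,
      integral_inv_of_pos (by norm_num) (by linarith)]
    simp
  rw [h, Real.norm_of_nonneg (Real.log_nonneg (by linarith)),
    Real.norm_of_nonneg (Real.log_nonneg (by linarith))]
  have : 2 * Real.log T = Real.log (T ^ 2) := by rw [Real.log_pow]; push_cast; ring
  rw [this]
  apply Real.log_le_log (by linarith)
  nlinarith

lemma integral_one_add_rpow_le_of_one_lt {q : ℝ} (hq : 1 < q) {T : ℝ} (hT : 0 ≤ T) :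
    ∫ t in (0 : ℝ)..T, (1 + t) ^ (-q) ≤ 1 / (q - 1) := by
  rw [integral_one_add_rpow (by linarith) hT]
  have h1 : 0 ≤ (1 + T) ^ (-q + 1) := by positivity
  rw [← neg_div_neg_eq, neg_sub]
  have e : -(-q + 1) = q - 1 := by ring
  rw [e]
  apply div_le_div_of_nonneg_right _ (by linarith)
  linarith

/-- The mean square of `dirichletSum`. -/
def meanDirichlet (σ T : ℝ) : ℝ := 1 / T * ∫ t in (0 : ℝ)..T, ‖dirichletSum σ t‖ ^ 2

lemma abs_meanDirichlet_sub_le (σ : ℝ) {T : ℝ} (hT : 0 < T) :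
    |meanDirichlet σ T - diagSum σ T / T| ≤ 2 * offDiagSum σ σ (cutoff T) / T := by
  have h := abs_integral_normSq_dirichletSum_sub_le σ hT.le
  have : meanDirichlet σ T - diagSum σ T / T =
      ((∫ t in (0 : ℝ)..T, ‖dirichletSum σ t‖ ^ 2) - diagSum σ T) / T := by
    unfold meanDirichlet; ring
  rw [this, abs_div, abs_of_pos hT]
  exact div_le_div_of_nonneg_right h hT.le

lemma cutoff_le_saddle (T : ℝ) : (cutoff T : ℝ) ≤ saddle T := Nat.floor_le (Real.sqrt_nonneg _)

lemma meanDirichlet_sub_diag_isBigO {σ τ e : ℝ} (h0 : 0 < τ) (h1 : 2 - 2 * σ < τ)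
    (he : e = τ / 2 - 1) :
    (fun T ↦ meanDirichlet σ T - diagSum σ T / T) =O[atTop] fun T : ℝ ↦ T ^ e := by
  obtain ⟨C, hC, h⟩ := exists_offDiagSum_le h0 h1
  apply IsBigO.of_bound (2 * (C * ((2 * Real.pi) ^ (τ / 2))⁻¹))
  filter_upwards [eventually_ge_atTop 1] with T hT
  have hT0 : 0 < T := by linarith
  refine (abs_meanDirichlet_sub_le σ hT0).trans ?_
  rw [Real.norm_of_nonneg (by positivity), he, Real.rpow_sub_one hT0.ne', ← mul_div_assoc]
  apply div_le_div_of_nonneg_right _ hT0.le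
  rw [mul_assoc]
  apply mul_le_mul_of_nonneg_left _ (by norm_num)
  refine (h _).trans ?_
  rw [mul_assoc]
  apply mul_le_mul_of_nonneg_left _ hC
  refine (Real.rpow_le_rpow (Nat.cast_nonneg _) (cutoff_le_saddle T) h0.le).trans (le_of_eq ?_)
  rw [saddle_rpow hT0.le, Real.div_rpow hT0.le (by positivity), div_eq_inv_mul]

lemma meanDirichlet_sub_diag_isBigO_of_two_le {σ : ℝ} (h : 2 ≤ σ) :
    (fun T ↦ meanDirichlet σ T - diagSum σ T / T) =O[atTop] fun T : ℝ ↦ T ^ (-1 : ℝ) := by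
  obtain ⟨C, hC, h⟩ := exists_offDiagSum_le_const h
  apply IsBigO.of_bound (2 * C)
  filter_upwards [eventually_ge_atTop 1] with T hT
  have hT0 : 0 < T := by linarith
  refine (abs_meanDirichlet_sub_le σ hT0).trans ?_
  rw [Real.norm_of_nonneg (by positivity), Real.rpow_neg_one, ← div_eq_mul_inv]
  apply div_le_div_of_nonneg_right _ hT0.le
  linarith [h (cutoff T)]

lemma intervalIntegrable_normSq_dirichletSum (σ : ℝ) {T : ℝ} (hT : 0 ≤ T) :
    IntervalIntegrable (fun t ↦ ‖dirichletSum σ t‖ ^ 2) volume 0 T := by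
  have h1 : IntervalIntegrable (fun t ↦ ∑ m ∈ Finset.Icc 1 (cutoff T),
      ∑ n ∈ Finset.Icc 1 (cutoff T), cutTerm σ m t * (starRingEnd ℂ) (cutTerm σ n t)) volume 0 T :=
    intervalIntegrable_finset_sum fun m hm ↦ intervalIntegrable_finset_sum fun n hn ↦
      intervalIntegrable_pairing (Finset.mem_Icc.1 hm).1 (Finset.mem_Icc.1 hn).1 _ _ _ _
  have h2 : IntervalIntegrable (fun t ↦ ((‖dirichletSum σ t‖ ^ 2 : ℝ) : ℂ)) volume 0 T := by
    refine h1.congr fun t ht ↦ ?_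
    rw [uIoc_of_le hT] at ht
    exact (normSq_dirichletSum_eq σ ht.1.le ht.2).symm
  rw [intervalIntegrable_iff] at h2 ⊢
  exact h2.re

lemma norm_sq_sub_norm_sq_le (a b : ℂ) : |‖a‖ ^ 2 - ‖b‖ ^ 2| ≤ 2 * ‖b‖ * ‖a - b‖ + ‖a - b‖ ^ 2 := by
  have h1 : |‖a‖ - ‖b‖| ≤ ‖a - b‖ := abs_norm_sub_norm_le a b
  have h2 : ‖a‖ ^ 2 - ‖b‖ ^ 2 = (‖a‖ - ‖b‖) * (2 * ‖b‖ + (‖a‖ - ‖b‖)) := by ring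
  rw [h2, abs_mul]
  have h3 : |2 * ‖b‖ + (‖a‖ - ‖b‖)| ≤ 2 * ‖b‖ + ‖a - b‖ :=
    (abs_add_le _ _).trans (add_le_add (by rw [abs_of_nonneg (by positivity)]) h1)
  calc _ ≤ ‖a - b‖ * (2 * ‖b‖ + ‖a - b‖) := mul_le_mul h1 h3 (abs_nonneg _) (norm_nonneg _)
    _ = _ := by ring

lemma abs_meanSquare_sub_le_of_bound {σ : ℝ} {T : ℝ} (hT : 0 < T) {g : ℝ → ℝ}
    (hg : IntervalIntegrable g volume 0 T)
    (h : ∀ t ∈ Ioc 0 T, |‖riemannAux (σ + t * Complex.I)‖ ^ 2 - ‖dirichletSum σ t‖ ^ 2| ≤ g t) :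
    |meanSquare σ T - meanDirichlet σ T| ≤ 1 / T * ∫ t in (0 : ℝ)..T, g t := by
  have hc : IntervalIntegrable (fun t : ℝ ↦ ‖riemannAux (σ + t * Complex.I)‖ ^ 2) volume 0 T :=
    ((continuous_riemannAux_vertical σ).norm.pow 2).intervalIntegrable _ _
  unfold meanSquare meanDirichlet
  rw [← mul_sub, abs_mul, abs_of_pos (by positivity : 0 < 1 / T),
    ← intervalIntegral.integral_sub hc (intervalIntegrable_normSq_dirichletSum σ hT.le)]
  apply mul_le_mul_of_nonneg_left _ (by positivity)
  rw [← Real.norm_eq_abs]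
  exact intervalIntegral.norm_integral_le_of_norm_le hT.le
    (Eventually.of_forall fun t ht ↦ h t ht) hg

/-- Comparison of the mean squares by the inequality of the arithmetic and geometric means. -/
lemma exists_abs_meanSquare_sub_le (σ : ℝ) : ∃ K : ℝ, 0 ≤ K ∧ ∀ T l : ℝ, 0 < T → 0 < l → l ≤ 1 →
    |meanSquare σ T - meanDirichlet σ T| ≤
      l * meanDirichlet σ T + K * (l⁻¹ * (1 / T * ∫ t in (0 : ℝ)..T, (1 + t) ^ (-σ))) := by
  obtain ⟨K, hK, h⟩ := exists_remainder_bound |σ|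
  refine ⟨2 * K ^ 2, by positivity, fun T l hT hl hl1 ↦ ?_⟩
  have hw := intervalIntegrable_one_add_rpow (-σ) le_rfl hT.le
  have hS := intervalIntegrable_normSq_dirichletSum σ hT.le
  have hbound := abs_meanSquare_sub_le_of_bound (σ := σ) hT
    (g := fun t ↦ l * ‖dirichletSum σ t‖ ^ 2 + 2 * K ^ 2 * l⁻¹ * (1 + t) ^ (-σ))
    ((hS.const_mul l).add (hw.const_mul _)) (fun t ht ↦ by
      refine (norm_sq_sub_norm_sq_le _ _).trans ?_
      have hE := h σ t le_rfl ht.1.le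
      set E := ‖riemannAux (σ + t * Complex.I) - dirichletSum σ t‖ with hEdef
      set S := ‖dirichletSum σ t‖
      have hE0 : 0 ≤ E := norm_nonneg _
      have h1t : 0 ≤ 1 + t := by linarith [ht.1]
      have hE2 : E ^ 2 ≤ K ^ 2 * (1 + t) ^ (-σ) := by
        refine (pow_le_pow_left₀ hE0 hE 2).trans (le_of_eq ?_)
        rw [mul_pow, ← Real.rpow_natCast ((1 + t) ^ (-σ / 2)), ← Real.rpow_mul h1t]
        congr 2; push_cast; ring
      have hli : 1 ≤ l⁻¹ := (one_le_inv₀ hl).2 hl1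
      -- The difference of the two sides is l⁻¹ (lS - E)². The condition l ≤ 1 lets the remaining E²
      -- be absorbed into l⁻¹ E².
      have h2 : 2 * S * E ≤ l * S ^ 2 + l⁻¹ * E ^ 2 := by
        have e : l * S ^ 2 + l⁻¹ * E ^ 2 - 2 * S * E = l⁻¹ * (l * S - E) ^ 2 := by
          field_simp; ring
        have : 0 ≤ l⁻¹ * (l * S - E) ^ 2 := by positivity
        linarith
      have h3 : E ^ 2 ≤ l⁻¹ * E ^ 2 := le_mul_of_one_le_left (by positivity) hli
      have h4 : l⁻¹ * E ^ 2 ≤ l⁻¹ * (K ^ 2 * (1 + t) ^ (-σ)) :=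
        mul_le_mul_of_nonneg_left hE2 (by positivity)
      linarith)
  refine hbound.trans (le_of_eq ?_)
  rw [intervalIntegral.integral_add (hS.const_mul l) (hw.const_mul _),
    intervalIntegral.integral_const_mul, intervalIntegral.integral_const_mul]
  unfold meanDirichlet
  ring

/-- Here M and V are the orders of the mean squares of S and of the remainder bound. The balanced
choice is l = √(V/M), which gives the Cauchy-Schwarz error √(MV); every application below uses it.
-/
lemma meanSquare_sub_isBigO {σ : ℝ} {l M V g : ℝ → ℝ} (hl : ∀ᶠ T in atTop, 0 < l T ∧ l T ≤ 1)
    (hM : (fun T ↦ meanDirichlet σ T) =O[atTop] M)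
    (hV : (fun T : ℝ ↦ 1 / T * ∫ t in (0 : ℝ)..T, (1 + t) ^ (-σ)) =O[atTop] V)
    (h1 : (fun T ↦ l T * M T) =O[atTop] g) (h2 : (fun T ↦ (l T)⁻¹ * V T) =O[atTop] g) :
    (fun T ↦ meanSquare σ T - meanDirichlet σ T) =O[atTop] g := by
  obtain ⟨K, hK, h⟩ := exists_abs_meanSquare_sub_le σ
  have a1 := ((isBigO_refl l atTop).mul hM).trans h1
  have a2 := (((isBigO_refl (fun T ↦ (l T)⁻¹) atTop).mul hV).trans h2).const_mul_left K
  refine IsBigO.trans (IsBigO.of_bound 1 ?_) (a1.add a2)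
  filter_upwards [hl, eventually_gt_atTop 0] with T hT hT0
  rw [one_mul]
  exact (h T (l T) hT0 hT.1 hT.2).trans (le_abs_self _)

lemma isBigO_mean_of_isBigO {f : ℝ → ℝ} {e : ℝ} (h : f =O[atTop] fun T : ℝ ↦ T ^ (e + 1)) :
    (fun T : ℝ ↦ 1 / T * f T) =O[atTop] fun T : ℝ ↦ T ^ e := by
  have := (isBigO_refl (fun T : ℝ ↦ 1 / T) atTop).mul h
  refine this.congr' EventuallyEq.rfl ?_
  filter_upwards [eventually_gt_atTop 0] with T hT
  rw [Real.rpow_add_one hT.ne']; field_simp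

lemma rpow_isBigO_rpow {a b : ℝ} (h : a ≤ b) :
    (fun T : ℝ ↦ T ^ a) =O[atTop] fun T : ℝ ↦ T ^ b := by
  apply IsBigO.of_bound 1
  filter_upwards [eventually_ge_atTop 1] with T hT
  rw [one_mul, Real.norm_of_nonneg (by positivity), Real.norm_of_nonneg (by positivity)]
  exact Real.rpow_le_rpow_of_exponent_le hT h

lemma const_isBigO_rpow {b : ℝ} (h : 0 ≤ b) (c : ℝ) :
    (fun _ : ℝ ↦ c) =O[atTop] fun T : ℝ ↦ T ^ b := by
  have := (isBigO_refl (fun _ : ℝ ↦ (1 : ℝ)) atTop).const_mul_left c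
  simp only [mul_one] at this
  refine this.trans ?_
  simpa using rpow_isBigO_rpow h

lemma rpow_mem_Ioc {a : ℝ} (ha : 0 ≤ a) : ∀ᶠ T : ℝ in atTop, 0 < T ^ (-a) ∧ T ^ (-a) ≤ 1 := by
  filter_upwards [eventually_ge_atTop 1] with T hT
  exact ⟨by positivity, Real.rpow_le_one_of_one_le_of_nonpos hT (by linarith)⟩

lemma rpow_mul_rpow_isBigO {a b c : ℝ} (h : a + b ≤ c) :
    (fun T : ℝ ↦ T ^ a * T ^ b) =O[atTop] fun T : ℝ ↦ T ^ c := by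
  refine ((rpow_isBigO_rpow h).congr' ?_ EventuallyEq.rfl)
  filter_upwards [eventually_gt_atTop 0] with T hT
  exact Real.rpow_add hT a b

lemma inv_rpow_mul_rpow_isBigO {a b c : ℝ} (h : -a + b ≤ c) :
    (fun T : ℝ ↦ (T ^ a)⁻¹ * T ^ b) =O[atTop] fun T : ℝ ↦ T ^ c := by
  refine (rpow_mul_rpow_isBigO h).congr' ?_ EventuallyEq.rfl
  filter_upwards [eventually_gt_atTop 0] with T hT
  rw [Real.rpow_neg hT.le]

lemma isBigO_mean_weight {σ : ℝ} (hσ : σ < 1) :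
    (fun T : ℝ ↦ 1 / T * ∫ t in (0 : ℝ)..T, (1 + t) ^ (-σ)) =O[atTop] fun T : ℝ ↦ T ^ (-σ) := by
  apply isBigO_mean_of_isBigO
  have := isBigO_integral_one_add_rpow_of_lt_one hσ
  rwa [show 1 - σ = -σ + 1 by ring] at this

/-! ### The individual ranges of σ -/

/-- For `σ < 1 / 2` the mean squares of `riemannAux` and of `dirichletSum` agree up to the error
term, given the order of magnitude of the latter. -/
lemma meanSquare_sub_isBigO_of_lt_half {σ : ℝ} (hσ : σ < 1 / 2)
    (hM : (fun T ↦ meanDirichlet σ T) =O[atTop] fun T : ℝ ↦ T ^ (1 / 2 - σ)) :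
    (fun T ↦ meanSquare σ T - meanDirichlet σ T) =O[atTop] fun T : ℝ ↦ T ^ (1 / 4 - σ) :=
  -- With M = T^(1/2 - σ) and V = T^(-σ) the balanced l is T^(-1/4).
  meanSquare_sub_isBigO (rpow_mem_Ioc (a := 1 / 4) (by norm_num)) hM
    (isBigO_mean_weight (by linarith)) (rpow_mul_rpow_isBigO (by linarith))
    (inv_rpow_mul_rpow_isBigO (by linarith))

lemma leadTerm_isBigO (σ : ℝ) : (fun T ↦ leadCoeff σ * saddle T ^ (1 - 2 * σ)) =O[atTop]
    fun T : ℝ ↦ T ^ (1 / 2 - σ) :=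
  (isBigO_saddle_rpow (by linarith)).const_mul_left _

lemma leadTerm_eq (σ : ℝ) : (fun T ↦ leadCoeff σ * saddle T ^ (1 - 2 * σ)) =ᶠ[atTop]
    fun T : ℝ ↦ 2 / ((1 - 2 * σ) * (3 - 2 * σ)) * (T / (2 * Real.pi)) ^ (1 / 2 - σ) := by
  filter_upwards [eventually_ge_atTop 0] with T hT
  rw [saddle_rpow hT, leadCoeff]
  congr 2; ring

lemma meanDirichlet_asymp_of_lt_half {σ z : ℝ} (hσ : σ < 1 / 2)
    (h : ∀ T, 2 * Real.pi ≤ T →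
      |diagSum σ T / T - leadCoeff σ * saddle T ^ (1 - 2 * σ) - z| ≤ 2 * saddle T ^ (-(2 * σ))) :
    (fun T ↦ meanDirichlet σ T - leadCoeff σ * saddle T ^ (1 - 2 * σ) - z) =O[atTop]
      fun T : ℝ ↦ T ^ (1 / 4 - σ) := by
  -- An off-diagonal sum O(X^τ) contributes T^(τ/2 - 1) after division by T, so τ is dictated by the
  -- target exponent; it exceeds 2 - 2σ by 1/2.
  have h1 := meanDirichlet_sub_diag_isBigO (σ := σ) (τ := 5 / 2 - 2 * σ) (e := 1 / 4 - σ)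
    (by linarith) (by linarith) (by ring)
  have h2 := isBigO_of_le_saddle (e := 1 / 4 - σ) (by linarith) h
  exact (h1.add h2).congr_left fun T ↦ by ring

lemma meanSquare_asymp_of_lt_half {σ z : ℝ} (hσ : σ < 1 / 2)
    (h : ∀ T, 2 * Real.pi ≤ T →
      |diagSum σ T / T - leadCoeff σ * saddle T ^ (1 - 2 * σ) - z| ≤ 2 * saddle T ^ (-(2 * σ))) :
    (fun T ↦ meanSquare σ T - leadCoeff σ * saddle T ^ (1 - 2 * σ) - z) =O[atTop]
      fun T : ℝ ↦ T ^ (1 / 4 - σ) := by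
  have h1 := meanDirichlet_asymp_of_lt_half hσ h
  have h2 : (fun T ↦ meanDirichlet σ T) =O[atTop] fun T : ℝ ↦ T ^ (1 / 2 - σ) := by
    have := ((h1.trans (rpow_isBigO_rpow (by linarith : 1 / 4 - σ ≤ 1 / 2 - σ))).add
      (leadTerm_isBigO σ)).add (const_isBigO_rpow (by linarith : 0 ≤ 1 / 2 - σ) z)
    exact this.congr_left fun T ↦ by ring
  exact ((meanSquare_sub_isBigO_of_lt_half hσ h2).add h1).congr_left fun T ↦ by ring

theorem meanSquare_asymp_of_le_quarter {σ : ℝ} (hσ : σ ≤ 1 / 4) :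
    (fun T ↦ meanSquare σ T - leadCoeff σ * saddle T ^ (1 - 2 * σ)) =O[atTop]
      fun T : ℝ ↦ T ^ (1 / 4 - σ) := by
  rcases le_or_gt σ 0 with h0 | h0
  · have := meanSquare_asymp_of_lt_half (σ := σ) (z := 0) (by linarith)
      (fun T hT ↦ by simpa using diagSum_asymp_of_nonpos h0 hT)
    simpa using this
  · obtain ⟨z, -, hz⟩ := diagSum_asymp_of_pos h0 (by linarith) (by linarith)
    have h1 := meanSquare_asymp_of_lt_half (by linarith) hz
    -- For 0 < σ ≤ 1/4 the constant ζ(2σ) is absorbed by the error term, whose exponent is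
    -- nonnegative.
    have h2 := const_isBigO_rpow (by linarith : 0 ≤ 1 / 4 - σ) z
    exact (h1.add h2).congr_left fun T ↦ by ring

theorem meanSquare_asymp_of_lt_half_of_quarter_lt {σ : ℝ} (h0 : 1 / 4 < σ) (hσ : σ < 1 / 2) :
    ∃ z : ℝ, riemannZeta ((2 * σ : ℝ) : ℂ) = z ∧
      (fun T ↦ meanSquare σ T - leadCoeff σ * saddle T ^ (1 - 2 * σ) - z) =O[atTop]
        fun T : ℝ ↦ T ^ (1 / 4 - σ) := by
  obtain ⟨z, h1, hz⟩ := diagSum_asymp_of_pos (σ := σ) (by linarith) (by linarith) (by linarith)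
  exact ⟨z, h1, meanSquare_asymp_of_lt_half hσ hz⟩

theorem meanSquare_asymp_half :
    (fun T ↦ meanSquare (1 / 2) T - (1 / 2 * Real.log (T / (2 * Real.pi)) +
      (Real.eulerMascheroniConstant - 1 / 2))) =O[atTop]
        fun T : ℝ ↦ T ^ (-(1 / 4) : ℝ) * (Real.log T) ^ (1 / 2 : ℝ) := by
  have hlog : ∀ᶠ T : ℝ in atTop, 1 ≤ Real.log T := Real.tendsto_log_atTop.eventually_ge_atTop 1
  have h1 := meanDirichlet_sub_diag_isBigO (σ := 1 / 2) (τ := 3 / 2) (e := -(1 / 4))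
    (by norm_num) (by norm_num) (by norm_num)
  have h2 := isBigO_of_le_saddle (e := -(1 / 4)) (by norm_num)
    (fun T hT ↦ diagSum_asymp_half hT)
  have h3 := (h1.add h2)
  have h4 : (fun T ↦ meanDirichlet (1 / 2) T - (1 / 2 * Real.log (T / (2 * Real.pi)) +
      (Real.eulerMascheroniConstant - 1 / 2))) =O[atTop] fun T : ℝ ↦ T ^ (-(1 / 4) : ℝ) :=
    h3.congr_left fun T ↦ by ring
  have hg : (fun T : ℝ ↦ T ^ (-(1 / 4) : ℝ)) =O[atTop]
      fun T : ℝ ↦ T ^ (-(1 / 4) : ℝ) * (Real.log T) ^ (1 / 2 : ℝ) := by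
    apply IsBigO.of_bound 1
    filter_upwards [hlog, eventually_gt_atTop 0] with T hT hT0
    have := Real.one_le_rpow hT (by norm_num : (0 : ℝ) ≤ 1 / 2)
    rw [one_mul, Real.norm_of_nonneg (by positivity), Real.norm_of_nonneg (by positivity)]
    exact le_mul_of_one_le_right (by positivity) this
  have hM : (fun T ↦ meanDirichlet (1 / 2) T) =O[atTop] Real.log := by
    have a1 : (fun T : ℝ ↦ T ^ (-(1 / 4) : ℝ)) =O[atTop] Real.log := by
      apply IsBigO.of_bound 1
      filter_upwards [hlog, eventually_ge_atTop 1] with T hT hT1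
      rw [one_mul, Real.norm_of_nonneg (by positivity), Real.norm_of_nonneg (by positivity)]
      exact (Real.rpow_le_one_of_one_le_of_nonpos hT1 (by norm_num)).trans hT
    have a2 : (fun T ↦ 1 / 2 * Real.log (T / (2 * Real.pi)) +
        (Real.eulerMascheroniConstant - 1 / 2)) =O[atTop] Real.log := by
      have b1 : (fun T ↦ 1 / 2 * Real.log T) =O[atTop] Real.log :=
        (isBigO_refl Real.log atTop).const_mul_left _
      have b2 : (fun _ : ℝ ↦ Real.eulerMascheroniConstant - 1 / 2 - 1 / 2 * Real.log (2 * Real.pi))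
          =O[atTop] Real.log :=
        Real.isLittleO_const_log_atTop.isBigO
      refine (b1.add b2).congr' ?_ EventuallyEq.rfl
      filter_upwards [eventually_gt_atTop 0] with T hT
      rw [Real.log_div hT.ne' (by positivity)]; ring
    exact ((h4.trans a1).add a2).congr_left fun T ↦ by ring
  have h5 : (fun T ↦ meanSquare (1 / 2) T - meanDirichlet (1 / 2) T) =O[atTop]
      fun T : ℝ ↦ T ^ (-(1 / 4) : ℝ) * (Real.log T) ^ (1 / 2 : ℝ) := by
    -- The balanced l for M = log T and V = T^(-1/2).
    refine meanSquare_sub_isBigO (l := fun T ↦ T ^ (-(1 / 4) : ℝ) * (Real.log T) ^ (-(1 / 2) : ℝ))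
      ?_ hM (isBigO_mean_weight (by norm_num)) ?_ ?_
    · filter_upwards [hlog, eventually_ge_atTop 1] with T hT hT1
      have c1 := Real.rpow_le_one_of_one_le_of_nonpos hT1 (by norm_num : (-(1 / 4) : ℝ) ≤ 0)
      have c2 := Real.rpow_le_one_of_one_le_of_nonpos hT (by norm_num : (-(1 / 2) : ℝ) ≤ 0)
      refine ⟨by positivity, mul_le_one₀ c1 (by positivity) c2⟩
    · refine (isBigO_refl _ _).congr' EventuallyEq.rfl ?_
      filter_upwards [hlog] with T hT
      rw [mul_assoc]; congr 1
      rw [← Real.rpow_add_one (by positivity)]; norm_num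
    · refine (isBigO_refl _ _).congr' EventuallyEq.rfl ?_
      filter_upwards [hlog, eventually_gt_atTop 0] with T hT hT0
      rw [mul_inv, ← Real.rpow_neg hT0.le, ← Real.rpow_neg (by positivity), mul_right_comm,
        ← Real.rpow_add hT0]
      norm_num
  exact (h5.add (h4.trans hg)).congr_left fun T ↦ by ring

lemma norm_dirichletSum_le (σ t : ℝ) :
    ‖dirichletSum σ t‖ ≤ ∑ n ∈ Finset.Icc 1 (cutoff t), (n : ℝ) ^ (-σ) := by
  refine (norm_sum_le _ _).trans (Finset.sum_le_sum fun n hn ↦ ?_)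
  rw [norm_natCast_cpow (Finset.mem_Icc.1 hn).1]

/-- For σ > 1 the Dirichlet sum is bounded pointwise, so the cross term is O(|E|) and the mean of (1
+ t)^(-σ/2) decides. The quadratic comparison would stop at T^(-1/2), since the integral of (1 +
t)^(-σ) stays bounded without decaying. -/
lemma exists_meanSquare_sub_le_of_one_lt {σ : ℝ} (hσ : 1 < σ) : ∃ K : ℝ, 0 ≤ K ∧ ∀ T : ℝ, 0 < T →
    |meanSquare σ T - meanDirichlet σ T| ≤ K * (1 / T * ∫ t in (0 : ℝ)..T, (1 + t) ^ (-(σ / 2))) := by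
  obtain ⟨K, hK, h⟩ := exists_remainder_bound |σ|
  obtain ⟨C, hC, hs⟩ := exists_sum_rpow_le_const (α := -σ) (by linarith)
  refine ⟨2 * C * K + K * K, by positivity, fun T hT ↦ ?_⟩
  have hw := intervalIntegrable_one_add_rpow (-(σ / 2)) le_rfl hT.le
  refine (abs_meanSquare_sub_le_of_bound hT
    (g := fun t ↦ (2 * C * K + K * K) * (1 + t) ^ (-(σ / 2))) (hw.const_mul _) fun t ht ↦ ?_).trans
    (le_of_eq ?_)
  · refine (norm_sq_sub_norm_sq_le _ _).trans ?_
    have hE := h σ t le_rfl ht.1.le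
    rw [neg_div] at hE
    have hS := (norm_dirichletSum_le σ t).trans (hs _)
    set E := ‖riemannAux (σ + t * Complex.I) - dirichletSum σ t‖ with hEdef
    set S := ‖dirichletSum σ t‖
    have hE0 : 0 ≤ E := norm_nonneg _
    have hw1 : (1 + t) ^ (-(σ / 2)) ≤ 1 :=
      Real.rpow_le_one_of_one_le_of_nonpos (by linarith [ht.1]) (by linarith)
    have hEK : E ≤ K := hE.trans (mul_le_of_le_one_right hK hw1)
    have h1 : S * E ≤ C * (K * (1 + t) ^ (-(σ / 2))) := mul_le_mul hS hE hE0 hC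
    have h2 : E * E ≤ K * (K * (1 + t) ^ (-(σ / 2))) := mul_le_mul hEK hE hE0 hK
    nlinarith
  · rw [intervalIntegral.integral_const_mul]; ring

theorem meanSquare_asymp_of_half_lt {σ : ℝ} (h0 : 1 / 2 < σ) (h1 : σ < 1) :
    ∃ z : ℝ, riemannZeta ((2 * σ : ℝ) : ℂ) = z ∧
      (fun T ↦ meanSquare σ T - z - leadCoeff σ * saddle T ^ (1 - 2 * σ)) =O[atTop]
        fun T : ℝ ↦ T ^ (-(σ / 2)) := by
  obtain ⟨z, hz, h⟩ := diagSum_asymp_of_pos (σ := σ) (by linarith) h1 (by linarith)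
  refine ⟨z, hz, ?_⟩
  have a1 := meanDirichlet_sub_diag_isBigO (σ := σ) (τ := 2 - σ) (e := -(σ / 2))
    (by linarith) (by linarith) (by ring)
  have a2 := isBigO_of_le_saddle (e := -(σ / 2)) (by linarith) h
  have a3 : (fun T ↦ meanDirichlet σ T) =O[atTop] fun T : ℝ ↦ T ^ (0 : ℝ) := by
    have := (((a1.add a2).trans (rpow_isBigO_rpow (by linarith : -(σ / 2) ≤ 0))).add
      ((leadTerm_isBigO σ).trans (rpow_isBigO_rpow (by linarith : 1 / 2 - σ ≤ 0)))).add
      (const_isBigO_rpow le_rfl z)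
    exact this.congr_left fun T ↦ by ring
  -- Now M = 1 and V = T^(-σ), so l = T^(-σ/2).
  have a4 := meanSquare_sub_isBigO (rpow_mem_Ioc (a := σ / 2) (by linarith)) a3
    (isBigO_mean_weight h1) (rpow_mul_rpow_isBigO (c := -(σ / 2)) (by linarith))
    (inv_rpow_mul_rpow_isBigO (by linarith))
  exact (a4.add (a1.add a2)).congr_left fun T ↦ by ring

lemma meanDirichlet_asymp_of_one_le {σ : ℝ} (h0 : 1 ≤ σ) :
    ∃ z : ℝ, riemannZeta ((2 * σ : ℝ) : ℂ) = z ∧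
      (fun T ↦ meanDirichlet σ T - z) =O[atTop] fun T : ℝ ↦ T ^ (-(min σ 2 / 2)) := by
  obtain ⟨z, C, hz, h⟩ := diagSum_asymp_of_one_le h0
  refine ⟨z, hz, ?_⟩
  have a2 := isBigO_of_le_saddle (e := -(min σ 2 / 2)) (by linarith) h
  have a1 : (fun T ↦ meanDirichlet σ T - diagSum σ T / T) =O[atTop]
      fun T : ℝ ↦ T ^ (-(min σ 2 / 2)) := by
    rcases lt_or_ge σ 2 with h2 | h2
    · rw [min_eq_left h2.le]
      exact meanDirichlet_sub_diag_isBigO (τ := 2 - σ) (by linarith) (by linarith) (by ring)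
    · rw [min_eq_right h2]
      simpa using meanDirichlet_sub_diag_isBigO_of_two_le h2
  exact (a1.add a2).congr_left fun T ↦ by ring

theorem meanSquare_asymp_one : ∃ z : ℝ, riemannZeta 2 = z ∧
    (fun T ↦ meanSquare 1 T - z) =O[atTop]
      fun T : ℝ ↦ T ^ (-(1 / 2) : ℝ) * (Real.log T) ^ (1 / 2 : ℝ) := by
  obtain ⟨z, hz, h⟩ := meanDirichlet_asymp_of_one_le (σ := 1) le_rfl
  refine ⟨z, by simpa using hz, ?_⟩
  rw [min_eq_left (by norm_num)] at h
  have hlog : ∀ᶠ T : ℝ in atTop, 1 ≤ Real.log T := Real.tendsto_log_atTop.eventually_ge_atTop 1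
  have hM : (fun T ↦ meanDirichlet 1 T) =O[atTop] fun _ : ℝ ↦ (1 : ℝ) := by
    have a1 := h.trans (rpow_isBigO_rpow (by norm_num : -(1 / 2) ≤ (0 : ℝ)))
    have := a1.add (const_isBigO_rpow le_rfl z)
    simpa using this
  have hg : (fun T : ℝ ↦ T ^ (-(1 / 2) : ℝ)) =O[atTop]
      fun T : ℝ ↦ T ^ (-(1 / 2) : ℝ) * (Real.log T) ^ (1 / 2 : ℝ) := by
    apply IsBigO.of_bound 1
    filter_upwards [hlog, eventually_gt_atTop 0] with T hT hT0
    have := Real.one_le_rpow hT (by norm_num : (0 : ℝ) ≤ 1 / 2)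
    rw [one_mul, Real.norm_of_nonneg (by positivity), Real.norm_of_nonneg (by positivity)]
    exact le_mul_of_one_le_right (by positivity) this
  have hV : (fun T : ℝ ↦ 1 / T * ∫ t in (0 : ℝ)..T, (1 + t) ^ (-1 : ℝ)) =O[atTop]
      fun T : ℝ ↦ 1 / T * Real.log T :=
    (isBigO_refl (fun T : ℝ ↦ 1 / T) atTop).mul isBigO_integral_one_add_inv
  have h5 : (fun T ↦ meanSquare 1 T - meanDirichlet 1 T) =O[atTop]
      fun T : ℝ ↦ T ^ (-(1 / 2) : ℝ) * (Real.log T) ^ (1 / 2 : ℝ) := by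
    -- The balanced l for M = 1 and V = log T / T.
    refine meanSquare_sub_isBigO (l := fun T ↦ T ^ (-(1 / 2) : ℝ) * (Real.log T) ^ (1 / 2 : ℝ))
      ?_ hM hV ?_ ?_
    · filter_upwards [hlog, eventually_ge_atTop 1] with T hT hT1
      have hT0 : 0 < T := by linarith
      refine ⟨by positivity, ?_⟩
      have c1 : (Real.log T) ^ (1 / 2 : ℝ) ≤ T ^ (1 / 2 : ℝ) :=
        Real.rpow_le_rpow (by linarith) (Real.log_le_self hT0.le) (by norm_num)
      calc _ ≤ T ^ (-(1 / 2) : ℝ) * T ^ (1 / 2 : ℝ) := mul_le_mul_of_nonneg_left c1 (by positivity)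
        _ = 1 := by rw [← Real.rpow_add hT0]; norm_num
    · simpa using isBigO_refl (fun T : ℝ ↦ T ^ (-(1 / 2) : ℝ) * (Real.log T) ^ (1 / 2 : ℝ)) atTop
    · refine (isBigO_refl _ _).congr' EventuallyEq.rfl ?_
      filter_upwards [hlog, eventually_gt_atTop 0] with T hT hT0
      have hL : 0 < Real.log T := by linarith
      have e1 : (1 : ℝ) / T = T ^ (-1 : ℝ) := by rw [Real.rpow_neg_one, one_div]
      have e2 : T ^ (1 / 2 : ℝ) * T ^ (-1 : ℝ) = T ^ (-(1 / 2) : ℝ) := by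
        rw [← Real.rpow_add hT0]; norm_num
      have e3 : (Real.log T) ^ (-(1 / 2) : ℝ) * Real.log T = (Real.log T) ^ (1 / 2 : ℝ) := by
        rw [← Real.rpow_add_one hL.ne']; norm_num
      rw [mul_inv, ← Real.rpow_neg hT0.le, ← Real.rpow_neg hL.le, neg_neg, e1, mul_mul_mul_comm, e2, e3]
  exact (h5.add (h.trans hg)).congr_left fun T ↦ by ring

theorem meanSquare_asymp_of_one_lt {σ : ℝ} (h0 : 1 < σ) (h2 : σ < 2) :
    ∃ z : ℝ, riemannZeta ((2 * σ : ℝ) : ℂ) = z ∧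
      (fun T ↦ meanSquare σ T - z) =O[atTop] fun T : ℝ ↦ T ^ (-(σ / 2)) := by
  obtain ⟨z, hz, h⟩ := meanDirichlet_asymp_of_one_le h0.le
  refine ⟨z, hz, ?_⟩
  rw [min_eq_left h2.le] at h
  obtain ⟨K, hK, hb⟩ := exists_meanSquare_sub_le_of_one_lt h0
  have a1 : (fun T ↦ meanSquare σ T - meanDirichlet σ T) =O[atTop] fun T : ℝ ↦ T ^ (-(σ / 2)) := by
    refine IsBigO.trans (IsBigO.of_bound K ?_) (isBigO_mean_weight (σ := σ / 2) (by linarith))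
    filter_upwards [eventually_gt_atTop 0] with T hT
    exact (hb T hT).trans (mul_le_mul_of_nonneg_left (le_abs_self _) hK)
  exact (a1.add h).congr_left fun T ↦ by ring

lemma isBigO_rpow_neg_one_of_le {f : ℝ → ℝ} {C : ℝ} (h : ∀ T, 0 < T → |f T| ≤ 1 / T * C) :
    f =O[atTop] fun T : ℝ ↦ T ^ (-1 : ℝ) := by
  apply IsBigO.of_bound C
  filter_upwards [eventually_gt_atTop 0] with T hT
  rw [Real.rpow_neg_one, Real.norm_eq_abs, Real.norm_of_nonneg (inv_nonneg.2 hT.le)]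
  refine (h T hT).trans (le_of_eq ?_)
  ring

/-- The integral of (1 + t)^(-σ/2) over the half-line is finite exactly for σ > 2, which is why σ =
2 needs a separate argument. -/
lemma meanSquare_sub_isBigO_of_two_lt {σ : ℝ} (h0 : 2 < σ) :
    (fun T ↦ meanSquare σ T - meanDirichlet σ T) =O[atTop] fun T : ℝ ↦ T ^ (-1 : ℝ) := by
  obtain ⟨K, hK, hb⟩ := exists_meanSquare_sub_le_of_one_lt (by linarith : 1 < σ)
  apply isBigO_rpow_neg_one_of_le (C := K * (1 / (σ / 2 - 1)))
  intro T hT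
  refine (hb T hT).trans ?_
  rw [mul_left_comm]
  apply mul_le_mul_of_nonneg_left _ (by positivity)
  exact mul_le_mul_of_nonneg_left (integral_one_add_rpow_le_of_one_lt (by linarith) hT.le) hK

/-! ### The borderline abscissa 2 -/

/-- The entire function `n ^ s * riemannAux s`. -/
def twistedAux (n : ℕ) (s : ℂ) : ℂ := Complex.exp (Real.log n * s) * riemannAux s

lemma differentiable_twistedAux (n : ℕ) : Differentiable ℂ (twistedAux n) := by
  unfold twistedAux
  exact Differentiable.mul (by fun_prop) differentiable_riemannAux

lemma norm_exp_log_mul {n : ℕ} (hn : 1 ≤ n) (s : ℂ) :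
    ‖Complex.exp (Real.log n * s)‖ = (n : ℝ) ^ s.re := by
  rw [Complex.norm_exp, Complex.re_ofReal_mul, Real.rpow_def_of_pos (by exact_mod_cast hn)]

/-- On the vertical line through σ, conjugation turns n^(-σ' - it) into n^(-σ - σ') n^s, which is
holomorphic in s; the pairing becomes a contour integral of `twistedAux`. -/
lemma riemannAux_mul_conj_cutTerm {n : ℕ} (hn : 1 ≤ n) (σ σ' : ℝ) :
    (fun t : ℝ ↦ riemannAux (σ + t * Complex.I) * conj (cutTerm σ' n t)) =
      (Ici (2 * Real.pi * (n : ℝ) ^ 2)).indicator fun t : ℝ ↦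
        (((n : ℝ) ^ (-σ - σ') : ℝ) : ℂ) * twistedAux n (σ + t * Complex.I) := by
  ext t
  have hn0 : (0 : ℝ) < n := by exact_mod_cast hn
  by_cases h : 2 * Real.pi * (n : ℝ) ^ 2 ≤ t
  · rw [cutTerm, indicator_of_mem (mem_Ici.2 h), indicator_of_mem (mem_Ici.2 h), natCast_cpow_eq hn,
      map_mul, ← Complex.exp_conj, Complex.conj_ofReal]
    simp only [map_mul, map_neg, Complex.conj_ofReal, Complex.conj_I]
    have e : Complex.exp (Real.log n * (σ + t * Complex.I)) =
        (((n : ℝ) ^ σ : ℝ) : ℂ) * Complex.exp (-(Real.log n * -Complex.I) * t) := by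
      rw [Real.rpow_def_of_pos hn0, Complex.ofReal_exp, ← Complex.exp_add]
      congr 1; push_cast; ring
    have e2 : (n : ℝ) ^ (-σ - σ') * (n : ℝ) ^ σ = (n : ℝ) ^ (-σ') := by
      rw [← Real.rpow_add hn0]; congr 1; ring
    rw [twistedAux, e, ← e2]
    push_cast
    ring
  · rw [cutTerm, indicator_of_notMem (mt mem_Ici.1 h), indicator_of_notMem (mt mem_Ici.1 h)]
    simp

lemma continuous_twistedAux_vertical (n : ℕ) (σ : ℝ) :
    Continuous fun t : ℝ ↦ twistedAux n (σ + t * Complex.I) :=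
  (differentiable_twistedAux n).continuous.comp (by fun_prop)

lemma intervalIntegrable_riemannAux_mul_conj_cutTerm {n : ℕ} (hn : 1 ≤ n) (σ σ' a b : ℝ) :
    IntervalIntegrable (fun t : ℝ ↦ riemannAux (σ + t * Complex.I) * conj (cutTerm σ' n t)) volume a b := by
  rw [riemannAux_mul_conj_cutTerm hn]
  exact intervalIntegrable_indicator_Ici ((continuous_twistedAux_vertical n σ).const_mul _)

lemma integral_riemannAux_mul_conj_cutTerm {n : ℕ} {T : ℝ} (hT : 0 ≤ T)
    (hn : n ∈ Finset.Icc 1 (cutoff T)) (σ σ' : ℝ) :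
    ∫ t in (0 : ℝ)..T, riemannAux (σ + t * Complex.I) * conj (cutTerm σ' n t) =
      (((n : ℝ) ^ (-σ - σ') : ℝ) : ℂ) *
        ∫ t in (2 * Real.pi * (n : ℝ) ^ 2)..T, twistedAux n (σ + t * Complex.I) := by
  rw [Finset.mem_Icc] at hn
  rw [riemannAux_mul_conj_cutTerm hn.1, integral_indicator_Ici (two_pi_sq_pos hn.1)
    ((le_cutoff_iff hn.1 hT).1 hn.2), intervalIntegral.integral_const_mul]

lemma exists_norm_riemannAux_le : ∃ C : ℝ, 0 ≤ C ∧ ∀ σ t : ℝ, 2 ≤ σ → σ ≤ 5 / 2 → 0 ≤ t →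
    ‖riemannAux (σ + t * Complex.I)‖ ≤ C := by
  obtain ⟨K, hK, h⟩ := exists_remainder_bound (5 / 2)
  obtain ⟨C, hC, hs⟩ := exists_sum_rpow_le_const (α := -2) (by norm_num)
  refine ⟨K + C, by positivity, fun σ t h2 h5 ht ↦ ?_⟩
  have h1 := h σ t (by rw [abs_of_nonneg (by linarith)]; exact h5) ht
  have h3 : K * (1 + t) ^ (-σ / 2) ≤ K := mul_le_of_le_one_right hK
    (Real.rpow_le_one_of_one_le_of_nonpos (by linarith) (by linarith))
  have h4 : ‖dirichletSum σ t‖ ≤ C := by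
    refine (norm_dirichletSum_le σ t).trans ((Finset.sum_le_sum fun n hn ↦ ?_).trans (hs (cutoff t)))
    exact Real.rpow_le_rpow_of_exponent_le (by exact_mod_cast (Finset.mem_Icc.1 hn).1) (by linarith)
  have h6 := norm_add_le (riemannAux (σ + t * Complex.I) - dirichletSum σ t) (dirichletSum σ t)
  rw [sub_add_cancel] at h6
  linarith

/-- Shift of the line of integration from abscissa `2` to abscissa `5 / 2`. -/
lemma exists_norm_shift_le : ∃ C : ℝ, 0 ≤ C ∧ ∀ (n : ℕ) (A T : ℝ), 1 ≤ n → 0 ≤ A → A ≤ T →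
    ‖(∫ t in A..T, twistedAux n ((2 : ℝ) + t * Complex.I)) -
      ∫ t in A..T, twistedAux n ((5 / 2 : ℝ) + t * Complex.I)‖ ≤ C * (n : ℝ) ^ (5 / 2 : ℝ) := by
  obtain ⟨C, hC, h⟩ := exists_norm_riemannAux_le
  refine ⟨C, hC, fun n A T hn hA hT ↦ ?_⟩
  have hrect := Complex.integral_boundary_rect_eq_zero_of_differentiableOn (twistedAux n)
    (⟨2, A⟩ : ℂ) (⟨5 / 2, T⟩ : ℂ) (differentiable_twistedAux n).differentiableOn
  simp only [smul_eq_mul] at hrect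
  have hside : ∀ y : ℝ, 0 ≤ y → ‖∫ x in (2 : ℝ)..(5 / 2), twistedAux n (x + y * Complex.I)‖ ≤
      (n : ℝ) ^ (5 / 2 : ℝ) * C * |5 / 2 - 2| := by
    intro y hy
    apply intervalIntegral.norm_integral_le_of_norm_le_const
    intro x hx
    rw [uIoc_of_le (by norm_num)] at hx
    rw [twistedAux, norm_mul, norm_exp_log_mul hn]
    apply mul_le_mul _ (h x y hx.1.le hx.2 hy) (norm_nonneg _) (by positivity)
    apply Real.rpow_le_rpow_of_exponent_le (by exact_mod_cast hn)
    simpa using hx.2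
  have e : (∫ t in A..T, twistedAux n ((2 : ℝ) + t * Complex.I)) -
      ∫ t in A..T, twistedAux n ((5 / 2 : ℝ) + t * Complex.I) =
      Complex.I * ((∫ x in (2 : ℝ)..(5 / 2), twistedAux n (x + T * Complex.I)) -
        ∫ x in (2 : ℝ)..(5 / 2), twistedAux n (x + A * Complex.I)) := by
    linear_combination Complex.I * hrect + ((∫ t in A..T, twistedAux n ((2 : ℝ) + t * Complex.I)) -
      ∫ t in A..T, twistedAux n ((5 / 2 : ℝ) + t * Complex.I)) * Complex.I_sq
  rw [e, norm_mul, Complex.norm_I, one_mul]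
  refine (norm_sub_le _ _).trans ((add_le_add (hside T (hA.trans hT)) (hside A hA)).trans ?_)
  norm_num
  apply le_of_eq; ring

/-- Taking abscissa 0 for the n-th factor makes the bound uniform in n: the inverse logarithm is at
most 2m, so the off-diagonal terms are summable in m alone. -/
lemma exists_norm_dirichlet_pairing_le : ∃ C : ℝ, 0 ≤ C ∧ ∀ (n : ℕ) (T : ℝ), 0 ≤ T →
    n ∈ Finset.Icc 1 (cutoff T) →
    IntervalIntegrable (fun t ↦ dirichletSum (5 / 2) t * conj (cutTerm 0 n t)) volume 0 T ∧
    ‖(∫ t in (0 : ℝ)..T, dirichletSum (5 / 2) t * conj (cutTerm 0 n t)) -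
      (((n : ℝ) ^ (-(5 / 2) : ℝ) * (T - 2 * Real.pi * n ^ 2) : ℝ) : ℂ)‖ ≤ C := by
  obtain ⟨C, hC, hs⟩ := exists_sum_rpow_le_const (α := -(3 / 2)) (by norm_num)
  refine ⟨4 * C, by positivity, fun n T hT hn ↦ ?_⟩
  have hn1 := (Finset.mem_Icc.1 hn).1
  have heq : ∀ t ∈ Icc 0 T, dirichletSum (5 / 2) t * conj (cutTerm 0 n t) =
      ∑ m ∈ Finset.Icc 1 (cutoff T), cutTerm (5 / 2) m t * conj (cutTerm 0 n t) := by
    intro t ht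
    rw [dirichletSum_eq_sum_cutTerm _ ht.1 ht.2, Finset.sum_mul]
  have hi : ∀ m ∈ Finset.Icc 1 (cutoff T),
      IntervalIntegrable (fun t ↦ cutTerm (5 / 2) m t * conj (cutTerm 0 n t)) volume 0 T :=
    fun m hm ↦ intervalIntegrable_pairing (Finset.mem_Icc.1 hm).1 hn1 _ _ _ _
  constructor
  · refine (intervalIntegrable_finset_sum hi).congr fun t ht ↦ ?_
    rw [uIoc_of_le hT] at ht
    exact (heq t ⟨ht.1.le, ht.2⟩).symm
  have e1 : ∫ t in (0 : ℝ)..T, dirichletSum (5 / 2) t * conj (cutTerm 0 n t) =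
      ∑ m ∈ Finset.Icc 1 (cutoff T), ∫ t in (0 : ℝ)..T, cutTerm (5 / 2) m t * conj (cutTerm 0 n t) := by
    rw [← intervalIntegral.integral_finsetSum hi]
    apply intervalIntegral.integral_congr
    intro t ht
    rw [uIcc_of_le hT] at ht
    exact heq t ht
  have e2 : (((n : ℝ) ^ (-(5 / 2) : ℝ) * (T - 2 * Real.pi * n ^ 2) : ℝ) : ℂ) =
      ∑ m ∈ Finset.Icc 1 (cutoff T), (((if m = n then (n : ℝ) ^ (-(5 / 2) : ℝ) * (n : ℝ) ^ (-0 : ℝ) *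
        (T - 2 * Real.pi * n ^ 2) else 0 : ℝ)) : ℂ) := by
    rw [← Complex.ofReal_sum, Finset.sum_ite_eq', if_pos hn]
    simp
  rw [e1, e2, ← Finset.sum_sub_distrib]
  refine (norm_sum_le _ _).trans ?_
  calc _ ≤ ∑ m ∈ Finset.Icc 1 (cutoff T), 4 * (m : ℝ) ^ (-(3 / 2) : ℝ) := by
        refine Finset.sum_le_sum fun m hm ↦ ?_
        refine (norm_pairing_sub_le hT hm hn (5 / 2) 0).trans ?_
        have hm1 := (Finset.mem_Icc.1 hm).1
        have hm0 : (0 : ℝ) < m := by exact_mod_cast hm1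
        have h1 := inv_abs_log_sub_le_two_mul_min hm1 hn1
        have h2 : ((min m n : ℕ) : ℝ) ≤ m := by exact_mod_cast min_le_left m n
        rw [neg_zero, Real.rpow_zero, mul_one]
        have e : (m : ℝ) ^ (-(3 / 2) : ℝ) = (m : ℝ) ^ (-(5 / 2) : ℝ) * m := by
          rw [← Real.rpow_add_one hm0.ne']; norm_num
        rw [e]
        have h3 : |Real.log n - Real.log m|⁻¹ ≤ 2 * m := by linarith
        have := mul_le_mul_of_nonneg_left h3 (by positivity : 0 ≤ (m : ℝ) ^ (-(5 / 2) : ℝ))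
        linarith
    _ ≤ _ := by
        rw [← Finset.mul_sum]
        exact mul_le_mul_of_nonneg_left (hs _) (by norm_num)

lemma norm_cutTerm_zero_le {n : ℕ} (hn : 1 ≤ n) (t : ℝ) : ‖cutTerm 0 n t‖ ≤ 1 := by
  unfold cutTerm
  refine (norm_indicator_le_norm_self _ _).trans (le_of_eq ?_)
  rw [norm_natCast_cpow hn]; simp

/-- At abscissa 5/2 the remainder is O((1 + t)^(-5/4)), hence integrable, and the auxiliary function
can replace its Dirichlet polynomial at bounded cost. -/
lemma exists_norm_aux_pairing_le : ∃ C : ℝ, 0 ≤ C ∧ ∀ (n : ℕ) (T : ℝ), 0 ≤ T →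
    n ∈ Finset.Icc 1 (cutoff T) →
    ‖(∫ t in (0 : ℝ)..T, riemannAux ((5 / 2 : ℝ) + t * Complex.I) * conj (cutTerm 0 n t)) -
      (((n : ℝ) ^ (-(5 / 2) : ℝ) * (T - 2 * Real.pi * n ^ 2) : ℝ) : ℂ)‖ ≤ C := by
  obtain ⟨C, hC, h⟩ := exists_norm_dirichlet_pairing_le
  obtain ⟨K, hK, hE⟩ := exists_remainder_bound (5 / 2)
  refine ⟨K * (1 / (5 / 4 - 1)) + C, by positivity, fun n T hT hn ↦ ?_⟩
  have hn1 := (Finset.mem_Icc.1 hn).1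
  obtain ⟨hi, hb⟩ := h n T hT hn
  have hj := intervalIntegrable_riemannAux_mul_conj_cutTerm hn1 (5 / 2) 0 0 T
  have h1 : ‖∫ t in (0 : ℝ)..T, (riemannAux ((5 / 2 : ℝ) + t * Complex.I) * conj (cutTerm 0 n t) -
      dirichletSum (5 / 2) t * conj (cutTerm 0 n t))‖ ≤ K * (1 / (5 / 4 - 1)) := by
    have hw := intervalIntegrable_one_add_rpow (-(5 / 4)) le_rfl hT
    refine (intervalIntegral.norm_integral_le_of_norm_le hT (g := fun t ↦ K * (1 + t) ^ (-(5 / 4) : ℝ))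
      (Eventually.of_forall fun t ht ↦ ?_) (hw.const_mul K)).trans ?_
    · rw [← sub_mul, norm_mul, RCLike.norm_conj]
      have := hE (5 / 2) t (by rw [abs_of_pos (by norm_num)]) ht.1.le
      refine (mul_le_of_le_one_right (norm_nonneg _) (norm_cutTerm_zero_le hn1 t)).trans (this.trans ?_)
      norm_num
    · rw [intervalIntegral.integral_const_mul]
      exact mul_le_mul_of_nonneg_left (integral_one_add_rpow_le_of_one_lt (by norm_num) hT) hK
  rw [intervalIntegral.integral_sub hj hi] at h1
  refine le_trans ?_ (add_le_add h1 hb)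
  refine le_trans (le_of_eq (congrArg _ ?_)) (norm_add_le _ _)
  ring

/-- An intermediate abscissa b > 2 makes the remainder integrable and the sum of m^(1 - b) converge.
Returning to abscissa 2 costs n^(b - 4), summable for b < 3. The value b = 5/2 gives n^(-3/2). -/
lemma exists_norm_aux_pairing_two_le : ∃ C : ℝ, 0 ≤ C ∧ ∀ (n : ℕ) (T : ℝ), 0 ≤ T →
    n ∈ Finset.Icc 1 (cutoff T) →
    ‖(∫ t in (0 : ℝ)..T, riemannAux ((2 : ℝ) + t * Complex.I) * conj (cutTerm 2 n t)) -
      (((n : ℝ) ^ (-2 : ℝ) * (n : ℝ) ^ (-2 : ℝ) * (T - 2 * Real.pi * n ^ 2) : ℝ) : ℂ)‖ ≤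
        C * (n : ℝ) ^ (-(3 / 2) : ℝ) := by
  obtain ⟨C₁, hC₁, h₁⟩ := exists_norm_aux_pairing_le
  obtain ⟨C₂, hC₂, h₂⟩ := exists_norm_shift_le
  refine ⟨C₁ + C₂, by positivity, fun n T hT hn ↦ ?_⟩
  have hn1 := (Finset.mem_Icc.1 hn).1
  have hn0 : (0 : ℝ) < n := by exact_mod_cast hn1
  have hTn := (le_cutoff_iff hn1 hT).1 (Finset.mem_Icc.1 hn).2
  have a1 := h₁ n T hT hn
  have a2 := h₂ n (2 * Real.pi * n ^ 2) T hn1 (by positivity) hTn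
  rw [integral_riemannAux_mul_conj_cutTerm hT hn] at a1 ⊢
  set F₂ := ∫ t in (2 * Real.pi * (n : ℝ) ^ 2)..T, twistedAux n ((2 : ℝ) + t * Complex.I)
  set F₅ := ∫ t in (2 * Real.pi * (n : ℝ) ^ 2)..T, twistedAux n ((5 / 2 : ℝ) + t * Complex.I)
  set D := T - 2 * Real.pi * (n : ℝ) ^ 2
  have e1 : (n : ℝ) ^ (-2 : ℝ) * (n : ℝ) ^ (-2 : ℝ) = (n : ℝ) ^ (-4 : ℝ) := by
    rw [← Real.rpow_add hn0]; norm_num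
  have e2 : (n : ℝ) ^ (-4 : ℝ) = (n : ℝ) ^ (-(3 / 2) : ℝ) * (n : ℝ) ^ (-(5 / 2) : ℝ) := by
    rw [← Real.rpow_add hn0]; norm_num
  have e3 : (n : ℝ) ^ (-4 : ℝ) * (n : ℝ) ^ (5 / 2 : ℝ) = (n : ℝ) ^ (-(3 / 2) : ℝ) := by
    rw [← Real.rpow_add hn0]; norm_num
  have e4 : (-2 - 2 : ℝ) = -4 := by norm_num
  have e5 : (-(5 / 2) - 0 : ℝ) = -(5 / 2) := by norm_num
  rw [e5] at a1
  rw [e4, e1]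
  -- The first summand is the shift, bounded by n^(-4) n^(5/2); the second is n^(-3/2) times the
  -- bounded error at abscissa 5/2.
  have e6 : (((n : ℝ) ^ (-4 : ℝ) : ℝ) : ℂ) * F₂ - (((n : ℝ) ^ (-4 : ℝ) * D : ℝ) : ℂ) =
      (((n : ℝ) ^ (-4 : ℝ) : ℝ) : ℂ) * (F₂ - F₅) + (((n : ℝ) ^ (-(3 / 2) : ℝ) : ℝ) : ℂ) *
        ((((n : ℝ) ^ (-(5 / 2) : ℝ) : ℝ) : ℂ) * F₅ - (((n : ℝ) ^ (-(5 / 2) : ℝ) * D : ℝ) : ℂ)) := by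
    rw [e2]; push_cast; ring
  rw [e6]
  refine (norm_add_le _ _).trans ?_
  rw [norm_mul, norm_mul, Complex.norm_real, Complex.norm_real, Real.norm_of_nonneg (by positivity),
    Real.norm_of_nonneg (by positivity)]
  have b1 := mul_le_mul_of_nonneg_left a2 (by positivity : 0 ≤ (n : ℝ) ^ (-4 : ℝ))
  have b2 := mul_le_mul_of_nonneg_left a1 (by positivity : 0 ≤ (n : ℝ) ^ (-(3 / 2) : ℝ))
  rw [mul_left_comm, e3] at b1
  linarith

lemma exists_norm_cross_sub_le : ∃ C : ℝ, 0 ≤ C ∧ ∀ T : ℝ, 0 ≤ T →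
    IntervalIntegrable (fun t : ℝ ↦ riemannAux ((2 : ℝ) + t * Complex.I) * conj (dirichletSum 2 t))
      volume 0 T ∧
    ‖(∫ t in (0 : ℝ)..T, riemannAux ((2 : ℝ) + t * Complex.I) * conj (dirichletSum 2 t)) -
      (diagSum 2 T : ℂ)‖ ≤ C := by
  obtain ⟨C₁, hC₁, h₁⟩ := exists_norm_aux_pairing_two_le
  obtain ⟨C, hC, hs⟩ := exists_sum_rpow_le_const (α := -(3 / 2)) (by norm_num)
  refine ⟨C₁ * C, by positivity, fun T hT ↦ ?_⟩
  have heq : ∀ t ∈ Icc 0 T, riemannAux ((2 : ℝ) + t * Complex.I) * conj (dirichletSum 2 t) =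
      ∑ n ∈ Finset.Icc 1 (cutoff T), riemannAux ((2 : ℝ) + t * Complex.I) * conj (cutTerm 2 n t) := by
    intro t ht
    rw [dirichletSum_eq_sum_cutTerm _ ht.1 ht.2, map_sum, Finset.mul_sum]
  have hi : ∀ n ∈ Finset.Icc 1 (cutoff T), IntervalIntegrable
      (fun t : ℝ ↦ riemannAux ((2 : ℝ) + t * Complex.I) * conj (cutTerm 2 n t)) volume 0 T :=
    fun n hn ↦ intervalIntegrable_riemannAux_mul_conj_cutTerm (Finset.mem_Icc.1 hn).1 _ _ _ _
  constructor
  · refine (intervalIntegrable_finset_sum hi).congr fun t ht ↦ ?_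
    rw [uIoc_of_le hT] at ht
    exact (heq t ⟨ht.1.le, ht.2⟩).symm
  have e1 : ∫ t in (0 : ℝ)..T, riemannAux ((2 : ℝ) + t * Complex.I) * conj (dirichletSum 2 t) =
      ∑ n ∈ Finset.Icc 1 (cutoff T), ∫ t in (0 : ℝ)..T,
        riemannAux ((2 : ℝ) + t * Complex.I) * conj (cutTerm 2 n t) := by
    rw [← intervalIntegral.integral_finsetSum hi]
    apply intervalIntegral.integral_congr
    intro t ht
    rw [uIcc_of_le hT] at ht
    exact heq t ht
  rw [e1, diagSum, Complex.ofReal_sum, ← Finset.sum_sub_distrib]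
  refine (norm_sum_le _ _).trans ((Finset.sum_le_sum fun n hn ↦ h₁ n T hT hn).trans ?_)
  rw [← Finset.mul_sum]
  exact mul_le_mul_of_nonneg_left (hs _) hC₁

/-- The cross term here contains a itself rather than a - b. With a = R and b = S, the three terms
are the evaluated pairing, the mean square of S and the integral of |E|². -/
lemma norm_sq_eq_cross (a b : ℂ) : ‖a‖ ^ 2 = 2 * (a * conj b).re - ‖b‖ ^ 2 + ‖a - b‖ ^ 2 := by
  simp only [← Complex.normSq_eq_norm_sq, Complex.normSq_apply, Complex.mul_re, Complex.conj_re,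
    Complex.conj_im, Complex.sub_re, Complex.sub_im]
  ring

/-- Twice the cross term minus the mean square of S leaves one copy of the diagonal up to O(1), and
|E|² is O((1 + t)^(-2)), whose integral is bounded. -/
lemma meanSquare_two_sub_isBigO :
    (fun T ↦ meanSquare 2 T - diagSum 2 T / T) =O[atTop] fun T : ℝ ↦ T ^ (-1 : ℝ) := by
  obtain ⟨C₁, hC₁, h₁⟩ := exists_norm_cross_sub_le
  obtain ⟨C₂, hC₂, h₂⟩ := exists_offDiagSum_le_const (le_refl (2 : ℝ))
  obtain ⟨K, hK, hE⟩ := exists_remainder_bound 2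
  apply isBigO_rpow_neg_one_of_le (C := 2 * C₁ + 2 * C₂ + K ^ 2 * (1 / (2 - 1)))
  intro T hT
  obtain ⟨hi, hb⟩ := h₁ T hT.le
  have hS := intervalIntegrable_normSq_dirichletSum 2 hT.le
  have hR : IntervalIntegrable (fun t : ℝ ↦ ‖riemannAux ((2 : ℝ) + t * Complex.I)‖ ^ 2) volume 0 T :=
    ((continuous_riemannAux_vertical 2).norm.pow 2).intervalIntegrable _ _
  have hire : IntervalIntegrable
      (fun t : ℝ ↦ (riemannAux ((2 : ℝ) + t * Complex.I) * conj (dirichletSum 2 t)).re) volume 0 T := by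
    rw [intervalIntegrable_iff] at hi ⊢
    exact hi.re
  have hre : ∫ t in (0 : ℝ)..T, (riemannAux ((2 : ℝ) + t * Complex.I) * conj (dirichletSum 2 t)).re =
      (∫ t in (0 : ℝ)..T, riemannAux ((2 : ℝ) + t * Complex.I) * conj (dirichletSum 2 t)).re :=
    intervalIntegral.intervalIntegral_re hi
  have hE2 : IntervalIntegrable (fun t : ℝ ↦
      ‖riemannAux ((2 : ℝ) + t * Complex.I) - dirichletSum 2 t‖ ^ 2) volume 0 T := by
    refine (((hR.sub (hire.const_mul 2)).add hS)).congr fun t _ ↦ ?_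
    have := norm_sq_eq_cross (riemannAux ((2 : ℝ) + t * Complex.I)) (dirichletSum 2 t)
    linarith
  have hw := intervalIntegrable_one_add_rpow (-2) le_rfl hT.le
  have hEint : |∫ t in (0 : ℝ)..T, ‖riemannAux ((2 : ℝ) + t * Complex.I) - dirichletSum 2 t‖ ^ 2| ≤
      K ^ 2 * (1 / (2 - 1)) := by
    rw [← Real.norm_eq_abs]
    refine (intervalIntegral.norm_integral_le_of_norm_le hT.le
      (g := fun t ↦ K ^ 2 * (1 + t) ^ (-2 : ℝ))
      (Eventually.of_forall fun t ht ↦ ?_) (hw.const_mul _)).trans ?_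
    · rw [Real.norm_of_nonneg (by positivity)]
      have h := hE 2 t (by norm_num) ht.1.le
      refine (pow_le_pow_left₀ (norm_nonneg _) h 2).trans (le_of_eq ?_)
      have h1t : 0 ≤ 1 + t := by linarith [ht.1]
      rw [mul_pow, ← Real.rpow_natCast ((1 + t) ^ (-2 / 2 : ℝ)), ← Real.rpow_mul h1t]
      norm_num
    · rw [intervalIntegral.integral_const_mul]
      exact mul_le_mul_of_nonneg_left (integral_one_add_rpow_le_of_one_lt (by norm_num) hT.le)
        (by positivity)
  have hmain : ∫ t in (0 : ℝ)..T, ‖riemannAux ((2 : ℝ) + t * Complex.I)‖ ^ 2 =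
      2 * (∫ t in (0 : ℝ)..T, riemannAux ((2 : ℝ) + t * Complex.I) * conj (dirichletSum 2 t)).re -
      (∫ t in (0 : ℝ)..T, ‖dirichletSum 2 t‖ ^ 2) +
      ∫ t in (0 : ℝ)..T, ‖riemannAux ((2 : ℝ) + t * Complex.I) - dirichletSum 2 t‖ ^ 2 := by
    rw [← hre, ← intervalIntegral.integral_const_mul, ← intervalIntegral.integral_sub
      (hire.const_mul 2) hS, ← intervalIntegral.integral_add ((hire.const_mul 2).sub hS) hE2]
    exact intervalIntegral.integral_congr fun t _ ↦ norm_sq_eq_cross _ _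
  have hb1 : |(∫ t in (0 : ℝ)..T, riemannAux ((2 : ℝ) + t * Complex.I) * conj (dirichletSum 2 t)).re -
      diagSum 2 T| ≤ C₁ := by
    have := Complex.abs_re_le_norm ((∫ t in (0 : ℝ)..T,
      riemannAux ((2 : ℝ) + t * Complex.I) * conj (dirichletSum 2 t)) - (diagSum 2 T : ℂ))
    rw [Complex.sub_re, Complex.ofReal_re] at this
    exact this.trans hb
  have hb2 := abs_integral_normSq_dirichletSum_sub_le 2 hT.le
  have hb3 := h₂ (cutoff T)
  have e : meanSquare 2 T - diagSum 2 T / T =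
      1 / T * ((∫ t in (0 : ℝ)..T, ‖riemannAux ((2 : ℝ) + t * Complex.I)‖ ^ 2) - diagSum 2 T) := by
    unfold meanSquare; ring
  rw [e, abs_mul, abs_of_pos (by positivity : 0 < 1 / T), hmain]
  apply mul_le_mul_of_nonneg_left _ (by positivity)
  rw [abs_le] at *
  constructor <;> linarith [hb1.1, hb1.2, hb2.1, hb2.2, hEint.1, hEint.2]

theorem meanSquare_asymp_of_two_le {σ : ℝ} (h2 : 2 ≤ σ) :
    ∃ z : ℝ, riemannZeta ((2 * σ : ℝ) : ℂ) = z ∧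
      (fun T ↦ meanSquare σ T - z) =O[atTop] fun T : ℝ ↦ T ^ (-1 : ℝ) := by
  obtain ⟨z, hz, h⟩ := meanDirichlet_asymp_of_one_le (σ := σ) (by linarith)
  refine ⟨z, hz, ?_⟩
  rw [min_eq_right h2] at h
  have h' : (fun T ↦ meanDirichlet σ T - z) =O[atTop] fun T : ℝ ↦ T ^ (-1 : ℝ) := by simpa using h
  have a1 : (fun T ↦ meanSquare σ T - meanDirichlet σ T) =O[atTop] fun T : ℝ ↦ T ^ (-1 : ℝ) := by
    -- At σ = 2 both mean squares are compared with the diagonal; beyond 2 they are compared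
    -- directly.
    rcases h2.eq_or_lt with rfl | h3
    · exact (meanSquare_two_sub_isBigO.sub (meanDirichlet_sub_diag_isBigO_of_two_le le_rfl)).congr_left
        fun T ↦ by ring
    · exact meanSquare_sub_isBigO_of_two_lt h3
  exact (a1.add h').congr_left fun T ↦ by ring

end

end SiegelAux

/-! ### Assembly of the seven ranges -/

theorem theorem4 (σ : ℝ) :
    (σ ≤ 1 / 4 →
      (fun T : ℝ => meanSquare σ T
          - 2 / ((1 - 2 * σ) * (3 - 2 * σ)) * (T / (2 * Real.pi)) ^ (1 / 2 - σ))
        =O[atTop] fun T : ℝ => T ^ (1 / 4 - σ)) ∧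
    (1 / 4 < σ → σ < 1 / 2 →
      (fun T : ℝ => (meanSquare σ T : ℂ)
          - ((2 / ((1 - 2 * σ) * (3 - 2 * σ)) * (T / (2 * Real.pi)) ^ (1 / 2 - σ) : ℝ) : ℂ)
          - riemannZeta (2 * (σ : ℂ)))
        =O[atTop] fun T : ℝ => T ^ (1 / 4 - σ)) ∧
    (σ = 1 / 2 →
      (fun T : ℝ => meanSquare σ T
          - (1 / 2 * Real.log (T / (2 * Real.pi)) + (Real.eulerMascheroniConstant - 1 / 2)))
        =O[atTop] fun T : ℝ => T ^ (-(1 / 4) : ℝ) * (Real.log T) ^ (1 / 2 : ℝ)) ∧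
    (1 / 2 < σ → σ < 1 →
      (fun T : ℝ => (meanSquare σ T : ℂ)
          - riemannZeta (2 * (σ : ℂ))
          - ((2 / ((1 - 2 * σ) * (3 - 2 * σ)) * (T / (2 * Real.pi)) ^ (1 / 2 - σ) : ℝ) : ℂ))
        =O[atTop] fun T : ℝ => T ^ (-(σ / 2))) ∧
    (σ = 1 →
      (fun T : ℝ => (meanSquare σ T : ℂ) - riemannZeta 2)
        =O[atTop] fun T : ℝ => T ^ (-(1 / 2) : ℝ) * (Real.log T) ^ (1 / 2 : ℝ)) ∧
    (1 < σ → σ < 2 →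
      (fun T : ℝ => (meanSquare σ T : ℂ) - riemannZeta (2 * (σ : ℂ)))
        =O[atTop] fun T : ℝ => T ^ (-(σ / 2))) ∧
    (2 ≤ σ →
      (fun T : ℝ => (meanSquare σ T : ℂ) - riemannZeta (2 * (σ : ℂ)))
        =O[atTop] fun T : ℝ => T ^ (-1 : ℝ)) := by
  have hcast : ((2 * σ : ℝ) : ℂ) = 2 * (σ : ℂ) := by push_cast; rfl
  have hlead := SiegelAux.leadTerm_eq σ
  refine ⟨fun h ↦ ?_, fun h1 h2 ↦ ?_, fun h ↦ ?_, fun h1 h2 ↦ ?_, fun h ↦ ?_, fun h1 h2 ↦ ?_,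
    fun h ↦ ?_⟩
  · refine (SiegelAux.meanSquare_asymp_of_le_quarter h).congr' ?_ EventuallyEq.rfl
    filter_upwards [hlead] with T hT
    rw [hT]
  · obtain ⟨z, hz, hO⟩ := SiegelAux.meanSquare_asymp_of_lt_half_of_quarter_lt h1 h2
    rw [← hcast, hz]
    refine (Complex.isBigO_ofReal_left.2 hO).congr' ?_ EventuallyEq.rfl
    filter_upwards [hlead] with T hT
    rw [hT]; push_cast; ring
  · subst h
    exact SiegelAux.meanSquare_asymp_half
  · obtain ⟨z, hz, hO⟩ := SiegelAux.meanSquare_asymp_of_half_lt h1 h2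
    rw [← hcast, hz]
    refine (Complex.isBigO_ofReal_left.2 hO).congr' ?_ EventuallyEq.rfl
    filter_upwards [hlead] with T hT
    rw [hT]; push_cast; ring
  · subst h
    obtain ⟨z, hz, hO⟩ := SiegelAux.meanSquare_asymp_one
    rw [hz]
    exact (Complex.isBigO_ofReal_left.2 hO).congr_left fun T ↦ by push_cast; ring
  · obtain ⟨z, hz, hO⟩ := SiegelAux.meanSquare_asymp_of_one_lt h1 h2
    rw [← hcast, hz]
    exact (Complex.isBigO_ofReal_left.2 hO).congr_left fun T ↦ by push_cast; ring
  · obtain ⟨z, hz, hO⟩ := SiegelAux.meanSquare_asymp_of_two_le h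
    rw [← hcast, hz]
    exact (Complex.isBigO_ofReal_left.2 hO).congr_left fun T ↦ by push_cast; ring
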